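/- Let $n\ge 1$, let $\mathbb{R}_n$ be the real Clifford algebra with imaginary units $e_1,\dots,e_n$ ($e_i^2=-1$, $e_ie_j=-e_je_i$ for $i\neq j$), with $|s|^2=\sum_A s_A^2$ for $s=\sum_A s_Ae_A$, and identify $\mathbb{R}^{n+1}$ with the paravectors $s=s_0+s_1e_1+\dots+s_ne_n$. Let $\mathbb{S}$ be the set of paravectors with $s_0=0$, $|s|=1$, and for $J\in\mathbb{S}$ let $\mathbb{C}_J=\{x+Jy: x,y\in\mathbb{R}\}$. For $\omega\in(0,\frac{\pi}{2})$ put $I_\omega=(-\omega,\omega)\cup(\pi-\omega,\pi+\omega)$ and $D_\omega=\{te^{J\alpha}: t>0,\ J\in\mathbb{S},\ \alpha\in I_\omega\}$. Operators. Let $V_{\mathbb{R}}$ be a real Banach space and $V=\{\sum_A v_A\otimes e_A\}$ the Clifford module over it, with $\|v\|^2=\sum_A\|v_A\|^2$ and the natural left and right multiplications by $\mathbb{R}_n$. Let $T:\operatorname{dom}(T)\to V$ be a closed right-linear operator with two-sided linear domain. For a real polynomial $p$ of degree $N$ put $p[T]=\sum_{k\le N}p_kT^k$ with $\operatorname{dom}(p[T])=\operatorname{dom}(T^N)$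 (and $0[T]=0$ on $V$). Put $Q_s[T]=T^2-2s_0T+|s|^2$ for paravectors $s$, let $\rho_S(T)$ be the set of paravectors $s$ for which $Q_s[T]$ has an everywhere defined bounded inverse, $\sigma_S(T)=\mathbb{R}^{n+1}\setminus\rho_S(T)$, and $S_L^{-1}(s,T)=Q_s[T]^{-1}\overline{s}-TQ_s[T]^{-1}$ for $s\in\rho_S(T)$. Assume that $T$ is bisectorial of angle $\omega\in(0,\frac{\pi}{2})$: $\sigma_S(T)\subseteq\overline{D_\omega}$, and for every $\varphi\in(\omega,\frac{\pi}{2})$ there is $C_\varphi\ge0$ with $\|S_L^{-1}(s,T)\|\le C_\varphi/|s|$ for all paravectors $s\notin D_\varphi\cup\{0\}$. Function spaces. For $\theta\in(0,\frac{\pi}{2})$, a function $f:D_\theta\to\mathbb{R}_n$ is left slice hyperholomorphic if $f(x+Jy)=f_0(x,y)+Jf_1(x,y)$ for all $J\in\mathbb{S}$, where $f_0,f_1$ are continuously differentiable $\mathbb{R}_n$-valued functions on $\{(x,y): x+\mathbb{S}y\subseteq D_\theta\}$, even resp. odd in $y$, with $\partial_xf_0=\partial_yf_1$ and $\partial_yf_0=-\partial_xf_1$;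 it is intrinsic, $f\in\mathcal{N}(D_\theta)$, if $f_0,f_1$ can be taken real valued. $\mathcal{SH}_L^0(D_\theta)$ (resp. $\mathcal{N}^0(D_\theta)$) consists of the bounded left slice hyperholomorphic (resp. intrinsic) functions with $\int_0^\infty|f(te^{J\phi})|\frac{dt}{t}<\infty$ for all $J\in\mathbb{S}$, $\phi\in I_\theta$. $\mathcal{SH}_L^{\rm bnd}(D_\theta)$ (resp. $\mathcal{N}^{\rm bnd}(D_\theta)$) consists of the functions $f(s)=f_\infty+(1+s^2)^{-1}(f_0-f_\infty)+\widetilde f(s)$ with $f_0,f_\infty\in\mathbb{R}_n$, $\widetilde f\in\mathcal{SH}_L^0(D_\theta)$ (resp. $f_0,f_\infty\in\mathbb{R}$, $\widetilde f\in\mathcal{N}^0(D_\theta)$); $f_0,f_\infty,\widetilde f$ are determined by $f$. Functional calculi. Let $\theta\in(\omega,\frac{\pi}{2})$. For $f\in\mathcal{SH}_L^{\rm bnd}(D_\theta)$, $\varphi\in(\omega,\theta)$ and $J\in\mathbb{S}$ put $$f(T)=f_\infty+(1+T^2)^{-1}(f_0-f_\infty)+\frac{1}{2\pi}\int_{\partial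 D_\varphi\cap\mathbb{C}_J}S_L^{-1}(s,T)\,ds_J\,\widetilde f(s),\qquad ds_J=\tfrac{ds}{J},$$ with $\partial D_\varphi\cap\mathbb{C}_J$ positively oriented. A regularizer of $f$ is a function $e\in\mathcal{N}^{\rm bnd}(D_\theta)$ with $ef\in\mathcal{SH}_L^{\rm bnd}(D_\theta)$ and $e(T)$ injective, and then the $H^\infty$-functional calculus is $f(T):=e(T)^{-1}(ef)(T)$. $\mathcal{N}^{\rm reg}(D_\theta)$ is the set of $g\in\mathcal{N}(D_\theta)$ for which there is $e\in\mathcal{N}^{\rm bnd}(D_\theta)$ with $eg\in\mathcal{N}^{\rm bnd}(D_\theta)$ and $e(T)$ injective. **Theorem.** Let $p,q$ be polynomials with real coefficients such that $q$ has no zeros in $\overline{D_\omega}$. Then $q[T]:\operatorname{dom}(q[T])\to V$ is bijective, and there exists $\theta\in(\omega,\frac{\pi}{2})$ such that $\frac pq\in\mathcal{N}^{\rm reg}(D_\theta)$ and $$\Big(\frac pq\Big)(T)=p[T]\,q[T]^{-1}$$ as an equality of operators including their domains, for every choice of the angle $\varphi\in(\omega,\theta)$, the imaginary unit $J\in\mathbb{S}$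 and the regularizer used to compute the left-hand side. -/

import Mathlib

noncomputable section

namespace HInfty

/-! ### The real Clifford algebra -/

/-- The sign in `e_A e_B = sgn A B • e_{A ∆ B}` for ordered products of the imaginary units:
one factor `-1` for every pair `a ∈ A`, `b ∈ B` with `b < a` (a transposition) or `b = a`
(since `e_a ^ 2 = -1`). -/
def sgn {n : ℕ} (A B : Finset (Fin n)) : ℝ :=
  ∏ a ∈ A, ∏ b ∈ B, if b ≤ a then (-1 : ℝ) else 1

theorem prod_symmDiff_of_sq {ι : Type*} [DecidableEq ι] (f : ι → ℝ) (hf : ∀ i, f i * f i = 1)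
    (A B : Finset ι) : ∏ i ∈ symmDiff A B, f i = (∏ i ∈ A, f i) * ∏ i ∈ B, f i := by
  have h1 : ∏ i ∈ A, f i = (∏ i ∈ A \ B, f i) * ∏ i ∈ A ∩ B, f i := by
    rw [mul_comm, Finset.prod_inter_mul_prod_sdiff]
  have h2 : ∏ i ∈ B, f i = (∏ i ∈ B \ A, f i) * ∏ i ∈ A ∩ B, f i := by
    rw [mul_comm, Finset.inter_comm, Finset.prod_inter_mul_prod_sdiff]
  have h3 : (∏ i ∈ A ∩ B, f i) * ∏ i ∈ A ∩ B, f i = 1 := by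
    rw [← Finset.prod_mul_distrib]; exact Finset.prod_eq_one fun i _ => hf i
  have h4 : ∏ i ∈ symmDiff A B, f i = (∏ i ∈ A \ B, f i) * ∏ i ∈ B \ A, f i := by
    rw [symmDiff_def, Finset.sup_eq_union, Finset.prod_union]
    exact Finset.disjoint_left.mpr fun i hi hj => by
      simp only [Finset.mem_sdiff] at hi hj; exact hi.2 hj.1
  rw [h1, h2, h4]
  linear_combination (-(∏ i ∈ A \ B, f i) * ∏ i ∈ B \ A, f i) * h3

theorem sgn_mul_self {n : ℕ} (A B : Finset (Fin n)) : sgn A B * sgn A B = 1 := by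
  unfold sgn
  rw [← Finset.prod_mul_distrib]
  refine Finset.prod_eq_one fun a _ => ?_
  rw [← Finset.prod_mul_distrib]
  refine Finset.prod_eq_one fun b _ => ?_
  split_ifs <;> norm_num

theorem sgn_symmDiff_left {n : ℕ} (A A' B : Finset (Fin n)) :
    sgn (symmDiff A A') B = sgn A B * sgn A' B := by
  unfold sgn
  refine prod_symmDiff_of_sq _ (fun a => ?_) A A'
  rw [← Finset.prod_mul_distrib]
  refine Finset.prod_eq_one fun b _ => ?_
  split_ifs <;> norm_num

theorem sgn_symmDiff_right {n : ℕ} (A B B' : Finset (Fin n)) :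
    sgn A (symmDiff B B') = sgn A B * sgn A B' := by
  unfold sgn
  rw [← Finset.prod_mul_distrib]
  refine Finset.prod_congr rfl fun a _ => ?_
  refine prod_symmDiff_of_sq _ (fun b => ?_) B B'
  split_ifs <;> norm_num

theorem sgn_empty_left {n : ℕ} (B : Finset (Fin n)) : sgn ∅ B = 1 := by simp [sgn]

theorem sgn_empty_right {n : ℕ} (A : Finset (Fin n)) : sgn A ∅ = 1 := by simp [sgn]

/-- The Clifford algebra `ℝ_n` over `n` imaginary units, as families `(s_A)` of real coefficients
of the basis vectors `e_A`, `A ⊆ {1, …, n}`, with the norm `|s| ^ 2 = ∑ A, s_A ^ 2`. -/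
def Cl (n : ℕ) : Type := EuclideanSpace ℝ (Finset (Fin n))

namespace Cl

variable {n : ℕ}

instance : NormedAddCommGroup (Cl n) :=
  inferInstanceAs (NormedAddCommGroup (EuclideanSpace ℝ (Finset (Fin n))))

instance : NormedSpace ℝ (Cl n) :=
  inferInstanceAs (NormedSpace ℝ (EuclideanSpace ℝ (Finset (Fin n))))

/-- The Clifford number `∑ A, c A • e_A`. -/
def ofCoeff (c : Finset (Fin n) → ℝ) : Cl n :=
  (WithLp.toLp 2 c : EuclideanSpace ℝ (Finset (Fin n)))

/-- The coefficient `s_A` of `e_A`. -/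
def coeff (s : Cl n) (A : Finset (Fin n)) : ℝ :=
  WithLp.ofLp (show EuclideanSpace ℝ (Finset (Fin n)) from s) A

theorem coeff_ofCoeff (c : Finset (Fin n) → ℝ) (A : Finset (Fin n)) :
    (ofCoeff c).coeff A = c A := rfl

theorem ext_coeff {s t : Cl n} (h : ∀ A, s.coeff A = t.coeff A) : s = t :=
  PiLp.ext (x := (show EuclideanSpace ℝ (Finset (Fin n)) from s)) h

theorem coeff_add (s t : Cl n) (A : Finset (Fin n)) :
    (s + t).coeff A = s.coeff A + t.coeff A := rfl

theorem coeff_zero (A : Finset (Fin n)) : (0 : Cl n).coeff A = 0 := rfl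

theorem coeff_smul (c : ℝ) (s : Cl n) (A : Finset (Fin n)) :
    (c • s).coeff A = c * s.coeff A := rfl

/-- The product determined by `e_B e_D = sgn B D • e_{B ∆ D}`; the coefficient of `e_A` collects
all `B, D` with `B ∆ D = A`, i.e. `D = B ∆ A`. -/
instance : Mul (Cl n) :=
  ⟨fun s t => ofCoeff fun A =>
    ∑ B, sgn B (symmDiff B A) * (s.coeff B * t.coeff (symmDiff B A))⟩

instance : One (Cl n) := ⟨ofCoeff fun A => if A = ∅ then 1 else 0⟩

theorem coeff_mul (s t : Cl n) (A : Finset (Fin n)) :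
    (s * t).coeff A = ∑ B, sgn B (symmDiff B A) * (s.coeff B * t.coeff (symmDiff B A)) := rfl

theorem coeff_one (A : Finset (Fin n)) : (1 : Cl n).coeff A = if A = ∅ then 1 else 0 := rfl

theorem mul_assoc' (s t u : Cl n) : s * t * u = s * (t * u) := by
  refine ext_coeff fun A => ?_
  simp only [coeff_mul, Finset.mul_sum, Finset.sum_mul]
  rw [Finset.sum_comm]
  refine Finset.sum_congr rfl fun B _ => ?_
  have hinv : Function.Involutive (fun C : Finset (Fin n) => symmDiff B C) :=
    fun C => symmDiff_symmDiff_cancel_left B C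
  refine Fintype.sum_equiv hinv.toPerm _ _ fun C => ?_
  have e1 : symmDiff (symmDiff B C) (symmDiff B A) = symmDiff C A := by
    rw [symmDiff_comm B C, symmDiff_assoc, symmDiff_symmDiff_cancel_left]
  change _ = sgn B (symmDiff B A) * (s.coeff B * (sgn (symmDiff B C)
    (symmDiff (symmDiff B C) (symmDiff B A)) *
    (t.coeff (symmDiff B C) * u.coeff (symmDiff (symmDiff B C) (symmDiff B A)))))
  rw [e1]
  simp only [sgn_symmDiff_left, sgn_symmDiff_right]
  linear_combination (-(sgn B B * sgn B C * sgn C C * sgn C A * s.coeff B *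
    t.coeff (symmDiff B C) * u.coeff (symmDiff C A))) * sgn_mul_self B A

theorem one_mul' (s : Cl n) : 1 * s = s := by
  refine ext_coeff fun A => ?_
  rw [coeff_mul, Finset.sum_eq_single ∅]
  · rw [coeff_one, if_pos rfl, sgn_empty_left, one_mul, one_mul]
    congr 1
    exact bot_symmDiff A
  · intro B _ hB
    rw [coeff_one, if_neg hB, zero_mul, mul_zero]
  · intro h; exact absurd (Finset.mem_univ _) h

theorem mul_one' (s : Cl n) : s * 1 = s := by
  refine ext_coeff fun A => ?_
  rw [coeff_mul, Finset.sum_eq_single A]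
  · have h : symmDiff A A = (∅ : Finset (Fin n)) := symmDiff_self A
    rw [h, coeff_one, if_pos rfl, sgn_empty_right, one_mul, mul_one]
  · intro B _ hB
    have h : symmDiff B A ≠ (∅ : Finset (Fin n)) := fun h => hB (symmDiff_eq_bot.mp h)
    rw [coeff_one, if_neg h, mul_zero, mul_zero]
  · intro h; exact absurd (Finset.mem_univ _) h

instance : Ring (Cl n) :=
  { (inferInstance : AddCommGroup (Cl n)) with
    mul := (· * ·)
    one := 1
    mul_assoc := mul_assoc'
    one_mul := one_mul'
    mul_one := mul_one'
    zero_mul := fun s => ext_coeff fun A => by simp [coeff_mul, coeff_zero]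
    mul_zero := fun s => ext_coeff fun A => by simp [coeff_mul, coeff_zero]
    left_distrib := fun s t u => ext_coeff fun A => by
      simp only [coeff_mul, coeff_add, mul_add, Finset.sum_add_distrib]
    right_distrib := fun s t u => ext_coeff fun A => by
      simp only [coeff_mul, coeff_add, add_mul, mul_add, Finset.sum_add_distrib] }

instance : Algebra ℝ (Cl n) :=
  Algebra.ofModule
    (fun c s t => ext_coeff fun A => by
      simp only [coeff_mul, coeff_smul, Finset.mul_sum]
      exact Finset.sum_congr rfl fun B _ => by ring)
    (fun c s t => ext_coeff fun A => by
      simp only [coeff_mul, coeff_smul, Finset.mul_sum]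
      exact Finset.sum_congr rfl fun B _ => by ring)

/-- The conjugate `∑ A, (-1) ^ (|A| (|A| + 1) / 2) s_A e_A`. -/
def conj (s : Cl n) : Cl n :=
  ofCoeff fun A => (-1) ^ (A.card * (A.card + 1) / 2) * s.coeff A

end Cl

/-- The paravectors `s_0 + s_1 e_1 + ⋯ + s_n e_n`, as a subset of the Clifford algebra. -/
def paravectors (n : ℕ) : Set (Cl n) := {s | ∀ A : Finset (Fin n), 2 ≤ A.card → s.coeff A = 0}

/-- The sphere `𝕊` of purely imaginary paravectors of modulus one. -/
def unitSphere (n : ℕ) : Set (Cl n) := {J | J ∈ paravectors n ∧ J.coeff ∅ = 0 ∧ ‖J‖ = 1}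

/-- The point `x + J y` of the complex plane `ℂ_J`. -/
def slicePt {n : ℕ} (J : Cl n) (x y : ℝ) : Cl n := x • (1 : Cl n) + y • J

/-- The point `t e^{J α}` of the complex plane `ℂ_J`. -/
def polarPt {n : ℕ} (J : Cl n) (t α : ℝ) : Cl n :=
  slicePt J (t * Real.cos α) (t * Real.sin α)

/-- `I_ω = (-ω, ω) ∪ (π - ω, π + ω)`. -/
def angleSet (ω : ℝ) : Set ℝ := Set.Ioo (-ω) ω ∪ Set.Ioo (Real.pi - ω) (Real.pi + ω)

/-- The double sector `D_ω` of all nonzero paravectors with argument in `I_ω`. -/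
def doubleSector (n : ℕ) (ω : ℝ) : Set (Cl n) :=
  {s | ∃ t : ℝ, 0 < t ∧ ∃ J ∈ unitSphere n, ∃ α ∈ angleSet ω, s = polarPt J t α}

/-! ### Slice hyperholomorphic functions -/

/-- The set `𝒰` of all `(x, y)` with `x + 𝕊 y ⊆ U`. -/
def sliceDomain {n : ℕ} (U : Set (Cl n)) : Set (ℝ × ℝ) :=
  {z | ∀ J ∈ unitSphere n, slicePt J z.1 z.2 ∈ U}

/-- `f₀, f₁` are components of a left slice hyperholomorphic function `f` on `U`: continuously
differentiable on `𝒰`, with `f (x + J y) = f₀ (x, y) + J f₁ (x, y)`, the even-odd compatibility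
conditions and the Cauchy–Riemann equations. It is used for axially symmetric sets `U` that are
open in the space of paravectors (for which `𝒰` is open); values of `f` outside `U` and of
`f₀, f₁` outside `𝒰` are irrelevant. -/
structure IsSliceRep {n : ℕ} (U : Set (Cl n)) (f : Cl n → Cl n) (f₀ f₁ : ℝ × ℝ → Cl n) :
    Prop where
  contDiff_fst : ContDiffOn ℝ 1 f₀ (sliceDomain U)
  contDiff_snd : ContDiffOn ℝ 1 f₁ (sliceDomain U)
  rep : ∀ z ∈ sliceDomain U, ∀ J ∈ unitSphere n, f (slicePt J z.1 z.2) = f₀ z + J * f₁ z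
  even : ∀ z ∈ sliceDomain U, f₀ (z.1, -z.2) = f₀ z
  odd : ∀ z ∈ sliceDomain U, f₁ (z.1, -z.2) = -f₁ z
  cauchyRiemann_fst : ∀ z ∈ sliceDomain U, fderiv ℝ f₀ z (1, 0) = fderiv ℝ f₁ z (0, 1)
  cauchyRiemann_snd : ∀ z ∈ sliceDomain U, fderiv ℝ f₀ z (0, 1) = -fderiv ℝ f₁ z (1, 0)

/-- The class `𝒮ℋ_L(U)` of left slice hyperholomorphic functions. -/
def IsSH {n : ℕ} (U : Set (Cl n)) (f : Cl n → Cl n) : Prop := ∃ f₀ f₁, IsSliceRep U f f₀ f₁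

/-- The class `𝒩(U)` of intrinsic functions: the components can be chosen real valued. -/
def IsIntrinsic {n : ℕ} (U : Set (Cl n)) (f : Cl n → Cl n) : Prop :=
  ∃ f₀ f₁, IsSliceRep U f f₀ f₁ ∧
    ∀ z ∈ sliceDomain U, f₀ z ∈ Set.range (algebraMap ℝ (Cl n)) ∧
      f₁ z ∈ Set.range (algebraMap ℝ (Cl n))

/-- Boundedness on `D_θ` and `∫₀^∞ |f (t e^{J φ})| dt / t < ∞` for all `J ∈ 𝕊`, `φ ∈ I_θ`. -/
def HasDecay {n : ℕ} (θ : ℝ) (f : Cl n → Cl n) : Prop :=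
  (∃ C : ℝ, ∀ s ∈ doubleSector n θ, ‖f s‖ ≤ C) ∧
    ∀ J ∈ unitSphere n, ∀ φ ∈ angleSet θ,
      MeasureTheory.IntegrableOn (fun t : ℝ => ‖f (polarPt J t φ)‖ / t) (Set.Ioi 0)

/-- The class `𝒮ℋ_L^0(D_θ)`. -/
def IsSHZero {n : ℕ} (θ : ℝ) (f : Cl n → Cl n) : Prop := IsSH (doubleSector n θ) f ∧ HasDecay θ f

/-- The class `𝒩^0(D_θ)`. -/
def IsNZero {n : ℕ} (θ : ℝ) (f : Cl n → Cl n) : Prop :=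
  IsIntrinsic (doubleSector n θ) f ∧ HasDecay θ f

/-- `f = f_∞ + (1 + s²)⁻¹ (f_0 - f_∞) + f̃` on `D_θ` with `f̃ ∈ 𝒮ℋ_L^0(D_θ)`. -/
def IsBndDecomp {n : ℕ} (θ : ℝ) (f : Cl n → Cl n) (f0 finf : Cl n) (ft : Cl n → Cl n) : Prop :=
  IsSHZero θ ft ∧
    ∀ s ∈ doubleSector n θ, f s = finf + Ring.inverse (1 + s ^ 2) * (f0 - finf) + ft s

/-- The class `𝒮ℋ_L^bnd(D_θ)`. -/
def IsSHBnd {n : ℕ} (θ : ℝ) (f : Cl n → Cl n) : Prop :=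
  ∃ d : Cl n × Cl n × (Cl n → Cl n), IsBndDecomp θ f d.1 d.2.1 d.2.2

/-- The class `𝒩^bnd(D_θ)`. -/
def IsNBnd {n : ℕ} (θ : ℝ) (g : Cl n → Cl n) : Prop :=
  ∃ (g0 ginf : ℝ) (gt : Cl n → Cl n), IsNZero θ gt ∧
    IsBndDecomp θ g (algebraMap ℝ (Cl n) g0) (algebraMap ℝ (Cl n) ginf) gt

/-! ### Clifford modules and operators -/

/-- The Clifford module `V = {∑ A, v_A ⊗ e_A}` over a real Banach space `E`, as families `(v_A)`
with the norm `‖v‖ ^ 2 = ∑ A, ‖v_A‖ ^ 2`. -/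
abbrev CliffordModule (n : ℕ) (E : Type*) : Type _ := PiLp 2 (fun _ : Finset (Fin n) => E)

section Operators

variable {n : ℕ} {E : Type*} [NormedAddCommGroup E] [NormedSpace ℝ E]

/-- Left multiplication `v ↦ s v = ∑ B D, (s_B v_D) ⊗ (e_B e_D)`; the component at `e_A` collects
all `B, D` with `B ∆ D = A`. -/
def leftMul (s : Cl n) : CliffordModule n E →L[ℝ] CliffordModule n E :=
  (PiLp.continuousLinearEquiv 2 ℝ (fun _ : Finset (Fin n) => E)).symm.toContinuousLinearMap.comp
    (ContinuousLinearMap.pi fun A => ∑ B, (sgn B (symmDiff B A) * s.coeff B) •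
      PiLp.proj (𝕜 := ℝ) 2 (fun _ : Finset (Fin n) => E) (symmDiff B A))

/-- Right multiplication `v ↦ v s = ∑ B D, (v_B s_D) ⊗ (e_B e_D)`. -/
def rightMul (s : Cl n) : CliffordModule n E →L[ℝ] CliffordModule n E :=
  (PiLp.continuousLinearEquiv 2 ℝ (fun _ : Finset (Fin n) => E)).symm.toContinuousLinearMap.comp
    (ContinuousLinearMap.pi fun A => ∑ B, (sgn B (symmDiff B A) * s.coeff (symmDiff B A)) •
      PiLp.proj (𝕜 := ℝ) 2 (fun _ : Finset (Fin n) => E) B)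

/-- The class `𝒦(V)` of closed right-linear operators with two-sided linear domain. -/
structure IsClosedOp (T : CliffordModule n E →ₗ.[ℝ] CliffordModule n E) : Prop where
  left_mem : ∀ (s : Cl n), ∀ v ∈ T.domain, leftMul s v ∈ T.domain
  right_mem : ∀ (s : Cl n), ∀ v ∈ T.domain, rightMul s v ∈ T.domain
  map_right : ∀ (s : Cl n) (v w : T.domain), (w : CliffordModule n E) = rightMul s v →
    T w = rightMul s (T v)
  closed : T.IsClosed

/-- A bounded real-linear map as an everywhere defined operator. -/
def total {V : Type*} [NormedAddCommGroup V] [NormedSpace ℝ V] (B : V →L[ℝ] V) : V →ₗ.[ℝ] V :=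
  (B : V →ₗ[ℝ] V).toPMap ⊤

/-- The product `S T` of partially defined operators,
with `dom (S T) = {v ∈ dom T | T v ∈ dom S}`. -/
def pcomp {V : Type*} [AddCommGroup V] [Module ℝ V] (S T : V →ₗ.[ℝ] V) : V →ₗ.[ℝ] V where
  domain :=
    { carrier := {v | ∃ h : v ∈ T.domain, T ⟨v, h⟩ ∈ S.domain}
      zero_mem' := ⟨T.domain.zero_mem, by
        have h : T ⟨0, T.domain.zero_mem⟩ = 0 := T.map_zero
        rw [h]; exact S.domain.zero_mem⟩
      add_mem' := by
        rintro v w ⟨hv, hv'⟩ ⟨hw, hw'⟩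
        refine ⟨T.domain.add_mem hv hw, ?_⟩
        have h : T ⟨v + w, T.domain.add_mem hv hw⟩ = T ⟨v, hv⟩ + T ⟨w, hw⟩ :=
          T.map_add ⟨v, hv⟩ ⟨w, hw⟩
        rw [h]; exact S.domain.add_mem hv' hw'
      smul_mem' := by
        rintro c v ⟨hv, hv'⟩
        refine ⟨T.domain.smul_mem c hv, ?_⟩
        have h : T ⟨c • v, T.domain.smul_mem c hv⟩ = c • T ⟨v, hv⟩ := T.map_smul c ⟨v, hv⟩
        rw [h]; exact S.domain.smul_mem c hv' }
  toFun :=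
    { toFun := fun v => S ⟨T ⟨v.1, v.2.1⟩, v.2.2⟩
      map_add' := fun v w => by
        rw [← S.map_add]
        congr 1
        exact Subtype.ext (T.map_add ⟨v.1, v.2.1⟩ ⟨w.1, w.2.1⟩)
      map_smul' := fun c v => by
        rw [RingHom.id_apply, ← S.map_smul]
        congr 1
        exact Subtype.ext (T.map_smul c ⟨v.1, v.2.1⟩) }

/-- The powers `T^k`, with `dom T^(k+1) = {v ∈ dom T^k | T^k v ∈ dom T}`. -/
def powOp {V : Type*} [NormedAddCommGroup V] [NormedSpace ℝ V] (T : V →ₗ.[ℝ] V) : ℕ → (V →ₗ.[ℝ] V)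
  | 0 => total (ContinuousLinearMap.id ℝ V)
  | k + 1 => pcomp T (powOp T k)

/-- The polynomial functional calculus `p[T] = p_0 + p_1 T + ⋯ + p_N T^N`, `N = deg p`, of a real
polynomial. The domain of a sum of partially defined operators is the intersection of the
domains, here `dom T^N` (also if some coefficients vanish). -/
def polyOp {V : Type*} [NormedAddCommGroup V] [NormedSpace ℝ V] (T : V →ₗ.[ℝ] V)
    (p : Polynomial ℝ) : V →ₗ.[ℝ] V :=
  ∑ k ∈ Finset.range (p.natDegree + 1), p.coeff k • powOp T k

/-- An everywhere defined bounded operator as a continuous linear map (and `0` for operators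
that are not everywhere defined and bounded). -/
def toBounded {V : Type*} [NormedAddCommGroup V] [NormedSpace ℝ V] (A : V →ₗ.[ℝ] V) : V →L[ℝ] V :=
  open Classical in if h : ∃ B : V →L[ℝ] V, total B = A then h.choose else 0

/-- `A` has an inverse `A⁻¹ ∈ ℬ(V)`: it is injective and its inverse is everywhere defined,
bounded and right-linear. -/
def HasBoundedInverse (A : CliffordModule n E →ₗ.[ℝ] CliffordModule n E) : Prop :=
  Function.Injective A ∧ ∃ B : CliffordModule n E →L[ℝ] CliffordModule n E,
    total B = A.inverse ∧ ∀ (s : Cl n) v, B (rightMul s v) = rightMul s (B v)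

/-- `Q_s[T] = T² - 2 s_0 T + |s|²`, with domain `dom T²`. -/
def Qop (s : Cl n) (T : CliffordModule n E →ₗ.[ℝ] CliffordModule n E) :
    CliffordModule n E →ₗ.[ℝ] CliffordModule n E :=
  polyOp T (Polynomial.X ^ 2 - Polynomial.C (2 * s.coeff ∅) * Polynomial.X +
    Polynomial.C (‖s‖ ^ 2))

/-- The `S`-resolvent set. -/
def resolventSetS (T : CliffordModule n E →ₗ.[ℝ] CliffordModule n E) : Set (Cl n) :=
  {s | s ∈ paravectors n ∧ HasBoundedInverse (Qop s T)}

/-- The `S`-spectrum. -/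
def spectrumS (T : CliffordModule n E →ₗ.[ℝ] CliffordModule n E) : Set (Cl n) :=
  paravectors n \ resolventSetS T

/-- The left `S`-resolvent operator `S_L⁻¹(s, T) = Q_s[T]⁻¹ s̄ - T Q_s[T]⁻¹`. For closed `T` and
`s` in the `S`-resolvent set this is an everywhere defined bounded operator. -/
def resolventL (s : Cl n) (T : CliffordModule n E →ₗ.[ℝ] CliffordModule n E) :
    CliffordModule n E →L[ℝ] CliffordModule n E :=
  toBounded (pcomp (Qop s T).inverse (total (leftMul s.conj)) - pcomp T (Qop s T).inverse)

/-- `T` is bisectorial of angle `ω`. -/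
structure IsBisectorial (T : CliffordModule n E →ₗ.[ℝ] CliffordModule n E) (ω : ℝ) : Prop where
  angle_mem : ω ∈ Set.Ioo 0 (Real.pi / 2)
  spectrum_subset : spectrumS T ⊆ closure (doubleSector n ω)
  resolvent_bound : ∀ φ ∈ Set.Ioo ω (Real.pi / 2), ∃ C : ℝ, 0 ≤ C ∧
    ∀ s ∈ paravectors n, s ∉ doubleSector n φ → s ≠ 0 → ‖resolventL s T‖ ≤ C / ‖s‖

/-! ### The functional calculi -/

/-- The integral `∫ S_L⁻¹(s, T) ds_J f(s)` along the ray `γ(t) = t e^{J α}`, `t ∈ (0, ∞)`, where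
`ds_J = γ'(t) / J dt = e^{J α} (-J) dt`, and an operator `A` and a Clifford number `a` have the
product `(A a)(v) = A (a v)`. -/
def rayIntegral (T : CliffordModule n E →ₗ.[ℝ] CliffordModule n E) (J : Cl n) (f : Cl n → Cl n)
    (α : ℝ) : CliffordModule n E →L[ℝ] CliffordModule n E :=
  ∫ t in Set.Ioi (0 : ℝ), (resolventL (polarPt J t α) T).comp
    (leftMul (polarPt J 1 α * -J * f (polarPt J t α)))

/-- The `ω`-functional calculus `f(T) = (2π)⁻¹ ∫_{∂D_φ ∩ ℂ_J} S_L⁻¹(s, T) ds_J f(s)`. The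
positively oriented boundary `∂D_φ ∩ ℂ_J` runs inwards along the rays of angle `φ` and `π + φ`,
and outwards along the rays of angle `-φ` and `π - φ`. -/
def omegaCalculus (T : CliffordModule n E →ₗ.[ℝ] CliffordModule n E) (φ : ℝ) (J : Cl n)
    (f : Cl n → Cl n) : CliffordModule n E →L[ℝ] CliffordModule n E :=
  (2 * Real.pi)⁻¹ • (rayIntegral T J f (-φ) - rayIntegral T J f φ +
    rayIntegral T J f (Real.pi - φ) - rayIntegral T J f (Real.pi + φ))

/-- The extended `ω`-functional calculus `f(T) = f_∞ + (1 + T²)⁻¹ (f_0 - f_∞) + f̃(T)` of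
`f ∈ 𝒮ℋ_L^bnd(D_θ)`, where `f_0, f_∞` and `f̃` (on `D_θ`) are uniquely determined by `f`. -/
def extendedCalculus (T : CliffordModule n E →ₗ.[ℝ] CliffordModule n E) (θ φ : ℝ) (J : Cl n)
    (f : Cl n → Cl n) : CliffordModule n E →L[ℝ] CliffordModule n E :=
  open Classical in
  if h : IsSHBnd θ f then
    leftMul h.choose.2.1 +
      (toBounded (polyOp T (1 + Polynomial.X ^ 2)).inverse).comp
        (leftMul (h.choose.1 - h.choose.2.1)) +
      omegaCalculus T φ J h.choose.2.2
  else 0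

/-- `e` is a regularizer of `f`: `e ∈ 𝒩^bnd(D_θ)`, `e f ∈ 𝒮ℋ_L^bnd(D_θ)` and `e(T)` is injective,
where `e(T)` is computed with the angle `φ` and the imaginary unit `J`. -/
def IsRegularizer (T : CliffordModule n E →ₗ.[ℝ] CliffordModule n E) (θ φ : ℝ) (J : Cl n)
    (e f : Cl n → Cl n) : Prop :=
  IsNBnd θ e ∧ IsSHBnd θ (fun s => e s * f s) ∧ Function.Injective (extendedCalculus T θ φ J e)

/-- The class `𝒩^reg(D_θ)` of intrinsic functions `g` for which there is `e ∈ 𝒩^bnd(D_θ)` with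
`e g ∈ 𝒩^bnd(D_θ)` and `e(T)` injective, for whichever angle `φ ∈ (ω, θ)` and imaginary unit
`J ∈ 𝕊` are used to compute `e(T)`. -/
def IsNReg (T : CliffordModule n E →ₗ.[ℝ] CliffordModule n E) (ω θ : ℝ) (g : Cl n → Cl n) : Prop :=
  IsIntrinsic (doubleSector n θ) g ∧ ∃ e : Cl n → Cl n, IsNBnd θ e ∧
    IsNBnd θ (fun s => e s * g s) ∧
    ∀ φ ∈ Set.Ioo ω θ, ∀ J ∈ unitSphere n, Function.Injective (extendedCalculus T θ φ J e)

/-- The `H^∞`-functional calculus `f(T) = e(T)⁻¹ (e f)(T)`, computed with the regularizer `e`, the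
angle `φ` and the imaginary unit `J`. -/
def hInftyCalculus (T : CliffordModule n E →ₗ.[ℝ] CliffordModule n E) (θ φ : ℝ) (J : Cl n)
    (e f : Cl n → Cl n) : CliffordModule n E →ₗ.[ℝ] CliffordModule n E :=
  pcomp (total (extendedCalculus T θ φ J e)).inverse
    (total (extendedCalculus T θ φ J fun s => e s * f s))

end Operators

/-- The rational function `s ↦ p(s) q(s)⁻¹`. -/
def ratFun (n : ℕ) (p q : Polynomial ℝ) (s : Cl n) : Cl n :=
  Polynomial.aeval s p * Ring.inverse (Polynomial.aeval s q)

end HInfty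

end

open HInfty

noncomputable section
namespace HInfty

open Complex (I)
open scoped ComplexConjugate

/-! ### The Clifford algebra and its complex planes -/

namespace Cl

variable {n : ℕ}

/-! Everything is built from the quadratics Q_z[T] = T² - 2 Re(z) T + |z|², whose inverse P_z is
bounded as soon as z lies outside the closed double sector. A real polynomial q without zeros in the
closed sector is a nonzero constant times a product of such quadratics (`outerPoly_induction`), so
q[T] is inverted by a product of operators P_z. Domains are tracked by extending T to a linear map L
of the whole space and recording which iterates stay in dom T.

The calculus is transported to one complex variable. On a plane ℂ_J an intrinsic function is a
holomorphic function commuting with conjugation (`IsIntrinsic.exists_represents`). Composition on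
the right with j, the left multiplication by J, makes the bounded operators a complex vector space,
and with R_s = T P_s the resolvent S(s) = P_s conj(s) - R_s is holomorphic in s for this structure
(`differentiableAt_complexify`). Rays become horizontal lines under t = exp x, and Cauchy's theorem
is applied on strips.

The core is that a proper rational function p/q with poles off the closed sector of angle θ is a
multiplier: if f has the value f(T), then (p/q) f has the value p[T] q[T]⁻¹ f(T), and the two
factors commute (`exists_isMultiplier`). Polynomial division reduces this to r(z) = (a + b z) /
Q_c(z), with operator M = a P_c + b R_c. The resolvent equation gives M S(s) = r(s) S(s) plus an
elementary fraction holomorphic on the sector, and after multiplication by the decaying part of f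
this fraction integrates to zero (`contourCalculus_simpleFrac_mul`). The parts of f that do not
decay need one explicit integral, namely that z / (1 + z²) is sent to T (1 + T²)⁻¹
(`contourCalculus_simpleFrac_I`).

Now let e be any regularizer, A = e(T) and A' = (e p/q)(T). Smoothing removes the unboundedness of
p/q: B₁ = (1 + T²)⁻ᵐ and M = p[T] B₁ q[T]⁻¹ are both multipliers, so B₁ A' = M A = A M and B₁ A = A
B₁. As A and B₁ are injective, A' v = A w holds exactly when M v = B₁ w, and B₁ can be cancelled to
give q[T]⁻¹ v ∈ dom p[T] and p[T] q[T]⁻¹ v = w (`pcomp_inverse_total_eq`). This is the asserted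
equality, domains included, and it does not see e, φ or J. The angle θ exists because q has only
finitely many zeros. -/

theorem norm_sq_eq (s : Cl n) : ‖s‖ ^ 2 = ∑ A, s.coeff A ^ 2 := by
  have h := EuclideanSpace.norm_sq_eq (𝕜 := ℝ) (show EuclideanSpace ℝ (Finset (Fin n)) from s)
  simp only [Real.norm_eq_abs, sq_abs] at h
  exact h

theorem coeff_neg (s : Cl n) (A : Finset (Fin n)) : (-s).coeff A = -s.coeff A := rfl

theorem coeff_sub (s t : Cl n) (A : Finset (Fin n)) :
    (s - t).coeff A = s.coeff A - t.coeff A := rfl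

theorem algebraMap_eq (r : ℝ) : algebraMap ℝ (Cl n) r = r • (1 : Cl n) :=
  Algebra.algebraMap_eq_smul_one r

theorem coeff_algebraMap_empty (r : ℝ) : (algebraMap ℝ (Cl n) r).coeff ∅ = r := by
  simp [algebraMap_eq, coeff_smul, coeff_one]

theorem coeff_algebraMap_of_ne {A : Finset (Fin n)} (hA : A ≠ ∅) (r : ℝ) :
    (algebraMap ℝ (Cl n) r).coeff A = 0 := by
  simp [algebraMap_eq, coeff_smul, coeff_one, hA]

/-- The coefficient of `e_A` as a continuous linear functional. -/
def coeffCLM (A : Finset (Fin n)) : Cl n →L[ℝ] ℝ :=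
  (PiLp.proj (𝕜 := ℝ) 2 (fun _ : Finset (Fin n) => ℝ) A :
    EuclideanSpace ℝ (Finset (Fin n)) →L[ℝ] ℝ)

theorem coeffCLM_apply (A : Finset (Fin n)) (s : Cl n) : coeffCLM A s = s.coeff A := rfl

theorem abs_coeff_le_norm (s : Cl n) (A : Finset (Fin n)) : |s.coeff A| ≤ ‖s‖ :=
  PiLp.norm_apply_le (p := 2) (show EuclideanSpace ℝ (Finset (Fin n)) from s) A

theorem eq_algebraMap_of_coeff {s : Cl n} (h : ∀ A, A ≠ ∅ → s.coeff A = 0) :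
    s = algebraMap ℝ (Cl n) (s.coeff ∅) := by
  refine ext_coeff fun A => ?_
  by_cases hA : A = ∅
  · rw [hA, coeff_algebraMap_empty]
  · rw [h A hA, coeff_algebraMap_of_ne hA]

end Cl

open Cl

variable {n : ℕ}

theorem sgn_singleton (i j : Fin n) : sgn {i} {j} = if j ≤ i then (-1 : ℝ) else 1 := by
  simp [sgn]

/-- The squares of the e_i contribute -|J|² = -1, and for i ≠ j the products e_i e_j and e_j e_i
cancel. -/
theorem unitSphere_mul_self {J : Cl n} (hJ : J ∈ unitSphere n) : J * J = -1 := by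
  obtain ⟨hp, h0, h1⟩ := hJ
  have hsupp : ∀ B : Finset (Fin n), J.coeff B ≠ 0 → ∃ i, B = {i} := by
    intro B hB
    have hc : B.card < 2 := by
      by_contra h
      exact hB (hp B (not_lt.mp h))
    have hne : B ≠ ∅ := fun h => hB (h ▸ h0)
    have : B.card = 1 := by
      have := Finset.card_pos.mpr (Finset.nonempty_iff_ne_empty.mpr hne)
      omega
    exact Finset.card_eq_one.mp this
  refine ext_coeff fun A => ?_
  rw [coeff_mul, coeff_neg, coeff_one]
  split_ifs with hA
  · subst hA
    have hb : ∀ B : Finset (Fin n), symmDiff B ∅ = B := fun B => symmDiff_bot B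
    simp only [hb]
    have hterm : ∀ B : Finset (Fin n), sgn B B * (J.coeff B * J.coeff B) = -(J.coeff B ^ 2) := by
      intro B
      by_cases hB : J.coeff B = 0
      · simp [hB]
      · obtain ⟨i, rfl⟩ := hsupp B hB
        rw [sgn_singleton, if_pos le_rfl]; ring
    rw [Finset.sum_congr rfl fun B _ => hterm B, Finset.sum_neg_distrib, ← norm_sq_eq, h1]
    norm_num
  · rw [neg_zero]
    -- The involution B ↦ B ∆ A exchanges the terms of e_i e_j and e_j e_i and reverses the sign, so
    -- the sum equals its own negative.
    have hinv : Function.Involutive (fun C : Finset (Fin n) => symmDiff C A) :=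
      fun C => symmDiff_symmDiff_cancel_right A C
    have key : ∑ B, sgn B (symmDiff B A) * (J.coeff B * J.coeff (symmDiff B A)) =
        ∑ B, -(sgn B (symmDiff B A) * (J.coeff B * J.coeff (symmDiff B A))) := by
      refine Fintype.sum_equiv hinv.toPerm _ _ fun B => ?_
      change _ = -(sgn (symmDiff B A) (symmDiff (symmDiff B A) A) *
        (J.coeff (symmDiff B A) * J.coeff (symmDiff (symmDiff B A) A)))
      rw [symmDiff_symmDiff_cancel_right]
      by_cases hB : J.coeff B = 0
      · simp [hB]
      by_cases hC : J.coeff (symmDiff B A) = 0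
      · simp [hC]
      obtain ⟨i, hi⟩ := hsupp B hB
      obtain ⟨j, hj⟩ := hsupp _ hC
      rw [hj, hi, sgn_singleton, sgn_singleton]
      have hij : i ≠ j := by
        rintro rfl
        exact hA (symmDiff_eq_left.mp (hj.trans hi.symm))
      rcases lt_or_gt_of_ne hij with h | h
      · rw [if_neg (not_le.mpr h), if_pos h.le]; ring
      · rw [if_pos h.le, if_neg (not_le.mpr h)]; ring
    rw [Finset.sum_neg_distrib] at key
    linarith

theorem unitSphere_nonempty (hn : 1 ≤ n) : (unitSphere n).Nonempty := by
  let i : Fin n := ⟨0, hn⟩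
  refine ⟨ofCoeff fun A => if A = {i} then 1 else 0, fun A hA => ?_, ?_, ?_⟩
  · rw [coeff_ofCoeff, if_neg]
    rintro rfl
    simp at hA
  · rw [coeff_ofCoeff, if_neg (Finset.singleton_ne_empty i).symm]
  · rw [← sq_eq_sq₀ (norm_nonneg _) zero_le_one, norm_sq_eq]
    simp [coeff_ofCoeff]

/-- The embedding `x + i y ↦ x + J y` of the complex numbers onto the plane `ℂ_J`. -/
def planeEmb {J : Cl n} (hJ : J ∈ unitSphere n) : ℂ →ₐ[ℝ] Cl n :=
  Complex.liftAux J (unitSphere_mul_self hJ)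

variable {J : Cl n}

theorem planeEmb_apply (hJ : J ∈ unitSphere n) (z : ℂ) : planeEmb hJ z = slicePt J z.re z.im := by
  rw [planeEmb, Complex.liftAux_apply, algebraMap_eq, slicePt]

theorem coeff_slicePt_empty (hJ : J ∈ unitSphere n) (x y : ℝ) :
    (slicePt J x y).coeff ∅ = x := by
  rw [slicePt, coeff_add, coeff_smul, coeff_smul, hJ.2.1, coeff_one, if_pos rfl]; ring

theorem coeff_slicePt_of_ne {A : Finset (Fin n)} (hA : A ≠ ∅) (x y : ℝ) :
    (slicePt J x y).coeff A = y * J.coeff A := by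
  rw [slicePt, coeff_add, coeff_smul, coeff_smul, coeff_one, if_neg hA]; ring

theorem norm_slicePt_sq (hJ : J ∈ unitSphere n) (x y : ℝ) :
    ‖slicePt J x y‖ ^ 2 = x ^ 2 + y ^ 2 := by
  have h1 : ∑ A, J.coeff A ^ 2 = 1 := by rw [← norm_sq_eq, hJ.2.2]; norm_num
  have h2 : ∀ A, (slicePt J x y).coeff A ^ 2 =
      (if A = ∅ then x ^ 2 else 0) + y ^ 2 * J.coeff A ^ 2 := by
    intro A
    split_ifs with hA
    · rw [hA, coeff_slicePt_empty hJ, hJ.2.1]; ring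
    · rw [coeff_slicePt_of_ne hA]; ring
  rw [norm_sq_eq, Finset.sum_congr rfl fun A _ => h2 A, Finset.sum_add_distrib, ← Finset.mul_sum,
    h1, Finset.sum_ite_eq' Finset.univ ∅]
  simp

theorem norm_planeEmb (hJ : J ∈ unitSphere n) (z : ℂ) : ‖planeEmb hJ z‖ = ‖z‖ := by
  rw [← sq_eq_sq₀ (norm_nonneg _) (norm_nonneg _), planeEmb_apply, norm_slicePt_sq hJ,
    Complex.sq_norm, Complex.normSq_apply]
  ring

theorem norm_slicePt (hJ : J ∈ unitSphere n) (z : ℂ) : ‖slicePt J z.re z.im‖ = ‖z‖ := by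
  rw [← planeEmb_apply hJ, norm_planeEmb]

theorem slicePt_mem_paravectors (hJ : J ∈ unitSphere n) (x y : ℝ) :
    slicePt J x y ∈ paravectors n := fun A hA => by
  have hne : A ≠ ∅ := by rintro rfl; simp at hA
  rw [coeff_slicePt_of_ne hne, hJ.1 A hA, mul_zero]

theorem conj_slicePt (hJ : J ∈ unitSphere n) (x y : ℝ) :
    (slicePt J x y).conj = slicePt J x (-y) := by
  refine ext_coeff fun A => ?_
  rw [Cl.conj, coeff_ofCoeff]
  by_cases hA : A = ∅
  · rw [hA, coeff_slicePt_empty hJ, coeff_slicePt_empty hJ]; simp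
  · rw [coeff_slicePt_of_ne hA, coeff_slicePt_of_ne hA]
    by_cases h2 : 2 ≤ A.card
    · simp [hJ.1 A h2]
    · have : A.card = 1 := by
        have := Finset.card_pos.mpr (Finset.nonempty_iff_ne_empty.mpr hA)
        omega
      rw [this]; norm_num

theorem polarPt_eq (hJ : J ∈ unitSphere n) (t α : ℝ) :
    polarPt J t α = planeEmb hJ (t * Complex.exp (α * I)) := by
  rw [planeEmb_apply, polarPt]
  congr 1 <;> simp [Complex.exp_ofReal_mul_I_re, Complex.exp_ofReal_mul_I_im]

theorem aeval_planeEmb (hJ : J ∈ unitSphere n) (p : Polynomial ℝ) (z : ℂ) :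
    Polynomial.aeval (planeEmb hJ z) p = planeEmb hJ (Polynomial.aeval z p) :=
  Polynomial.aeval_algHom_apply (planeEmb hJ) z p

theorem inverse_planeEmb (hJ : J ∈ unitSphere n) (z : ℂ) :
    Ring.inverse (planeEmb hJ z) = planeEmb hJ z⁻¹ := by
  by_cases hz : z = 0
  · simp [hz]
  · let u : (Cl n)ˣ := ⟨planeEmb hJ z, planeEmb hJ z⁻¹,
      by rw [← map_mul, mul_inv_cancel₀ hz, map_one], by rw [← map_mul, inv_mul_cancel₀ hz, map_one]⟩
    exact Ring.inverse_unit u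

/-! ### Double sectors -/

/-- The double sector of all complex numbers with argument in `I_θ`. -/
def cDoubleSector (θ : ℝ) : Set ℂ := {z | Real.cos θ * ‖z‖ < |z.re|}

theorem cos_lt_abs_cos_of_mem_angleSet {θ α : ℝ} (hθ : θ ∈ Set.Ioo 0 (Real.pi / 2))
    (hα : α ∈ angleSet θ) : Real.cos θ < |Real.cos α| := by
  have key : ∀ β, β ∈ Set.Ioo (-θ) θ → Real.cos θ < Real.cos β := by
    intro β hβ
    rw [← Real.cos_abs β]
    exact Real.cos_lt_cos_of_nonneg_of_le_pi (abs_nonneg _) (by linarith [hθ.2, Real.pi_pos])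
      (abs_lt.mpr hβ)
  rcases hα with hα | hα
  · exact (key α hα).trans_le (le_abs_self _)
  · have := key (α - Real.pi) ⟨by linarith [hα.1], by linarith [hα.2]⟩
    rw [Real.cos_sub_pi] at this
    exact this.trans_le (neg_le_abs _)

theorem doubleSector_lt {θ : ℝ} (hθ : θ ∈ Set.Ioo 0 (Real.pi / 2)) {s : Cl n}
    (hs : s ∈ doubleSector n θ) : Real.cos θ * ‖s‖ < |s.coeff ∅| := by
  obtain ⟨t, ht, K, hK, α, hα, rfl⟩ := hs
  have h1 : ‖polarPt K t α‖ = t := by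
    rw [polarPt_eq hK, norm_planeEmb, norm_mul, Complex.norm_exp_ofReal_mul_I, mul_one,
      Complex.norm_real, Real.norm_of_nonneg ht.le]
  rw [h1, polarPt, coeff_slicePt_empty hK, abs_mul, abs_of_pos ht, mul_comm]
  exact mul_lt_mul_of_pos_left (cos_lt_abs_cos_of_mem_angleSet hθ hα) ht

/-- Arguments are replaced by the inequality cos θ · |z| < |Re z|, which makes the sector open at
sight and serves all later estimates. -/
theorem slicePt_mem_doubleSector (hJ : J ∈ unitSphere n) {θ : ℝ}
    (hθ : θ ∈ Set.Ioo 0 (Real.pi / 2)) (z : ℂ) :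
    slicePt J z.re z.im ∈ doubleSector n θ ↔ z ∈ cDoubleSector θ := by
  constructor
  · intro h
    have := doubleSector_lt hθ h
    rwa [norm_slicePt hJ, coeff_slicePt_empty hJ] at this
  · intro h
    have hcos : 0 < Real.cos θ := Real.cos_pos_of_mem_Ioo ⟨by linarith [hθ.1, Real.pi_pos], hθ.2⟩
    have hz : z ≠ 0 := by
      rintro rfl
      simp [cDoubleSector] at h
    have hnz : 0 < ‖z‖ := norm_pos_iff.mpr hz
    have hre : z.re = ‖z‖ * Real.cos z.arg := (Complex.norm_mul_cos_arg z).symm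
    have him : z.im = ‖z‖ * Real.sin z.arg := (Complex.norm_mul_sin_arg z).symm
    have habs : Real.cos θ < |Real.cos z.arg| := by
      have h' : Real.cos θ * ‖z‖ < |z.re| := h
      rw [hre, abs_mul, abs_of_pos hnz, mul_comm] at h'
      exact lt_of_mul_lt_mul_left h' hnz.le
    have hle : |z.arg| ≤ Real.pi := Complex.abs_arg_le_pi z
    have hpos : ∀ β : ℝ, |β| ≤ Real.pi → Real.cos θ < Real.cos β → |β| < θ := by
      intro β hβ h1
      by_contra h2
      rw [← Real.cos_abs β] at h1
      exact absurd h1 (not_lt.mpr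
        (Real.cos_le_cos_of_nonneg_of_le_pi hθ.1.le hβ (not_lt.mp h2)))
    obtain ⟨α, hα, hc, hs⟩ : ∃ α ∈ angleSet θ, Real.cos α = Real.cos z.arg ∧
        Real.sin α = Real.sin z.arg := by
      rcases lt_abs.mp habs with h1 | h1
      · exact ⟨z.arg, Or.inl (abs_lt.mp (hpos _ hle h1)), rfl, rfl⟩
      · by_cases h0 : 0 ≤ z.arg
        · have h2 := abs_lt.mp (hpos (z.arg - Real.pi)
            (by rw [abs_le] at hle ⊢; constructor <;> linarith [Real.pi_pos])
            (by rwa [Real.cos_sub_pi]))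
          exact ⟨z.arg, Or.inr ⟨by linarith [h2.1], by linarith [h2.2]⟩, rfl, rfl⟩
        · have h2 := abs_lt.mp (hpos (z.arg + Real.pi)
            (by rw [abs_le] at hle ⊢; constructor <;> linarith [Real.pi_pos])
            (by rwa [Real.cos_add_pi]))
          -- `Complex.arg` lies in (-π, π], so an argument near -π needs a full turn to reach the
          -- interval around π.
          exact ⟨z.arg + 2 * Real.pi, Or.inr ⟨by linarith [h2.1], by linarith [h2.2]⟩,
            Real.cos_add_two_pi _, Real.sin_add_two_pi _⟩
    refine ⟨‖z‖, hnz, J, hJ, α, hα, ?_⟩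
    rw [polarPt, hc, hs, ← hre, ← him]

theorem closure_doubleSector_le {θ : ℝ} (hθ : θ ∈ Set.Ioo 0 (Real.pi / 2)) {s : Cl n}
    (hs : s ∈ closure (doubleSector n θ)) : Real.cos θ * ‖s‖ ≤ |s.coeff ∅| := by
  have hcl : IsClosed {s : Cl n | Real.cos θ * ‖s‖ ≤ |s.coeff ∅|} :=
    isClosed_le (continuous_const.mul continuous_norm) (coeffCLM ∅).continuous.abs
  exact closure_minimal (fun s hs => (doubleSector_lt hθ hs).le) hcl hs

/-- Pushing z away from the imaginary axis by ε raises |Re z| by ε but cos θ · |z| by at most ε cos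
θ < ε. The shifted points therefore lie in the open sector; this includes the vertex z = 0. -/
theorem slicePt_mem_closure_doubleSector (hJ : J ∈ unitSphere n) {θ : ℝ}
    (hθ : θ ∈ Set.Ioo 0 (Real.pi / 2)) {z : ℂ} (hz : Real.cos θ * ‖z‖ ≤ |z.re|) :
    slicePt J z.re z.im ∈ closure (doubleSector n θ) := by
  have hc1 : Real.cos θ < 1 := by
    rw [← Real.cos_zero]
    exact Real.cos_lt_cos_of_nonneg_of_le_pi le_rfl (by linarith [hθ.2, Real.pi_pos]) hθ.1
  have hcos : 0 < Real.cos θ := Real.cos_pos_of_mem_Ioo ⟨by linarith [hθ.1, Real.pi_pos], hθ.2⟩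
  obtain ⟨σ, hσ, hre⟩ : ∃ σ : ℝ, |σ| = 1 ∧ σ * |z.re| = z.re := by
    rcases le_total 0 z.re with h | h
    · exact ⟨1, by simp, by rw [abs_of_nonneg h, one_mul]⟩
    · exact ⟨-1, by simp, by rw [abs_of_nonpos h]; ring⟩
  have hcont : Continuous fun ε : ℝ => slicePt J (z.re + ε * σ) z.im := by
    unfold slicePt; fun_prop
  have hlim : Filter.Tendsto (fun ε : ℝ => slicePt J (z.re + ε * σ) z.im)
      (nhdsWithin 0 (Set.Ioi 0)) (nhds (slicePt J z.re z.im)) := by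
    have := hcont.tendsto 0
    rw [zero_mul, add_zero] at this
    exact this.mono_left nhdsWithin_le_nhds
  refine mem_closure_of_tendsto hlim ?_
  filter_upwards [self_mem_nhdsWithin] with ε hε
  have hε : 0 < ε := hε
  have hmem : (z + (ε * σ : ℝ)) ∈ cDoubleSector θ := by
    have h1 : ‖z + (ε * σ : ℝ)‖ ≤ ‖z‖ + ε := by
      refine (norm_add_le _ _).trans ?_
      rw [Complex.norm_real, Real.norm_eq_abs, abs_mul, hσ, abs_of_pos hε, mul_one]
    have h2 : |(z + (ε * σ : ℝ)).re| = |z.re| + ε := by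
      have : (z + (ε * σ : ℝ)).re = σ * (|z.re| + ε) := by
        rw [Complex.add_re, Complex.ofReal_re, mul_add, hre]; ring
      rw [this, abs_mul, hσ, one_mul, abs_of_nonneg (by positivity)]
    change Real.cos θ * _ < _
    rw [h2]
    calc Real.cos θ * ‖z + (ε * σ : ℝ)‖ ≤ Real.cos θ * (‖z‖ + ε) := by gcongr
      _ < |z.re| + ε := by nlinarith
  have := (slicePt_mem_doubleSector hJ hθ _).mpr hmem
  simpa using this

theorem sliceDomain_doubleSector (hn : 1 ≤ n) {θ : ℝ} (hθ : θ ∈ Set.Ioo 0 (Real.pi / 2)) (z : ℂ) :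
    (z.re, z.im) ∈ sliceDomain (doubleSector n θ) ↔ z ∈ cDoubleSector θ := by
  constructor
  · intro h
    obtain ⟨J, hJ⟩ := unitSphere_nonempty hn
    exact (slicePt_mem_doubleSector hJ hθ z).mp (h J hJ)
  · exact fun h J hJ => (slicePt_mem_doubleSector hJ hθ z).mpr h

/-! ### Left multiplication -/

section LeftMul

variable {E : Type*} [NormedAddCommGroup E] [NormedSpace ℝ E]

theorem leftMul_apply (s : Cl n) (v : CliffordModule n E) (A : Finset (Fin n)) :
    leftMul s v A = ∑ B, (sgn B (symmDiff B A) * s.coeff B) • v (symmDiff B A) := by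
  simp [leftMul]

theorem leftMul_mul (s t : Cl n) (v : CliffordModule n E) :
    leftMul (s * t) v = leftMul s (leftMul t v) := by
  refine PiLp.ext fun A => ?_
  simp only [leftMul_apply, coeff_mul, Finset.smul_sum, Finset.mul_sum, Finset.sum_smul]
  rw [Finset.sum_comm]
  refine Finset.sum_congr rfl fun B _ => ?_
  have hinv : Function.Involutive (fun C : Finset (Fin n) => symmDiff B C) :=
    fun C => symmDiff_symmDiff_cancel_left B C
  refine Fintype.sum_equiv hinv.toPerm _ _ fun C => ?_
  have e1 : symmDiff (symmDiff B C) (symmDiff B A) = symmDiff C A := by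
    rw [symmDiff_comm B C, symmDiff_assoc, symmDiff_symmDiff_cancel_left]
  change _ = (sgn B (symmDiff B A) * s.coeff B) • (sgn (symmDiff B C)
    (symmDiff (symmDiff B C) (symmDiff B A)) * t.coeff (symmDiff B C)) •
      v (symmDiff (symmDiff B C) (symmDiff B A))
  rw [e1, smul_smul]
  congr 1
  -- `sgn` is multiplicative in each argument for symmetric differences, so the cocycle identity
  -- reduces to `sgn B A` having square one.
  simp only [sgn_symmDiff_left, sgn_symmDiff_right]
  linear_combination (-(sgn B B * sgn B C * sgn C C * sgn C A * s.coeff B *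
    t.coeff (symmDiff B C))) * sgn_mul_self B A

theorem leftMul_one (v : CliffordModule n E) : leftMul (1 : Cl n) v = v := by
  refine PiLp.ext fun A => ?_
  rw [leftMul_apply, Finset.sum_eq_single ∅]
  · have h : symmDiff ∅ A = A := bot_symmDiff A
    rw [coeff_one, if_pos rfl, sgn_empty_left, one_mul, one_smul, h]
  · intro B _ hB
    rw [coeff_one, if_neg hB, mul_zero, zero_smul]
  · intro h; exact absurd (Finset.mem_univ _) h

theorem leftMul_add (s t : Cl n) :
    (leftMul (s + t) : CliffordModule n E →L[ℝ] _) = leftMul s + leftMul t := by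
  refine ContinuousLinearMap.ext fun v => PiLp.ext fun A => ?_
  simp only [_root_.add_apply, PiLp.add_apply, leftMul_apply, coeff_add, mul_add,
    add_smul, Finset.sum_add_distrib]

theorem leftMul_smul (c : ℝ) (s : Cl n) :
    (leftMul (c • s) : CliffordModule n E →L[ℝ] _) = c • leftMul s := by
  refine ContinuousLinearMap.ext fun v => PiLp.ext fun A => ?_
  simp only [_root_.smul_apply, PiLp.smul_apply, leftMul_apply, coeff_smul,
    Finset.smul_sum, smul_smul]
  exact Finset.sum_congr rfl fun B _ => by congr 1; ring

theorem leftMul_algebraMap (c : ℝ) :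
    (leftMul (algebraMap ℝ (Cl n) c) : CliffordModule n E →L[ℝ] _) =
      c • ContinuousLinearMap.id ℝ _ := by
  rw [algebraMap_eq, leftMul_smul]
  congr 1
  exact ContinuousLinearMap.ext leftMul_one

theorem leftMul_slicePt (x y : ℝ) :
    (leftMul (slicePt J x y) : CliffordModule n E →L[ℝ] _) =
      x • ContinuousLinearMap.id ℝ _ + y • leftMul J := by
  rw [slicePt, leftMul_add, leftMul_smul, leftMul_smul]
  congr 2
  exact ContinuousLinearMap.ext leftMul_one

theorem leftMul_comp_self (hJ : J ∈ unitSphere n) :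
    (leftMul J : CliffordModule n E →L[ℝ] _) * leftMul J = -1 := by
  refine ContinuousLinearMap.ext fun v => ?_
  change leftMul J (leftMul J v) = -v
  rw [← leftMul_mul, unitSphere_mul_self hJ,
    show (-1 : Cl n) = (-1 : ℝ) • (1 : Cl n) by rw [neg_one_smul], leftMul_smul]
  simp [leftMul_one]

end LeftMul

end HInfty
end

noncomputable section
namespace HInfty

open Complex (I)
open Filter Topology MeasureTheory

/-! ### Contour integrals on strips -/

/-- In logarithmic coordinates rays become horizontal lines, sectors become strips, and dt / t
becomes Lebesgue measure. -/
theorem integral_Ioi_zero_eq_exp {F : Type*} [NormedAddCommGroup F] [NormedSpace ℝ F] (g : ℝ → F) :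
    ∫ t in Set.Ioi (0 : ℝ), g t = ∫ x : ℝ, Real.exp x • g (Real.exp x) := by
  have h := integral_image_eq_integral_abs_deriv_smul (s := Set.univ) MeasurableSet.univ
    (fun x _ => (Real.hasDerivAt_exp x).hasDerivWithinAt) Real.exp_injective.injOn g
  rw [Set.image_univ, Real.range_exp] at h
  simpa using h

theorem integrableOn_Ioi_zero_iff_exp {F : Type*} [NormedAddCommGroup F] [NormedSpace ℝ F]
    (g : ℝ → F) :
    IntegrableOn g (Set.Ioi (0 : ℝ)) ↔ Integrable fun x : ℝ => Real.exp x • g (Real.exp x) := by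
  have h := integrableOn_image_iff_integrableOn_abs_deriv_smul (s := Set.univ) MeasurableSet.univ
    (fun x _ => (Real.hasDerivAt_exp x).hasDerivWithinAt) Real.exp_injective.injOn g
  rw [Set.image_univ, Real.range_exp] at h
  simpa using h

section Strip

variable {G : ℂ → ℂ} {a b : ℝ}

theorem strip_rectangle (hG : ∀ w : ℂ, w.im ∈ Set.uIcc a b → DifferentiableAt ℂ G w) (X : ℝ) :
    (∫ x : ℝ in -X..X, G (x + a * I)) - (∫ x : ℝ in -X..X, G (x + b * I)) =
      I * (∫ y : ℝ in a..b, G ((-X : ℝ) + y * I)) - I * ∫ y : ℝ in a..b, G (X + y * I) := by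
  have h := Complex.integral_boundary_rect_eq_zero_of_differentiableOn G ⟨-X, a⟩ ⟨X, b⟩
    (fun w hw => (hG w hw.2).differentiableWithinAt)
  simp only [smul_eq_mul] at h
  linear_combination h

theorem continuous_line (hG : ∀ w : ℂ, w.im ∈ Set.uIcc a b → DifferentiableAt ℂ G w) {c : ℝ}
    (hc : c ∈ Set.uIcc a b) : Continuous fun x : ℝ => G (x + c * I) := by
  rw [continuous_iff_continuousAt]
  intro x
  have h : ContinuousAt G ((x : ℂ) + c * I) := (hG _ (by simpa using hc)).continuousAt
  exact ContinuousAt.comp (f := fun x : ℝ => (x : ℂ) + c * I) h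
    (by fun_prop : Continuous fun x : ℝ => (x : ℂ) + c * I).continuousAt

/-- The vertical sides of the rectangle are bounded by `B (±X) * |b - a|` and disappear in the
limit. -/
theorem strip_integral_eq_of_decay
    (hG : ∀ w : ℂ, w.im ∈ Set.uIcc a b → DifferentiableAt ℂ G w) {B : ℝ → ℝ}
    (hB : ∀ w : ℂ, w.im ∈ Set.uIcc a b → ‖G w‖ ≤ B w.re)
    (hB0 : Tendsto B atTop (𝓝 0)) (hB1 : Tendsto (fun x => B (-x)) atTop (𝓝 0))
    (ha : Integrable fun x : ℝ => G (x + a * I)) (hb : Integrable fun x : ℝ => G (x + b * I)) :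
    ∫ x : ℝ, G (x + a * I) = ∫ x : ℝ, G (x + b * I) := by
  have t1 := (intervalIntegral_tendsto_integral ha tendsto_neg_atTop_atBot tendsto_id).sub
    (intervalIntegral_tendsto_integral hb tendsto_neg_atTop_atBot tendsto_id)
  have side : ∀ X : ℝ, ‖∫ y : ℝ in a..b, G (X + y * I)‖ ≤ B X * |b - a| := fun X =>
    intervalIntegral.norm_integral_le_of_norm_le_const fun y hy => by
      simpa using hB (X + y * I) (by simpa using Set.uIoc_subset_uIcc hy)
  have s1 : Tendsto (fun X : ℝ => ∫ y : ℝ in a..b, G (X + y * I)) atTop (𝓝 0) :=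
    squeeze_zero_norm side (by simpa using hB0.mul_const |b - a|)
  have s2 : Tendsto (fun X : ℝ => ∫ y : ℝ in a..b, G ((-X : ℝ) + y * I)) atTop (𝓝 0) :=
    squeeze_zero_norm (fun X => side (-X)) (by simpa using hB1.mul_const |b - a|)
  have t2 := (s2.const_mul I).sub (s1.const_mul I)
  have := tendsto_nhds_unique t1 (t2.congr fun X => (strip_rectangle hG X).symm)
  simpa [sub_eq_zero] using this

/-- Cauchy's theorem on a strip for bounded functions that are integrable on both boundary
lines. -/
theorem strip_integral_eq (hG : ∀ w : ℂ, w.im ∈ Set.uIcc a b → DifferentiableAt ℂ G w) {C : ℝ}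
    (hC : ∀ w : ℂ, w.im ∈ Set.uIcc a b → ‖G w‖ ≤ C)
    (ha : Integrable fun x : ℝ => G (x + a * I)) (hb : Integrable fun x : ℝ => G (x + b * I)) :
    ∫ x : ℝ, G (x + a * I) = ∫ x : ℝ, G (x + b * I) := by
  set M : ℝ := max (|a|) (|b|)
  have hM : ∀ y ∈ Set.uIcc a b, y ^ 2 ≤ M ^ 2 := by
    intro y hy
    rw [← sq_abs y]
    have h1 : |y| ≤ M := by
      have := hy.1; have := hy.2
      rcases le_total a b with h | h
      · rw [Set.uIcc_of_le h] at hy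
        exact abs_le_max_abs_abs hy.1 hy.2
      · rw [Set.uIcc_of_ge h] at hy
        exact (abs_le_max_abs_abs hy.1 hy.2).trans (max_comm _ _).le
    exact pow_le_pow_left₀ (abs_nonneg _) h1 2
  -- Boundedness alone does not make the vertical sides vanish. The factor exp(-δ w²) does, it is
  -- bounded by exp(M²) on the strip for 0 ≤ δ ≤ 1, and it is removed at the end by dominated
  -- convergence as δ → 0.
  have hnorm : ∀ (δ : ℝ) (w : ℂ), ‖Complex.exp (-(δ * w ^ 2))‖ =
      Real.exp (δ * w.im ^ 2) * Real.exp (-(δ * w.re ^ 2)) := by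
    intro δ w
    rw [Complex.norm_exp, ← Real.exp_add]
    congr 1
    simp [pow_two]
    ring
  have hnle : ∀ δ : ℝ, 0 ≤ δ → δ ≤ 1 → ∀ w : ℂ, w.im ∈ Set.uIcc a b →
      ‖Complex.exp (-(δ * w ^ 2))‖ ≤ Real.exp (M ^ 2) * Real.exp (-(δ * w.re ^ 2)) := by
    intro δ h0 h1 w hw
    rw [hnorm]
    gcongr
    nlinarith [hM _ hw, sq_nonneg w.im]
  have hnle' : ∀ δ : ℝ, 0 ≤ δ → δ ≤ 1 → ∀ w : ℂ, w.im ∈ Set.uIcc a b →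
      ‖Complex.exp (-(δ * w ^ 2))‖ ≤ Real.exp (M ^ 2) := by
    intro δ h0 h1 w hw
    refine (hnle δ h0 h1 w hw).trans (mul_le_of_le_one_right (Real.exp_pos _).le ?_)
    rw [Real.exp_le_one_iff]
    nlinarith [sq_nonneg w.re]
  have hint : ∀ c ∈ Set.uIcc a b, Integrable (fun x : ℝ => G (x + c * I)) →
      ∀ δ : ℝ, 0 ≤ δ → δ ≤ 1 →
      Integrable fun x : ℝ => Complex.exp (-(δ * (x + c * I) ^ 2)) * G (x + c * I) := by
    intro c hc hi δ h0 h1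
    refine hi.bdd_mul (c := Real.exp (M ^ 2))
      (by fun_prop : Continuous fun x : ℝ => Complex.exp (-(δ * (x + c * I) ^ 2))).aestronglyMeasurable
      (Filter.Eventually.of_forall fun x => hnle' δ h0 h1 _ (by simpa using hc))
  have hlim0 : ∀ δ : ℝ, 0 < δ → Tendsto (fun x : ℝ => Real.exp (-(δ * x ^ 2))) atTop (𝓝 0) := by
    intro δ hδ
    refine Real.tendsto_exp_atBot.comp (tendsto_neg_atTop_atBot.comp ?_)
    exact (tendsto_pow_atTop two_ne_zero).const_mul_atTop hδ
  have heq : ∀ δ : ℝ, 0 < δ → δ ≤ 1 →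
      ∫ x : ℝ, Complex.exp (-(δ * (x + a * I) ^ 2)) * G (x + a * I) =
      ∫ x : ℝ, Complex.exp (-(δ * (x + b * I) ^ 2)) * G (x + b * I) := by
    intro δ h0 h1
    refine strip_integral_eq_of_decay (G := fun w => Complex.exp (-(δ * w ^ 2)) * G w)
      (B := fun x => Real.exp (M ^ 2) * Real.exp (-(δ * x ^ 2)) * C)
      (fun w hw => DifferentiableAt.mul (by fun_prop) (hG w hw)) (fun w hw => ?_) ?_ ?_
      (hint a Set.left_mem_uIcc ha δ h0.le h1) (hint b Set.right_mem_uIcc hb δ h0.le h1)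
    · rw [norm_mul]
      exact mul_le_mul (hnle δ h0.le h1 w hw) (hC w hw) (norm_nonneg _) (by positivity)
    · simpa using ((hlim0 δ h0).const_mul (Real.exp (M ^ 2))).mul_const C
    · simpa using ((hlim0 δ h0).const_mul (Real.exp (M ^ 2))).mul_const C
  have hconv : ∀ c ∈ Set.uIcc a b, Integrable (fun x : ℝ => G (x + c * I)) →
      Tendsto (fun k : ℕ => ∫ x : ℝ, Complex.exp (-((1 / ((k : ℝ) + 1) : ℝ) * (x + c * I) ^ 2)) *
        G (x + c * I)) atTop (𝓝 (∫ x : ℝ, G (x + c * I))) := by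
    intro c hc hi
    have hk0 : ∀ k : ℕ, (0 : ℝ) ≤ 1 / ((k : ℝ) + 1) := fun k => by positivity
    have hk1 : ∀ k : ℕ, 1 / ((k : ℝ) + 1) ≤ 1 := fun k => by
      rw [div_le_one (by positivity)]; linarith [Nat.cast_nonneg (α := ℝ) k]
    refine tendsto_integral_of_dominated_convergence
      (fun x => Real.exp (M ^ 2) * ‖G (x + c * I)‖) (fun k => (hint c hc hi _ (hk0 k) (hk1 k)).1)
      (hi.norm.const_mul _) (fun k => Filter.Eventually.of_forall fun x => ?_)
      (Filter.Eventually.of_forall fun x => ?_)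
    · rw [norm_mul]
      exact mul_le_mul_of_nonneg_right (hnle' _ (hk0 k) (hk1 k) _ (by simpa using hc))
        (norm_nonneg _)
    · have hc' : Continuous fun δ : ℝ => Complex.exp (-(δ * (x + c * I) ^ 2)) * G (x + c * I) := by
        fun_prop
      have := (hc'.tendsto 0).comp tendsto_one_div_add_atTop_nhds_zero_nat
      simpa [Function.comp_def] using this
  refine tendsto_nhds_unique (hconv a Set.left_mem_uIcc ha)
    ((hconv b Set.right_mem_uIcc hb).congr fun k => (heq _ (by positivity) ?_).symm)
  rw [div_le_one (by positivity)]; linarith [Nat.cast_nonneg (α := ℝ) k]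

/-- The principal value of the difference of the integrals over the boundary lines of a strip, for
a function with limits `0` and `L` at the two ends. -/
theorem strip_principal_value (hG : ∀ w : ℂ, w.im ∈ Set.uIcc a b → DifferentiableAt ℂ G w)
    {L : ℂ} {K : ℝ}
    (h1 : ∀ w : ℂ, w.im ∈ Set.uIcc a b → ‖G w - L‖ ≤ K * Real.exp (-w.re))
    (h0 : ∀ w : ℂ, w.im ∈ Set.uIcc a b → ‖G w‖ ≤ K * Real.exp w.re) :
    Tendsto (fun X : ℝ => (∫ x : ℝ in -X..X, G (x + a * I)) - ∫ x : ℝ in -X..X, G (x + b * I))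
      atTop (𝓝 (-(I * L * (b - a)))) := by
  have hexp : Tendsto (fun X : ℝ => K * Real.exp (-X) * |b - a|) atTop (𝓝 0) := by
    simpa using ((Real.tendsto_exp_neg_atTop_nhds_zero.const_mul K).mul_const |b - a|)
  have s2 : Tendsto (fun X : ℝ => ∫ y : ℝ in a..b, G ((-X : ℝ) + y * I)) atTop (𝓝 0) := by
    refine squeeze_zero_norm (fun X => ?_) hexp
    refine intervalIntegral.norm_integral_le_of_norm_le_const fun y hy => ?_
    simpa using h0 ((-X : ℝ) + y * I) (by simpa using Set.uIoc_subset_uIcc hy)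
  -- Only the right-hand vertical side survives, and there the integrand tends to L.
  have s1 : Tendsto (fun X : ℝ => ∫ y : ℝ in a..b, G (X + y * I)) atTop (𝓝 ((b - a) * L)) := by
    rw [tendsto_iff_norm_sub_tendsto_zero]
    refine squeeze_zero (fun X => norm_nonneg _) (fun X => ?_) hexp
    have hcont : IntervalIntegrable (fun y : ℝ => G (X + y * I)) volume a b := by
      refine ContinuousOn.intervalIntegrable fun y hy => ?_
      have h : ContinuousAt G ((X : ℂ) + y * I) := (hG _ (by simpa using hy)).continuousAt
      exact (ContinuousAt.comp (f := fun y : ℝ => (X : ℂ) + y * I) h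
        (by fun_prop : Continuous fun y : ℝ => (X : ℂ) + y * I).continuousAt).continuousWithinAt
    have hL : ((b : ℂ) - a) * L = ∫ _ in a..b, L := by
      rw [intervalIntegral.integral_const]
      simp
    rw [hL, ← intervalIntegral.integral_sub hcont (by simp)]
    refine intervalIntegral.norm_integral_le_of_norm_le_const fun y hy => ?_
    simpa using h1 (X + y * I) (by simpa using Set.uIoc_subset_uIcc hy)
  have t2 := (s2.const_mul I).sub (s1.const_mul I)
  refine (t2.congr fun X => (strip_rectangle hG X).symm).trans ?_
  rw [show I * 0 - I * ((b - a) * L) = -(I * L * (b - a)) by ring]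

end Strip

/-! ### Uniqueness of the values at zero and infinity -/

theorem not_integrableOn_Ioc_inv {ε : ℝ} (hε : 0 < ε) :
    ¬ IntegrableOn (fun t : ℝ => t⁻¹) (Set.Ioc 0 ε) := by
  rw [← intervalIntegrable_iff_integrableOn_Ioc_of_le hε.le, intervalIntegrable_inv_iff]
  rintro (h | h)
  · exact hε.ne h
  · exact h Set.left_mem_uIcc

/-- If l ≠ 0 then |g| > |l| / 2 along F, so 1 / t would be integrable on a set where it is not. The
filter F stands for either end of the half-line. -/
theorem eq_zero_of_integrableOn_div {g : ℝ → ℝ} {l : ℝ} {F : Filter ℝ} {S : Set ℝ}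
    (hg : Tendsto g F (𝓝 l)) (hS0 : S ⊆ Set.Ioi 0)
    (hF : ∀ U ∈ F, ∃ S' ⊆ S ∩ U, MeasurableSet S' ∧ ¬ IntegrableOn (fun t : ℝ => t⁻¹) S')
    (hi : IntegrableOn (fun t => |g t| / t) S) : l = 0 := by
  by_contra hl
  have hpos : 0 < |l| / 2 := by positivity
  have hev : ∀ᶠ t in F, |l| / 2 < |g t| := hg.abs.eventually_const_lt (half_lt_self (abs_pos.mpr hl))
  obtain ⟨S', hS', hm, hn⟩ := hF _ hev
  refine hn ?_
  have h1 : IntegrableOn (fun t => (|l| / 2)⁻¹ * (|g t| / t)) S' :=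
    (hi.mono_set fun t ht => (hS' ht).1).const_mul _
  refine Integrable.mono' h1 measurable_inv.aestronglyMeasurable ?_
  filter_upwards [ae_restrict_mem hm] with t ht
  have ht0 : 0 < t := hS0 (hS' ht).1
  have hgt : |l| / 2 < |g t| := (hS' ht).2
  rw [Real.norm_of_nonneg (inv_nonneg.mpr ht0.le)]
  calc t⁻¹ = (|l| / 2)⁻¹ * ((|l| / 2) / t) := by field_simp
    _ ≤ (|l| / 2)⁻¹ * (|g t| / t) := by gcongr

/-- The numerator tends to |a| at infinity and to |a + b| at zero, and dt / t diverges at both ends.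
This is why f_0 and f_∞ are determined by f. -/
theorem eq_zero_of_integrableOn_const_add {a b : ℝ}
    (hi : IntegrableOn (fun t : ℝ => |a + (1 + t ^ 2)⁻¹ * b| / t) (Set.Ioi 0)) :
    a = 0 ∧ b = 0 := by
  have ha : a = 0 := by
    refine eq_zero_of_integrableOn_div (F := atTop) ?_ subset_rfl ?_ hi
    · have h : Tendsto (fun t : ℝ => 1 + t ^ 2) atTop atTop :=
        tendsto_atTop_add_const_left _ _ (tendsto_pow_atTop two_ne_zero)
      simpa using (h.inv_tendsto_atTop.mul_const b).const_add a
    · intro U hU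
      obtain ⟨R, hR⟩ := mem_atTop_sets.mp hU
      refine ⟨Set.Ioi (max R 0), fun t ht => ⟨?_, hR t ?_⟩, measurableSet_Ioi,
        not_integrableOn_Ioi_inv⟩
      · exact (le_max_right R 0).trans_lt ht
      · exact (le_max_left R 0).trans (le_of_lt ht)
  have hab : a + b = 0 := by
    refine eq_zero_of_integrableOn_div (F := 𝓝[>] 0) ?_ subset_rfl ?_ hi
    · have h : ContinuousAt (fun t : ℝ => a + (1 + t ^ 2)⁻¹ * b) 0 := by
        refine ContinuousAt.add continuousAt_const (ContinuousAt.mul (ContinuousAt.inv₀ ?_ ?_) ?_)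
        · fun_prop
        · norm_num
        · exact continuousAt_const
      have := h.tendsto
      simp only [ne_eq, OfNat.ofNat_ne_zero, not_false_eq_true, zero_pow, add_zero, inv_one,
        one_mul] at this
      exact this.mono_left nhdsWithin_le_nhds
    · intro U hU
      obtain ⟨ε, hε, hU'⟩ := mem_nhdsGT_iff_exists_Ioc_subset.mp hU
      exact ⟨Set.Ioc 0 ε, fun t ht => ⟨ht.1, hU' ht⟩, measurableSet_Ioc,
        not_integrableOn_Ioc_inv hε⟩
  exact ⟨ha, by linarith⟩

end HInfty
end

noncomputable section
namespace HInfty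

open Polynomial

/-! ### Polynomials of partially defined operators -/

section PowDomain

variable {V : Type*} [AddCommGroup V] [Module ℝ V]

/-- The domain of the `N`-th power of the restriction of `L` to `D`. -/
def powDomain (L : V →ₗ[ℝ] V) (D : Submodule ℝ V) (N : ℕ) : Submodule ℝ V where
  carrier := {u | ∀ k < N, (L ^ k) u ∈ D}
  zero_mem' := fun k _ => by rw [map_zero]; exact D.zero_mem
  add_mem' := fun ha hb k hk => by rw [map_add]; exact D.add_mem (ha k hk) (hb k hk)
  smul_mem' := fun c a ha k hk => by rw [map_smul]; exact D.smul_mem c (ha k hk)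

variable {L : V →ₗ[ℝ] V} {D : Submodule ℝ V}

theorem mem_powDomain {N : ℕ} {u : V} : u ∈ powDomain L D N ↔ ∀ k < N, (L ^ k) u ∈ D := Iff.rfl

theorem powDomain_mono {M N : ℕ} (h : M ≤ N) : powDomain L D N ≤ powDomain L D M :=
  fun _ hu k hk => hu k (hk.trans_le h)

theorem mem_powDomain_add {M N : ℕ} {u : V} :
    u ∈ powDomain L D (M + N) ↔ u ∈ powDomain L D M ∧ (L ^ M) u ∈ powDomain L D N := by
  constructor
  · refine fun h => ⟨powDomain_mono (Nat.le_add_right _ _) h, fun k hk => ?_⟩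
    rw [← Module.End.mul_apply, ← pow_add]
    exact h _ (by omega)
  · rintro ⟨h1, h2⟩ k hk
    by_cases hkM : k < M
    · exact h1 k hkM
    · have := h2 (k - M) (by omega)
      rwa [← Module.End.mul_apply, ← pow_add, Nat.sub_add_cancel (not_lt.mp hkM)] at this

theorem mem_powDomain_one {u : V} : u ∈ powDomain L D 1 ↔ u ∈ D := by
  simp [mem_powDomain]

theorem mem_powDomain_succ {N : ℕ} {u : V} :
    u ∈ powDomain L D (N + 1) ↔ u ∈ D ∧ L u ∈ powDomain L D N := by
  rw [add_comm, mem_powDomain_add, mem_powDomain_one, pow_one]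

theorem aeval_mem_powDomain {p : ℝ[X]} {M N : ℕ} (hp : p.natDegree ≤ N) {u : V}
    (hu : u ∈ powDomain L D (N + M)) : aeval L p u ∈ powDomain L D M := by
  rw [aeval_eq_sum_range, LinearMap.sum_apply]
  refine Submodule.sum_mem _ fun k hk => ?_
  rw [LinearMap.smul_apply]
  refine Submodule.smul_mem _ _ ?_
  have hk' : k ≤ N := (Nat.lt_succ_iff.mp (Finset.mem_range.mp hk)).trans hp
  exact (mem_powDomain_add.mp (powDomain_mono (Nat.add_le_add_right hk' M) hu)).2

/-- A regularity bootstrap: once u lies in dom L^(N + M) with N = deg p, all terms of p[L]u below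
the leading one lie in dom L^(M + 1), hence so does the leading one. -/
theorem mem_powDomain_of_aeval {p : ℝ[X]} (hp : p ≠ 0) {M : ℕ} {u : V}
    (hu : u ∈ powDomain L D p.natDegree) (h : aeval L p u ∈ powDomain L D M) :
    u ∈ powDomain L D (p.natDegree + M) := by
  induction M with
  | zero => exact hu
  | succ M ih =>
    have hM := ih (powDomain_mono (Nat.le_succ M) h)
    refine mem_powDomain_add.mpr ⟨hu, ?_⟩
    have hlead : p.coeff p.natDegree ≠ 0 := by
      rwa [coeff_natDegree, Ne, leadingCoeff_eq_zero]
    rw [aeval_eq_sum_range, Finset.sum_range_succ, LinearMap.add_apply, LinearMap.sum_apply,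
      LinearMap.smul_apply] at h
    have hlow : ∑ k ∈ Finset.range p.natDegree, (p.coeff k • L ^ k) u ∈
        powDomain L D (M + 1) := by
      refine Submodule.sum_mem _ fun k hk => ?_
      rw [LinearMap.smul_apply]
      refine Submodule.smul_mem _ _ ?_
      have hk' := Finset.mem_range.mp hk
      exact (mem_powDomain_add.mp (powDomain_mono (by omega : k + (M + 1) ≤ _) hM)).2
    have := (Submodule.add_mem_iff_right _ hlow).mp h
    exact (Submodule.smul_mem_iff _ hlead).mp this

end PowDomain

/-! ### Polynomials of an operator with their domains, and their bounded inverses -/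

section PolyOp

variable {V : Type*} [NormedAddCommGroup V] [NormedSpace ℝ V]

/-- A purely algebraic extension, with no continuity. It turns polynomials of `T` into elements of
an endomorphism algebra, where they commute, and leaves only membership in `powDomain` to be
checked. -/
theorem exists_linearMap_extend (T : V →ₗ.[ℝ] V) :
    ∃ L : V →ₗ[ℝ] V, ∀ u : T.domain, T u = L u := by
  obtain ⟨L, hL⟩ := LinearMap.exists_extend T.toFun
  exact ⟨L, fun u => (LinearMap.congr_fun hL u).symm⟩

variable {T : V →ₗ.[ℝ] V} {L : V →ₗ[ℝ] V}

theorem powOp_eq (hL : ∀ u : T.domain, T u = L u) (k : ℕ) :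
    powOp T k = (L ^ k).toPMap (powDomain L T.domain k) := by
  induction k with
  | zero =>
    refine LinearPMap.ext ?_ fun x hx hx' => ?_
    · ext u
      simp [powOp, total, mem_powDomain]
    · rfl
  | succ k ih =>
    have hval : ∀ (u : V) (hu : u ∈ (powOp T k).domain), powOp T k ⟨u, hu⟩ = (L ^ k) u := by
      rw [ih]
      exact fun u hu => rfl
    have hdom : (powOp T k).domain = powDomain L T.domain k := by rw [ih]; rfl
    refine LinearPMap.ext ?_ fun x hx hx' => ?_
    · ext u
      change (∃ h : u ∈ (powOp T k).domain, powOp T k ⟨u, h⟩ ∈ T.domain) ↔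
        u ∈ powDomain L T.domain (k + 1)
      rw [mem_powDomain_add, mem_powDomain_one, ← hdom]
      constructor
      · rintro ⟨h, h'⟩
        exact ⟨h, by rwa [hval] at h'⟩
      · rintro ⟨h, h'⟩
        exact ⟨h, by rwa [hval]⟩
    · have hx1 : ∃ h : x ∈ (powOp T k).domain, powOp T k ⟨x, h⟩ ∈ T.domain := hx
      obtain ⟨h, h'⟩ := hx1
      change T ⟨powOp T k ⟨x, h⟩, h'⟩ = (L ^ (k + 1)) x
      rw [hL, pow_succ', Module.End.mul_apply, ← hval x h]

theorem sum_toPMap {ι : Type*} (s : Finset ι) (c : ι → ℝ) (f : ι → V →ₗ[ℝ] V)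
    (D : ι → Submodule ℝ V) :
    ∑ i ∈ s, c i • (f i).toPMap (D i) =
      (∑ i ∈ s, c i • f i).toPMap (⨅ i ∈ s, D i) := by
  classical
  induction s using Finset.induction_on with
  | empty =>
    refine LinearPMap.ext ?_ fun x hx hx' => ?_
    · simp
    · simp [LinearPMap.zero_apply]
  | insert a s ha ih =>
    rw [Finset.sum_insert ha, ih]
    refine LinearPMap.ext ?_ fun x hx hx' => ?_
    · rw [LinearMap.toPMap_domain, Finset.iInf_insert]
      rfl
    · change c a • f a x + (∑ i ∈ s, c i • f i) x = (∑ i ∈ insert a s, c i • f i) x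
      rw [Finset.sum_insert ha]
      rfl

theorem polyOp_eq (hL : ∀ u : T.domain, T u = L u) (p : ℝ[X]) :
    polyOp T p = (aeval L p).toPMap (powDomain L T.domain p.natDegree) := by
  unfold polyOp
  simp only [powOp_eq hL]
  rw [sum_toPMap, aeval_eq_sum_range]
  congr 1
  -- The domains of the powers decrease, so their intersection is the domain of the highest one,
  -- even if lower coefficients vanish.
  refine le_antisymm ?_ ?_
  · exact iInf₂_le p.natDegree (Finset.self_mem_range_succ _)
  · exact le_iInf₂ fun k hk => powDomain_mono (Nat.lt_succ_iff.mp (Finset.mem_range.mp hk))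

/-- The bounded operator `B` is the inverse of `q[L]` with domain `dom L ^ N`, `N = deg q`. -/
structure IsPolyInverse (L : V →ₗ[ℝ] V) (D : Submodule ℝ V) (q : ℝ[X]) (B : V →L[ℝ] V) : Prop where
  ne_zero : q ≠ 0
  mem : ∀ v, B v ∈ powDomain L D q.natDegree
  right_inv : ∀ v, aeval L q (B v) = v
  left_inv : ∀ u ∈ powDomain L D q.natDegree, B (aeval L q u) = u

namespace IsPolyInverse

variable {D : Submodule ℝ V} {q q' : ℝ[X]} {B B' : V →L[ℝ] V}

theorem C {c : ℝ} (hc : c ≠ 0) :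
    IsPolyInverse L D (Polynomial.C c) (c⁻¹ • ContinuousLinearMap.id ℝ V) where
  ne_zero := by simpa using hc
  mem v := by simp [mem_powDomain]
  right_inv v := by
    rw [aeval_C, Module.algebraMap_end_apply]
    simp [smul_smul, hc]
  left_inv u _ := by
    rw [aeval_C, Module.algebraMap_end_apply]
    simp [smul_smul, hc]

theorem mul (h : IsPolyInverse L D q B) (h' : IsPolyInverse L D q' B') :
    IsPolyInverse L D (q * q') (B' * B) where
  ne_zero := mul_ne_zero h.ne_zero h'.ne_zero
  mem v := by
    rw [natDegree_mul h.ne_zero h'.ne_zero, add_comm]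
    refine mem_powDomain_of_aeval h'.ne_zero (h'.mem _) ?_
    change aeval L q' (B' (B v)) ∈ _
    rw [h'.right_inv]
    exact h.mem v
  right_inv v := by
    rw [map_mul, Module.End.mul_apply]
    change aeval L q (aeval L q' (B' (B v))) = v
    rw [h'.right_inv, h.right_inv]
  left_inv u hu := by
    rw [natDegree_mul h.ne_zero h'.ne_zero, add_comm] at hu
    rw [map_mul, Module.End.mul_apply]
    change B' (B _) = u
    rw [h.left_inv _ (aeval_mem_powDomain le_rfl hu),
      h'.left_inv _ (powDomain_mono (Nat.le_add_right _ _) hu)]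

theorem unique (h : IsPolyInverse L D q B) (h' : IsPolyInverse L D q B') : B = B' :=
  ContinuousLinearMap.ext fun v => by
    rw [← h'.left_inv _ (h.mem v), h.right_inv]

theorem mem_powDomain_add (h : IsPolyInverse L D q B) {M : ℕ} {v : V} (hv : v ∈ powDomain L D M) :
    B v ∈ powDomain L D (q.natDegree + M) :=
  mem_powDomain_of_aeval h.ne_zero (h.mem v) (by rwa [h.right_inv])

/-- By the bootstrap L (B v) lies in the domain of q[L], and q[L] sends it to L v. Applying B gives
the claim. -/
theorem map_comm (h : IsPolyInverse L D q B) {v : V} (hv : v ∈ D) : B (L v) = L (B v) := by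
  have h1 : B v ∈ powDomain L D (q.natDegree + 1) :=
    h.mem_powDomain_add (mem_powDomain_one.mpr hv)
  have h2 : L (B v) ∈ powDomain L D q.natDegree := (mem_powDomain_succ.mp h1).2
  have h3 : aeval L q (L (B v)) = L v := by
    have : aeval L q (L (B v)) = L (aeval L q (B v)) := by
      rw [← Module.End.mul_apply, ← Module.End.mul_apply]
      congr 1
      have hX : L = aeval L (X : ℝ[X]) := (aeval_X L).symm
      conv_lhs => rw [show aeval L q * L = aeval L q * aeval L (X : ℝ[X]) by rw [aeval_X]]
      conv_rhs => rw [show L * aeval L q = aeval L (X : ℝ[X]) * aeval L q by rw [aeval_X]]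
      rw [← map_mul, ← map_mul, mul_comm]
    rw [this, h.right_inv]
  rw [← h3, h.left_inv _ h2]

theorem map_pow_comm (h : IsPolyInverse L D q B) {k : ℕ} {v : V} (hv : v ∈ powDomain L D k) :
    B ((L ^ k) v) = (L ^ k) (B v) := by
  induction k with
  | zero => rfl
  | succ k ih =>
    rw [pow_succ', Module.End.mul_apply, h.map_comm (hv k (Nat.lt_succ_self k)),
      ih (powDomain_mono (Nat.le_succ k) hv), Module.End.mul_apply]

theorem map_aeval_comm (h : IsPolyInverse L D q B) {p : ℝ[X]} {v : V}
    (hv : v ∈ powDomain L D p.natDegree) : B (aeval L p v) = aeval L p (B v) := by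
  rw [aeval_eq_sum_range, LinearMap.sum_apply, LinearMap.sum_apply, map_sum]
  refine Finset.sum_congr rfl fun k hk => ?_
  rw [LinearMap.smul_apply, LinearMap.smul_apply, map_smul,
    h.map_pow_comm (powDomain_mono (Nat.lt_succ_iff.mp (Finset.mem_range.mp hk)) hv)]

theorem commute (h : IsPolyInverse L D q B) (h' : IsPolyInverse L D q' B') : B * B' = B' * B :=
  (h'.mul h).unique (mul_comm q' q ▸ h.mul h')

end IsPolyInverse

theorem toBounded_eq {A : V →ₗ.[ℝ] V} {B : V →L[ℝ] V} (h : total B = A) : toBounded A = B := by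
  have hex : ∃ B : V →L[ℝ] V, total B = A := ⟨B, h⟩
  rw [toBounded, dif_pos hex]
  refine ContinuousLinearMap.ext fun v => ?_
  have h2 : total hex.choose = total B := hex.choose_spec.trans h.symm
  have h3 : ∀ A A' : V →ₗ.[ℝ] V, A = A' → ∀ (h : v ∈ A.domain) (h' : v ∈ A'.domain),
      A ⟨v, h⟩ = A' ⟨v, h'⟩ := by rintro A _ rfl h h'; rfl
  exact h3 _ _ h2 trivial trivial

theorem injective_polyOp_iff (hL : ∀ u : T.domain, T u = L u) (q : ℝ[X]) :
    Function.Injective (polyOp T q) ↔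
      ∀ u ∈ powDomain L T.domain q.natDegree, aeval L q u = 0 → u = 0 := by
  rw [polyOp_eq hL]
  constructor
  · intro h u hu h0
    have := @h ⟨u, hu⟩ 0 (by rw [LinearPMap.map_zero]; exact h0)
    exact congrArg Subtype.val this
  · intro h u v huv
    have huv' : aeval L q (u : V) = aeval L q (v : V) := huv
    have := h (u - v) (Submodule.sub_mem _ u.2 v.2) (by rw [map_sub, huv', sub_self])
    exact Subtype.ext (sub_eq_zero.mp this)

theorem isPolyInverse_of_total (hL : ∀ u : T.domain, T u = L u) {q : ℝ[X]} (hq : q ≠ 0)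
    {B : V →L[ℝ] V} (hi : Function.Injective (polyOp T q)) (hB : total B = (polyOp T q).inverse) :
    IsPolyInverse L T.domain q B := by
  have hker : LinearMap.ker (polyOp T q).toFun = ⊥ := LinearMap.ker_eq_bot.mpr hi
  have hg : ∀ v, ∃ u ∈ powDomain L T.domain q.natDegree, u = B v ∧ aeval L q u = v := by
    intro v
    have h1 : (v, B v) ∈ (polyOp T q).inverse.graph := by
      rw [← hB]
      exact (LinearPMap.mem_graph_iff _).mpr ⟨⟨v, trivial⟩, rfl, rfl⟩
    rw [LinearPMap.inverse_graph hker] at h1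
    obtain ⟨⟨u, w⟩, h2, h3⟩ := h1
    rw [polyOp_eq hL] at h2
    obtain ⟨y, hy1, hy2⟩ := (LinearPMap.mem_graph_iff _).mp h2
    simp at h3 hy1 hy2
    refine ⟨u, hy1 ▸ y.2, h3.2, ?_⟩
    rw [← h3.1, ← hy2, ← hy1]
    rfl
  refine ⟨hq, fun v => ?_, fun v => ?_, fun u hu => ?_⟩
  · obtain ⟨u, hu, rfl, -⟩ := hg v
    exact hu
  · obtain ⟨u, hu, rfl, h⟩ := hg v
    exact h
  · obtain ⟨u', hu', h1, h2⟩ := hg (aeval L q u)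
    rw [← h1]
    have := (injective_polyOp_iff hL q).mp hi (u' - u) (Submodule.sub_mem _ hu' hu)
      (by rw [map_sub, h2, sub_self])
    exact sub_eq_zero.mp this

theorem IsPolyInverse.injective (hL : ∀ u : T.domain, T u = L u) {q : ℝ[X]} {B : V →L[ℝ] V}
    (h : IsPolyInverse L T.domain q B) : Function.Injective (polyOp T q) :=
  (injective_polyOp_iff hL q).mpr fun u hu h0 => by
    rw [← h.left_inv u hu, h0, map_zero]

theorem IsPolyInverse.bijective (hL : ∀ u : T.domain, T u = L u) {q : ℝ[X]} {B : V →L[ℝ] V}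
    (h : IsPolyInverse L T.domain q B) : Function.Bijective (polyOp T q) := by
  refine ⟨h.injective hL, fun v => ?_⟩
  rw [polyOp_eq hL]
  exact ⟨⟨B v, h.mem v⟩, h.right_inv v⟩

theorem IsPolyInverse.total_eq (hL : ∀ u : T.domain, T u = L u) {q : ℝ[X]} {B : V →L[ℝ] V}
    (h : IsPolyInverse L T.domain q B) : total B = (polyOp T q).inverse := by
  have hker : LinearMap.ker (polyOp T q).toFun = ⊥ :=
    LinearMap.ker_eq_bot.mpr (h.injective hL)
  refine LinearPMap.eq_of_le_of_domain_eq (LinearPMap.le_of_le_graph ?_) ?_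
  · rintro ⟨v, w⟩ hvw
    obtain ⟨y, hy1, hy2⟩ := (LinearPMap.mem_graph_iff _).mp hvw
    simp only at hy1 hy2
    have hw : w = B v := by rw [← hy2, ← hy1]; rfl
    rw [LinearPMap.inverse_graph hker]
    refine ⟨(w, v), ?_, rfl⟩
    rw [polyOp_eq hL]
    refine (LinearPMap.mem_graph_iff _).mpr ⟨⟨w, hw ▸ h.mem v⟩, rfl, ?_⟩
    change aeval L q w = v
    rw [hw, h.right_inv]
  · rw [LinearPMap.inverse_domain]
    refine Eq.symm (LinearMap.range_eq_top.mpr ?_)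
    exact (h.bijective hL).2

theorem mem_pcomp_graph {A A' : V →ₗ.[ℝ] V} {v w : V} :
    (v, w) ∈ (pcomp A A').graph ↔ ∃ x, (v, x) ∈ A'.graph ∧ (x, w) ∈ A.graph := by
  constructor
  · intro h
    obtain ⟨⟨y, hy, hy'⟩, h1, h2⟩ := (LinearPMap.mem_graph_iff _).mp h
    simp only at h1 h2
    subst h1
    refine ⟨A' ⟨y, hy⟩, A'.mem_graph ⟨y, hy⟩, ?_⟩
    rw [← h2]
    exact A.mem_graph ⟨_, hy'⟩
  · rintro ⟨x, h1, h2⟩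
    obtain ⟨⟨y, hy⟩, e1, e2⟩ := (LinearPMap.mem_graph_iff _).mp h1
    obtain ⟨⟨z, hz⟩, e3, e4⟩ := (LinearPMap.mem_graph_iff _).mp h2
    simp only at e1 e2 e3 e4
    subst e1 e2 e3
    refine (LinearPMap.mem_graph_iff _).mpr ⟨⟨y, hy, hz⟩, rfl, e4⟩

theorem mem_total_graph {B : V →L[ℝ] V} {v w : V} : (v, w) ∈ (total B).graph ↔ w = B v := by
  constructor
  · intro h
    obtain ⟨y, e1, e2⟩ := (LinearPMap.mem_graph_iff _).mp h
    simp only at e1 e2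
    rw [← e2, ← e1]; rfl
  · rintro rfl
    exact (LinearPMap.mem_graph_iff _).mpr ⟨⟨v, trivial⟩, rfl, rfl⟩

theorem mem_total_inverse_graph {A : V →L[ℝ] V} (hA : Function.Injective A) {v w : V} :
    (v, w) ∈ (total A).inverse.graph ↔ v = A w := by
  have hker : LinearMap.ker (total A).toFun = ⊥ := LinearMap.ker_eq_bot.mpr
    fun x y hxy => Subtype.ext (hA hxy)
  rw [LinearPMap.inverse_graph hker]
  constructor
  · rintro ⟨⟨a, b⟩, h, e⟩
    have := mem_total_graph.mp h
    simp at e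
    rw [← e.1, ← e.2, this]
  · rintro rfl
    exact ⟨(w, A w), mem_total_graph.mpr rfl, rfl⟩

theorem mem_polyOp_graph (hL : ∀ u : T.domain, T u = L u) {p : ℝ[X]} {v w : V} :
    (v, w) ∈ (polyOp T p).graph ↔
      v ∈ powDomain L T.domain p.natDegree ∧ aeval L p v = w := by
  rw [polyOp_eq hL, LinearPMap.mem_graph_iff]
  constructor
  · rintro ⟨⟨y, hy⟩, e1, e2⟩
    simp only at e1 e2
    subst e1
    exact ⟨hy, e2⟩
  · rintro ⟨h1, h2⟩
    exact ⟨⟨v, h1⟩, rfl, h2⟩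

/-- For a closed operator `L` on `D`, the product `L B` with a bounded operator `B` with range in
`D` is bounded. -/
theorem exists_bounded_comp [CompleteSpace V] (hL : ∀ u : T.domain, T u = L u)
    (hT : T.IsClosed) {B : V →L[ℝ] V} (hB : ∀ v, B v ∈ T.domain) :
    ∃ R : V →L[ℝ] V, ∀ v, R v = L (B v) := by
  let g : V →ₗ[ℝ] V := L.comp (B : V →ₗ[ℝ] V)
  have hg : IsClosed (g.graph : Set (V × V)) := by
    -- The graph of L B is a continuous preimage of the closed graph of T, so the closed graph
    -- theorem applies.
    have h1 : (g.graph : Set (V × V)) = (fun x : V × V => (B x.1, x.2)) ⁻¹' (T.graph : Set (V × V)) := by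
      ext ⟨v, w⟩
      simp only [SetLike.mem_coe, LinearMap.mem_graph_iff, Set.mem_preimage]
      rw [LinearPMap.mem_graph_iff]
      constructor
      · rintro rfl
        exact ⟨⟨B v, hB v⟩, rfl, hL _⟩
      · rintro ⟨y, e1, e2⟩
        simp only at e1 e2
        rw [← e2, hL, e1]; rfl
    rw [h1]
    exact IsClosed.preimage (by fun_prop) hT
  exact ⟨ContinuousLinearMap.ofIsClosedGraph hg, fun v => rfl⟩

end PolyOp

end HInfty
end

noncomputable section
namespace HInfty

open Polynomial
open Complex (I)
open scoped ComplexConjugate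

/-! ### Resolvent families -/

/-- The quadratic polynomial with roots `z` and `conj z`. -/
def quadPoly (z : ℂ) : ℝ[X] := X ^ 2 - C (2 * z.re) * X + C (‖z‖ ^ 2)

theorem natDegree_quadPoly (z : ℂ) : (quadPoly z).natDegree = 2 := by
  unfold quadPoly; compute_degree!

theorem quadPoly_ne_zero (z : ℂ) : quadPoly z ≠ 0 := by
  intro h
  have := natDegree_quadPoly z
  rw [h] at this
  simp at this

theorem quadPoly_I : quadPoly I = 1 + X ^ 2 := by
  simp [quadPoly, add_comm]

theorem quadPoly_conj (z : ℂ) : quadPoly (conj z) = quadPoly z := by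
  simp [quadPoly]

theorem aeval_quadPoly (c z : ℂ) : aeval z (quadPoly c) = (z - c) * (z - conj c) := by
  simp only [quadPoly, map_add, map_sub, map_mul, map_pow, aeval_X, aeval_C, Complex.coe_algebraMap]
  have h1 : c * conj c = (‖c‖ : ℂ) ^ 2 := Complex.mul_conj' c
  have h2 := Complex.add_conj c
  push_cast at h2 ⊢
  linear_combination z * h2 - h1

/-- The complement of the closed double sector of angle `ω`. -/
def cOuter (ω : ℝ) : Set ℂ := {z | |z.re| < Real.cos ω * ‖z‖}

theorem isOpen_cOuter (ω : ℝ) : IsOpen (cOuter ω) :=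
  isOpen_lt (Complex.continuous_re.abs) (continuous_const.mul continuous_norm)

theorem isOpen_cDoubleSector (θ : ℝ) : IsOpen (cDoubleSector θ) :=
  isOpen_lt (continuous_const.mul continuous_norm) (Complex.continuous_re.abs)

theorem I_mem_cOuter {ω : ℝ} (hω : ω ∈ Set.Ioo 0 (Real.pi / 2)) : I ∈ cOuter ω := by
  have : 0 < Real.cos ω := Real.cos_pos_of_mem_Ioo ⟨by linarith [hω.1, Real.pi_pos], hω.2⟩
  simpa [cOuter] using this

theorem conj_mem_cOuter {ω : ℝ} {z : ℂ} (hz : z ∈ cOuter ω) : conj z ∈ cOuter ω := by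
  simpa [cOuter] using hz

/-! ### Complex scalars acting on operators, and complex-valued functionals -/

section

variable {V : Type*} [NormedAddCommGroup V] [NormedSpace ℝ V]

/-- The action of `ℂ` on `V` by the imaginary unit `j`. -/
def scalarOp (j : V →L[ℝ] V) (z : ℂ) : V →L[ℝ] V := z.re • 1 + z.im • j

theorem scalarOp_ofReal (j : V →L[ℝ] V) (r : ℝ) : scalarOp j r = r • 1 := by
  simp [scalarOp]

theorem scalarOp_add (j : V →L[ℝ] V) (z w : ℂ) :
    scalarOp j (z + w) = scalarOp j z + scalarOp j w := by
  simp only [scalarOp, Complex.add_re, Complex.add_im, add_smul]; abel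

theorem scalarOp_neg (j : V →L[ℝ] V) (z : ℂ) : scalarOp j (-z) = -scalarOp j z := by
  simp only [scalarOp, Complex.neg_re, Complex.neg_im, neg_smul]; abel

theorem scalarOp_mul {j : V →L[ℝ] V} (hj : j * j = -1) (z w : ℂ) :
    scalarOp j (z * w) = scalarOp j z * scalarOp j w := by
  simp only [scalarOp, Complex.mul_re, Complex.mul_im, add_mul, mul_add, smul_mul_assoc,
    mul_smul_comm, one_mul, mul_one, hj, sub_smul, add_smul, smul_neg]
  module

theorem continuous_scalarOp (j : V →L[ℝ] V) : Continuous (scalarOp j) := by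
  unfold scalarOp; fun_prop

theorem norm_scalarOp_le (j : V →L[ℝ] V) (z : ℂ) : ‖scalarOp j z‖ ≤ (1 + ‖j‖) * ‖z‖ := by
  have h1 : ‖(1 : V →L[ℝ] V)‖ ≤ 1 := ContinuousLinearMap.norm_id_le
  calc ‖scalarOp j z‖ ≤ ‖z.re • (1 : V →L[ℝ] V)‖ + ‖z.im • j‖ := norm_add_le _ _
    _ = |z.re| * ‖(1 : V →L[ℝ] V)‖ + |z.im| * ‖j‖ := by
      rw [norm_smul, norm_smul, Real.norm_eq_abs, Real.norm_eq_abs]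
    _ ≤ ‖z‖ * 1 + ‖z‖ * ‖j‖ := by
      gcongr
      · exact Complex.abs_re_le_norm z
      · exact Complex.abs_im_le_norm z
    _ = (1 + ‖j‖) * ‖z‖ := by ring

/-- The left resolvent `P_z conj z - R_z`, where `P_z = Q_z[T]⁻¹` and `R_z = T Q_z[T]⁻¹`. -/
def leftResolvent (j : V →L[ℝ] V) (P R : ℂ → V →L[ℝ] V) (z : ℂ) : V →L[ℝ] V :=
  P z * scalarOp j (conj z) - R z

/-- `P z = Q_z[L]⁻¹` and `R z = L Q_z[L]⁻¹` outside the closed double sector of angle `ω`, with the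
estimates of a bisectorial operator. -/
structure IsBisectorialFamily (L : V →ₗ[ℝ] V) (D : Submodule ℝ V) (ω : ℝ) (j : V →L[ℝ] V)
    (P R : ℂ → V →L[ℝ] V) : Prop where
  angle_mem : ω ∈ Set.Ioo 0 (Real.pi / 2)
  unit_sq : j * j = -1
  inv : ∀ z ∈ cOuter ω, IsPolyInverse L D (quadPoly z) (P z)
  R_apply : ∀ z ∈ cOuter ω, ∀ v, R z v = L (P z v)
  P_conj : ∀ z, P (conj z) = P z
  R_conj : ∀ z, R (conj z) = R z
  bound : ∀ φ ∈ Set.Ioo ω (Real.pi / 2), ∃ C : ℝ, 0 ≤ C ∧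
    ∀ z : ℂ, z ≠ 0 → |z.re| ≤ Real.cos φ * ‖z‖ → ‖leftResolvent j P R z‖ ≤ C / ‖z‖

/-- The complex linear functional (for the structure `A ↦ A j`) with real part `ℓ`. -/
def complexify (j : V →L[ℝ] V) (ℓ : (V →L[ℝ] V) →L[ℝ] ℝ) : (V →L[ℝ] V) →L[ℝ] ℂ :=
  Complex.ofRealCLM.comp ℓ -
    I • Complex.ofRealCLM.comp (ℓ.comp ((ContinuousLinearMap.mul ℝ (V →L[ℝ] V)).flip j))

theorem complexify_apply (j : V →L[ℝ] V) (ℓ : (V →L[ℝ] V) →L[ℝ] ℝ) (A : V →L[ℝ] V) :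
    complexify j ℓ A = ℓ A - I * ℓ (A * j) := by
  simp [complexify]

theorem complexify_mul_scalarOp {j : V →L[ℝ] V} (hj : j * j = -1) (ℓ : (V →L[ℝ] V) →L[ℝ] ℝ)
    (A : V →L[ℝ] V) (z : ℂ) : complexify j ℓ (A * scalarOp j z) = complexify j ℓ A * z := by
  have h1 : ℓ (A * j * j) = -ℓ A := by rw [mul_assoc, hj]; simp
  rw [complexify_apply, complexify_apply, scalarOp, mul_add, add_mul]
  simp only [mul_smul_comm, smul_mul_assoc, mul_one, map_add, map_smul, h1, smul_eq_mul]
  conv_rhs => rw [← Complex.re_add_im z]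
  push_cast
  linear_combination (ℓ (A * j) * z.im : ℂ) * Complex.I_mul_I

/-- The real part of `complexify j ℓ` is ℓ, and real functionals separate points. Operator
identities thus become identities between complex-valued functions, to which Cauchy's theorem
applies. -/
theorem eq_of_complexify_eq {j : V →L[ℝ] V} {A B : V →L[ℝ] V}
    (h : ∀ ℓ : (V →L[ℝ] V) →L[ℝ] ℝ, complexify j ℓ A = complexify j ℓ B) : A = B := by
  refine (SeparatingDual.eq_iff_forall_dual_eq (R := ℝ)).mpr fun ℓ => ?_
  have := congrArg Complex.re (h ℓ)
  simpa [complexify_apply] using this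

/-! ### Resolvent equations and holomorphy of the left resolvent -/

namespace IsBisectorialFamily

variable {L : V →ₗ[ℝ] V} {D : Submodule ℝ V} {ω : ℝ} {j : V →L[ℝ] V} {P R : ℂ → V →L[ℝ] V}
variable {s c : ℂ}

theorem P_mem (h : IsBisectorialFamily L D ω j P R) (hs : s ∈ cOuter ω) (v : V) :
    P s v ∈ D ∧ L (P s v) ∈ D := by
  have := (h.inv s hs).mem v
  rw [natDegree_quadPoly] at this
  exact ⟨this 0 (by norm_num), by simpa using this 1 (by norm_num)⟩

theorem L_R (h : IsBisectorialFamily L D ω j P R) (hs : s ∈ cOuter ω) (v : V) :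
    L (R s v) = v + (2 * s.re) • R s v - ‖s‖ ^ 2 • P s v := by
  have := (h.inv s hs).right_inv v
  simp only [quadPoly, map_add, map_sub, map_mul, aeval_X_pow, aeval_X, aeval_C, LinearMap.add_apply,
    LinearMap.sub_apply, Module.End.mul_apply, pow_two (L : V →ₗ[ℝ] V),
    Module.algebraMap_end_apply, ← h.R_apply s hs] at this
  linear_combination (norm := module) this

theorem comm_PP (h : IsBisectorialFamily L D ω j P R) (hs : s ∈ cOuter ω) (hc : c ∈ cOuter ω) :
    P s * P c = P c * P s := (h.inv s hs).commute (h.inv c hc)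

theorem P_mul_R (h : IsBisectorialFamily L D ω j P R) (hs : s ∈ cOuter ω) (hc : c ∈ cOuter ω) :
    P s * R c = R s * P c := by
  refine ContinuousLinearMap.ext fun v => ?_
  change P s (R c v) = R s (P c v)
  rw [h.R_apply c hc, h.R_apply s hs, (h.inv s hs).map_comm (h.P_mem hc v).1]

theorem comm_PR (h : IsBisectorialFamily L D ω j P R) (hs : s ∈ cOuter ω) (hc : c ∈ cOuter ω) :
    P s * R c = R c * P s := by
  refine ContinuousLinearMap.ext fun v => ?_
  change P s (R c v) = R c (P s v)
  rw [h.R_apply c hc, h.R_apply c hc, (h.inv s hs).map_comm (h.P_mem hc v).1]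
  exact congrArg L (DFunLike.congr_fun (h.comm_PP hs hc) v)

/-- The left side is T² P_s P_c, and Q_s[T] P_s = 1 eliminates T² P_s. -/
theorem R_mul_R (h : IsBisectorialFamily L D ω j P R) (hs : s ∈ cOuter ω) (hc : c ∈ cOuter ω) :
    R s * R c = P c + (2 * s.re) • (P s * R c) - ‖s‖ ^ 2 • (P s * P c) := by
  refine ContinuousLinearMap.ext fun v => ?_
  change R s (R c v) = P c v + (2 * s.re) • P s (R c v) - ‖s‖ ^ 2 • P s (P c v)
  have h1 : R s (R c v) = L (P s (R c v)) := h.R_apply s hs _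
  have h2 : P s (R c v) = R s (P c v) := DFunLike.congr_fun (h.P_mul_R hs hc) v
  rw [h1, h2, h.L_R hs]

theorem comm_RR (h : IsBisectorialFamily L D ω j P R) (hs : s ∈ cOuter ω) (hc : c ∈ cOuter ω) :
    R s * R c = R c * R s := by
  refine ContinuousLinearMap.ext fun v => ?_
  change R s (R c v) = R c (R s v)
  have h1 : R s (R c v) = L (P s (R c v)) := h.R_apply s hs _
  have h2 : R c (R s v) = L (P c (R s v)) := h.R_apply c hc _
  rw [h1, h2]
  congr 1
  change (P s * R c) v = (P c * R s) v
  rw [h.P_mul_R hs hc, h.comm_PR hc hs]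

/-- Both sides are T³ P_s P_c, reduced once with Q_s[T] P_s = 1 and once with Q_c[T] P_c = 1. -/
theorem R_sub_R (h : IsBisectorialFamily L D ω j P R) (hs : s ∈ cOuter ω) (hc : c ∈ cOuter ω) :
    R c + (2 * s.re) • (R s * R c) - ‖s‖ ^ 2 • (P s * R c) =
      R s + (2 * c.re) • (R s * R c) - ‖c‖ ^ 2 • (P s * R c) := by
  have key : ∀ {a b : ℂ}, a ∈ cOuter ω → b ∈ cOuter ω → ∀ v,
      L (R a (R b v)) = R b v + (2 * a.re) • R a (R b v) - ‖a‖ ^ 2 • P a (R b v) :=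
    fun ha hb v => h.L_R ha _
  refine ContinuousLinearMap.ext fun v => ?_
  change R c v + (2 * s.re) • R s (R c v) - ‖s‖ ^ 2 • P s (R c v) =
    R s v + (2 * c.re) • R s (R c v) - ‖c‖ ^ 2 • P s (R c v)
  have e1 : R s (R c v) = R c (R s v) := DFunLike.congr_fun (h.comm_RR hs hc) v
  have e2 : P s (R c v) = P c (R s v) := by
    change (P s * R c) v = (P c * R s) v
    rw [h.P_mul_R hs hc, h.comm_PR hc hs]
  rw [← key hs hc]
  rw [e1, e2, ← key hc hs]

/-- The scalar form of the relations between two members of the family. -/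
theorem scalar_relations (h : IsBisectorialFamily L D ω j P R) (hs : s ∈ cOuter ω)
    (hc : c ∈ cOuter ω) (ψ : (V →L[ℝ] V) →L[ℝ] ℂ) :
    ψ (P c) = ψ (R s * R c) - (s + conj s) * ψ (P s * R c) + s * conj s * ψ (P s * P c) ∧
    ψ (P s) = ψ (R s * R c) - (c + conj c) * ψ (P s * R c) + c * conj c * ψ (P s * P c) ∧
    ψ (R c) + (s + conj s) * ψ (R s * R c) - s * conj s * ψ (P s * R c) =
      ψ (R s) + (c + conj c) * ψ (R s * R c) - c * conj c * ψ (P s * R c) := by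
  have h1 := congrArg ψ (h.R_mul_R hs hc)
  have h2 := congrArg ψ (h.R_mul_R hc hs)
  have h3 := congrArg ψ (h.R_sub_R hs hc)
  rw [h.comm_RR hc hs, h.P_mul_R hc hs, ← h.comm_PR hs hc, h.comm_PP hc hs] at h2
  simp only [map_add, map_sub, map_smul, Complex.real_smul] at h1 h2 h3
  rw [Complex.mul_conj', Complex.mul_conj', Complex.add_conj, Complex.add_conj]
  push_cast at h1 h2 h3 ⊢
  refine ⟨?_, ?_, ?_⟩
  · linear_combination -h1
  · linear_combination -h2
  · linear_combination h3

theorem complexify_leftResolvent (h : IsBisectorialFamily L D ω j P R)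
    (ℓ : (V →L[ℝ] V) →L[ℝ] ℝ) (B : V →L[ℝ] V) (s : ℂ) :
    complexify j ℓ (B * leftResolvent j P R s) =
      complexify j ℓ (B * P s) * conj s - complexify j ℓ (B * R s) := by
  rw [leftResolvent, mul_sub, map_sub, ← mul_assoc, complexify_mul_scalarOp h.unit_sq]

theorem complexify_leftResolvent' (h : IsBisectorialFamily L D ω j P R)
    (ℓ : (V →L[ℝ] V) →L[ℝ] ℝ) (s : ℂ) :
    complexify j ℓ (leftResolvent j P R s) =
      complexify j ℓ (P s) * conj s - complexify j ℓ (R s) := by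
  simpa using h.complexify_leftResolvent ℓ 1 s

/-- After division by (s - c)(s - conj c) this exhibits P_c S(s) as S(s) / Q_c(s) plus a fraction in
s that does not involve S and whose only poles are c and conj c. -/
theorem complexify_P_mul (h : IsBisectorialFamily L D ω j P R) (hs : s ∈ cOuter ω)
    (hc : c ∈ cOuter ω) (ℓ : (V →L[ℝ] V) →L[ℝ] ℝ) :
    complexify j ℓ (P c * leftResolvent j P R s) * ((s - c) * (s - conj c)) =
      complexify j ℓ (leftResolvent j P R s) + complexify j ℓ (P c) * (s - (c + conj c)) +
        complexify j ℓ (R c) := by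
  rw [h.complexify_leftResolvent, h.complexify_leftResolvent', ← h.comm_PP hs hc,
    h.P_mul_R hc hs, ← h.comm_PR hs hc]
  obtain ⟨h1, h2, h3⟩ := h.scalar_relations hs hc (complexify j ℓ)
  linear_combination (-(s - (c + conj c))) * h1 - conj s * h2 - h3

theorem complexify_R_mul (h : IsBisectorialFamily L D ω j P R) (hs : s ∈ cOuter ω)
    (hc : c ∈ cOuter ω) (ℓ : (V →L[ℝ] V) →L[ℝ] ℝ) :
    complexify j ℓ (R c * leftResolvent j P R s) * ((s - c) * (s - conj c)) =
      complexify j ℓ (leftResolvent j P R s) * s + complexify j ℓ (R c) * s -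
        c * conj c * complexify j ℓ (P c) := by
  rw [h.complexify_leftResolvent, h.complexify_leftResolvent', ← h.comm_PR hs hc,
    ← h.comm_RR hs hc]
  obtain ⟨h1, h2, h3⟩ := h.scalar_relations hs hc (complexify j ℓ)
  linear_combination (c * conj c) * h1 - s * conj s * h2 - s * h3

/-- The conjugate variable in S(s) does not spoil holomorphy: the increment is divisible by c - s,
and the cofactor is continuous in s although it contains conj s. Its value at s = c gives the
complex derivative. -/
theorem complexify_sub (h : IsBisectorialFamily L D ω j P R) (hs : s ∈ cOuter ω)
    (hc : c ∈ cOuter ω) (ℓ : (V →L[ℝ] V) →L[ℝ] ℝ) (B : V →L[ℝ] V) :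
    complexify j ℓ (B * leftResolvent j P R s) - complexify j ℓ (B * leftResolvent j P R c) =
      (c - s) * (conj s * conj c * complexify j ℓ (B * (P s * P c)) -
        (conj s + conj c) * complexify j ℓ (B * (P s * R c)) +
        complexify j ℓ (B * (R s * R c))) := by
  rw [h.complexify_leftResolvent, h.complexify_leftResolvent]
  obtain ⟨h1, h2, h3⟩ := h.scalar_relations hs hc
    ((complexify j ℓ).comp (ContinuousLinearMap.mul ℝ (V →L[ℝ] V) B))
  simp only [ContinuousLinearMap.comp_apply, ContinuousLinearMap.mul_apply'] at h1 h2 h3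
  linear_combination conj s * h2 - conj c * h1 + h3

/-- The right side is O(1/|s|) by the bisectorial bound, which identifies the limit of s R_I S(s) at
infinity as R_I. -/
theorem complexify_R_I_mul_s (h : IsBisectorialFamily L D ω j P R) (hs : s ∈ cOuter ω)
    (ℓ : (V →L[ℝ] V) →L[ℝ] ℝ) :
    complexify j ℓ (R I * leftResolvent j P R s) * s - complexify j ℓ (R I) =
      complexify j ℓ (leftResolvent j P R s) - complexify j ℓ (P I * leftResolvent j P R s) := by
  have hc := I_mem_cOuter h.angle_mem
  rw [h.complexify_leftResolvent, h.complexify_leftResolvent', h.complexify_leftResolvent,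
    ← h.comm_PR hs hc, ← h.comm_RR hs hc, ← h.comm_PP hs hc, h.P_mul_R hc hs, ← h.comm_PR hs hc]
  obtain ⟨h1, h2, h3⟩ := h.scalar_relations hs hc (complexify j ℓ)
  simp only [Complex.conj_I, add_neg_cancel, mul_neg, Complex.I_mul_I, neg_neg] at h1 h2 h3
  linear_combination -conj s * h2 - h3

/-- The right side stays bounded because S(s) is O(1/|s|), so s R_I S(s) is O(|s|) near zero. -/
theorem complexify_R_I_mul (h : IsBisectorialFamily L D ω j P R) (hs : s ∈ cOuter ω)
    (ℓ : (V →L[ℝ] V) →L[ℝ] ℝ) :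
    complexify j ℓ (R I * leftResolvent j P R s) =
      complexify j ℓ (P I * leftResolvent j P R s) * s - complexify j ℓ (P I) := by
  have hc := I_mem_cOuter h.angle_mem
  rw [h.complexify_leftResolvent, h.complexify_leftResolvent,
    ← h.comm_PR hs hc, ← h.comm_RR hs hc, ← h.comm_PP hs hc, h.P_mul_R hc hs, ← h.comm_PR hs hc]
  obtain ⟨h1, h2, h3⟩ := h.scalar_relations hs hc (complexify j ℓ)
  linear_combination h1

variable [CompleteSpace V]

/-- The operator `K s` is Q_s[T] P_c. It depends continuously on s and equals 1 at c, so it is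
invertible nearby, and P_s = P_c K(s)⁻¹, R_s = R_c K(s)⁻¹. -/
theorem continuousAt_P_R (h : IsBisectorialFamily L D ω j P R) (hc : c ∈ cOuter ω) :
    ContinuousAt P c ∧ ContinuousAt R c := by
  let K : ℂ → V →L[ℝ] V := fun s =>
    1 + (‖s‖ ^ 2 - ‖c‖ ^ 2) • P c - (2 * (s.re - c.re)) • R c
  have hK : ContinuousAt K c := by
    have : Continuous K := by
      have := Complex.continuous_re
      fun_prop
    exact this.continuousAt
  have hKc : K c = 1 := by simp [K]
  have hP : ∀ s ∈ cOuter ω, P s * K s = P c := by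
    intro s hs
    have h1 := h.R_mul_R hs hc
    have h2 := h.R_mul_R hc hs
    rw [h.comm_RR hc hs, h.P_mul_R hc hs, ← h.comm_PR hs hc, h.comm_PP hc hs] at h2
    simp only [K, mul_add, mul_sub, mul_one, mul_smul_comm]
    linear_combination (norm := module) h1 - h2
  have hR : ∀ s ∈ cOuter ω, R s * K s = R c := by
    intro s hs
    have h1 := h.R_sub_R hs hc
    simp only [K, mul_add, mul_sub, mul_one, mul_smul_comm, ← h.P_mul_R hs hc]
    linear_combination (norm := module) -h1
  have hinv : ContinuousAt (fun s => Ring.inverse (K s)) c := by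
    have h1 : ContinuousAt Ring.inverse (K c) := by
      rw [hKc]
      exact NormedRing.inverse_continuousAt (1 : (V →L[ℝ] V)ˣ)
    exact ContinuousAt.comp h1 hK
  have hunit : ∀ᶠ s in nhds c, IsUnit (K s) := by
    refine hK.eventually (Units.isOpen.mem_nhds ?_)
    rw [hKc]
    exact isUnit_one
  have hout := (isOpen_cOuter ω).mem_nhds hc
  constructor
  · refine (ContinuousAt.congr (f := fun s => P c * Ring.inverse (K s))
      (continuousAt_const.mul hinv) ?_)
    filter_upwards [hunit, hout] with s h1 h2
    rw [← hP s h2, mul_assoc, Ring.mul_inverse_cancel _ h1, mul_one]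
  · refine (ContinuousAt.congr (f := fun s => R c * Ring.inverse (K s))
      (continuousAt_const.mul hinv) ?_)
    filter_upwards [hunit, hout] with s h1 h2
    rw [← hR s h2, mul_assoc, Ring.mul_inverse_cancel _ h1, mul_one]

theorem continuousAt_leftResolvent (h : IsBisectorialFamily L D ω j P R) (hc : c ∈ cOuter ω) :
    ContinuousAt (leftResolvent j P R) c :=
  ((h.continuousAt_P_R hc).1.mul ((continuous_scalarOp j).comp
    Complex.continuous_conj).continuousAt).sub (h.continuousAt_P_R hc).2

theorem differentiableAt_complexify (h : IsBisectorialFamily L D ω j P R) (hc : c ∈ cOuter ω)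
    (ℓ : (V →L[ℝ] V) →L[ℝ] ℝ) (B : V →L[ℝ] V) :
    DifferentiableAt ℂ (fun s => complexify j ℓ (B * leftResolvent j P R s)) c := by
  let M : ℂ → ℂ := fun s => -(conj s * conj c * complexify j ℓ (B * (P s * P c)) -
        (conj s + conj c) * complexify j ℓ (B * (P s * R c)) +
        complexify j ℓ (B * (R s * R c)))
  have hP := (h.continuousAt_P_R hc).1
  have hR := (h.continuousAt_P_R hc).2
  have hM : ContinuousAt M c := by
    have hcl : ∀ {A : ℂ → V →L[ℝ] V}, ContinuousAt A c →
        ContinuousAt (fun s => complexify j ℓ (A s)) c :=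
      fun hA => (complexify j ℓ).continuous.continuousAt.comp hA
    have hconj : ContinuousAt (fun s : ℂ => conj s) c := Complex.continuous_conj.continuousAt
    exact ((((hconj.mul continuousAt_const).mul
      (hcl (continuousAt_const.mul (hP.mul continuousAt_const)))).sub
      ((hconj.add continuousAt_const).mul
        (hcl (continuousAt_const.mul (hP.mul continuousAt_const))))).add
      (hcl (continuousAt_const.mul (hR.mul continuousAt_const)))).neg
  refine HasDerivAt.differentiableAt (f' := M c) ?_
  rw [hasDerivAt_iff_tendsto_slope]
  refine (hM.tendsto.mono_left nhdsWithin_le_nhds).congr' ?_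
  filter_upwards [self_mem_nhdsWithin, nhdsWithin_le_nhds ((isOpen_cOuter ω).mem_nhds hc)]
    with s hs hs'
  have hne : s - c ≠ 0 := sub_ne_zero.mpr hs
  rw [slope_def_field, h.complexify_sub hs' hc]
  simp only [M]
  field_simp
  ring

end IsBisectorialFamily

end

end HInfty
end

noncomputable section
namespace HInfty

open Polynomial
open Complex (I)
open Filter Topology MeasureTheory
open scoped ComplexConjugate

/-! ### Decaying functions on double sectors -/

/-- Bounded holomorphic functions on a double sector that are real on the real axis and integrable
with respect to `dt / t` along all rays. -/
structure IsDecaying (θ : ℝ) (u : ℂ → ℂ) : Prop where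
  diff : ∀ z ∈ cDoubleSector θ, DifferentiableAt ℂ u z
  map_conj : ∀ z ∈ cDoubleSector θ, u (conj z) = conj (u z)
  bdd : ∃ C : ℝ, ∀ z ∈ cDoubleSector θ, ‖u z‖ ≤ C
  integrable : ∀ α ∈ angleSet θ,
    IntegrableOn (fun t : ℝ => ‖u (t * Complex.exp (α * I))‖ / t) (Set.Ioi 0)

theorem conj_mem_cDoubleSector {θ : ℝ} {z : ℂ} (hz : z ∈ cDoubleSector θ) :
    conj z ∈ cDoubleSector θ := by
  simpa [cDoubleSector] using hz

theorem ne_zero_of_mem_cDoubleSector {θ : ℝ} {z : ℂ} (hz : z ∈ cDoubleSector θ) : z ≠ 0 := by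
  rintro rfl
  simp [cDoubleSector] at hz

section Sector

variable {θ : ℝ}

theorem exp_mem_cDoubleSector (hθ : θ ∈ Set.Ioo 0 (Real.pi / 2)) {w : ℂ} (hw : w.im ∈ angleSet θ) :
    Complex.exp w ∈ cDoubleSector θ := by
  have h := cos_lt_abs_cos_of_mem_angleSet hθ hw
  change Real.cos θ * ‖_‖ < |_|
  rw [Complex.norm_exp, Complex.exp_re, abs_mul, abs_of_pos (Real.exp_pos _), mul_comm]
  exact mul_lt_mul_of_pos_left h (Real.exp_pos _)

theorem mul_exp_mem_cDoubleSector (hθ : θ ∈ Set.Ioo 0 (Real.pi / 2)) {α : ℝ}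
    (hα : α ∈ angleSet θ) {t : ℝ} (ht : 0 < t) :
    (t : ℂ) * Complex.exp (α * I) ∈ cDoubleSector θ := by
  have := exp_mem_cDoubleSector hθ (w := (Real.log t : ℝ) + α * I) (by simpa using hα)
  rwa [Complex.exp_add, ← Complex.ofReal_exp, Real.exp_log ht] at this

theorem exp_line (x α : ℝ) : Complex.exp (x + α * I) = (Real.exp x : ℝ) * Complex.exp (α * I) := by
  rw [Complex.exp_add, Complex.ofReal_exp]

theorem continuousOn_ray (hθ : θ ∈ Set.Ioo 0 (Real.pi / 2)) {u : ℂ → ℂ}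
    (hu : ∀ z ∈ cDoubleSector θ, DifferentiableAt ℂ u z) {α : ℝ} (hα : α ∈ angleSet θ) :
    ContinuousOn (fun t : ℝ => u (t * Complex.exp (α * I))) (Set.Ioi 0) := by
  intro t ht
  have h := (hu _ (mul_exp_mem_cDoubleSector hθ hα ht)).continuousAt
  exact (ContinuousAt.comp (f := fun t : ℝ => (t : ℂ) * Complex.exp (α * I)) h
    (by fun_prop : Continuous fun t : ℝ => (t : ℂ) * Complex.exp (α * I)).continuousAt).continuousWithinAt

theorem aestronglyMeasurable_ray_div (hθ : θ ∈ Set.Ioo 0 (Real.pi / 2)) {u : ℂ → ℂ}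
    (hu : ∀ z ∈ cDoubleSector θ, DifferentiableAt ℂ u z) {α : ℝ} (hα : α ∈ angleSet θ) :
    AEStronglyMeasurable (fun t : ℝ => ‖u (t * Complex.exp (α * I))‖ / t)
      (volume.restrict (Set.Ioi 0)) :=
  (((continuousOn_ray hθ hu hα).norm.div continuousOn_id fun _ ht => (ne_of_gt ht))).aestronglyMeasurable
    measurableSet_Ioi

namespace IsDecaying

variable {u v : ℂ → ℂ}

theorem of_norm_le (hθ : θ ∈ Set.Ioo 0 (Real.pi / 2)) (hv : IsDecaying θ v)
    (hd : ∀ z ∈ cDoubleSector θ, DifferentiableAt ℂ u z)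
    (hc : ∀ z ∈ cDoubleSector θ, u (conj z) = conj (u z)) {K : ℝ}
    (hK : ∀ z ∈ cDoubleSector θ, ‖u z‖ ≤ K * ‖v z‖) : IsDecaying θ u := by
  have hK' : ∀ z ∈ cDoubleSector θ, ‖u z‖ ≤ |K| * ‖v z‖ := fun z hz =>
    (hK z hz).trans (mul_le_mul_of_nonneg_right (le_abs_self K) (norm_nonneg _))
  refine ⟨hd, hc, ?_, fun α hα => ?_⟩
  · obtain ⟨C, hC⟩ := hv.bdd
    exact ⟨|K| * C, fun z hz => (hK' z hz).trans (mul_le_mul_of_nonneg_left (hC z hz) (abs_nonneg _))⟩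
  · refine Integrable.mono' ((hv.integrable α hα).const_mul |K|)
      (aestronglyMeasurable_ray_div hθ hd hα) ?_
    filter_upwards [ae_restrict_mem measurableSet_Ioi] with t ht
    have ht : 0 < t := ht
    rw [Real.norm_of_nonneg (by positivity), ← mul_div_assoc]
    exact div_le_div_of_nonneg_right (hK' _ (mul_exp_mem_cDoubleSector hθ hα ht)) ht.le

theorem of_bounds (hθ : θ ∈ Set.Ioo 0 (Real.pi / 2))
    (hd : ∀ z ∈ cDoubleSector θ, DifferentiableAt ℂ u z)
    (hc : ∀ z ∈ cDoubleSector θ, u (conj z) = conj (u z)) {K : ℝ}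
    (h0 : ∀ z ∈ cDoubleSector θ, ‖u z‖ ≤ K * ‖z‖)
    (h1 : ∀ z ∈ cDoubleSector θ, ‖u z‖ * ‖z‖ ≤ K) : IsDecaying θ u := by
  refine ⟨hd, hc, ⟨max K 0, fun z hz => ?_⟩, fun α hα => ?_⟩
  · have hz0 : 0 < ‖z‖ := norm_pos_iff.mpr (ne_zero_of_mem_cDoubleSector hz)
    have hK : K ≤ max K 0 := le_max_left _ _
    have hK0 : 0 ≤ max K 0 := le_max_right _ _
    rcases le_total ‖z‖ 1 with h | h
    · exact (h0 z hz).trans (by nlinarith)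
    · nlinarith [h1 z hz, norm_nonneg (u z)]
  -- Along a ray |u| / t is at most both K and K / t², hence at most 2 K / (1 + t²).
  · refine Integrable.mono' ((integrable_inv_one_add_sq.const_mul (2 * K)).integrableOn)
      (aestronglyMeasurable_ray_div hθ hd hα) ?_
    filter_upwards [ae_restrict_mem measurableSet_Ioi] with t ht
    have ht : 0 < t := ht
    have hm := mul_exp_mem_cDoubleSector hθ hα ht
    have e0 := h0 _ hm
    have e1 := h1 _ hm
    rw [norm_mul _ (Complex.exp _), Complex.norm_exp_ofReal_mul_I, mul_one, Complex.norm_real,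
      Real.norm_of_nonneg ht.le] at e0 e1
    rw [Real.norm_of_nonneg (by positivity), div_le_iff₀ ht, ← div_eq_mul_inv, div_mul_eq_mul_div,
      le_div_iff₀ (by positivity)]
    nlinarith

theorem mul_bdd (hθ : θ ∈ Set.Ioo 0 (Real.pi / 2)) (hu : IsDecaying θ u) {m : ℂ → ℂ}
    (hd : ∀ z ∈ cDoubleSector θ, DifferentiableAt ℂ m z)
    (hc : ∀ z ∈ cDoubleSector θ, m (conj z) = conj (m z)) {K : ℝ}
    (hK : ∀ z ∈ cDoubleSector θ, ‖m z‖ ≤ K) : IsDecaying θ fun z => m z * u z :=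
  of_norm_le hθ hu (fun z hz => (hd z hz).mul (hu.diff z hz))
    (fun z hz => by rw [hc z hz, hu.map_conj z hz, map_mul])
    (fun z hz => by
      rw [norm_mul]; exact mul_le_mul_of_nonneg_right (hK z hz) (norm_nonneg _))

theorem add (hθ : θ ∈ Set.Ioo 0 (Real.pi / 2)) (hu : IsDecaying θ u) (hv : IsDecaying θ v) :
    IsDecaying θ fun z => u z + v z := by
  have hd : ∀ z ∈ cDoubleSector θ, DifferentiableAt ℂ (fun z => u z + v z) z :=
    fun z hz => (hu.diff z hz).add (hv.diff z hz)
  refine ⟨hd, fun z hz => by rw [hu.map_conj z hz, hv.map_conj z hz, map_add], ?_, fun α hα => ?_⟩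
  · obtain ⟨C, hC⟩ := hu.bdd
    obtain ⟨C', hC'⟩ := hv.bdd
    exact ⟨C + C', fun z hz => (norm_add_le _ _).trans (add_le_add (hC z hz) (hC' z hz))⟩
  · refine Integrable.mono' ((hu.integrable α hα).add (hv.integrable α hα))
      (aestronglyMeasurable_ray_div hθ hd hα) ?_
    filter_upwards [ae_restrict_mem measurableSet_Ioi] with t ht
    have ht : 0 < t := ht
    rw [Real.norm_of_nonneg (by positivity), Pi.add_apply, ← add_div]
    exact div_le_div_of_nonneg_right (norm_add_le _ _) ht.le

theorem const_mul (hθ : θ ∈ Set.Ioo 0 (Real.pi / 2)) (hu : IsDecaying θ u) (r : ℝ) :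
    IsDecaying θ fun z => r * u z :=
  hu.mul_bdd hθ (m := fun _ => (r : ℂ)) (fun _ _ => differentiableAt_const _)
    (fun _ _ => (Complex.conj_ofReal r).symm) (fun _ _ => le_rfl)

theorem congr (hu : IsDecaying θ u) (h : ∀ z ∈ cDoubleSector θ, v z = u z)
    (hθ : θ ∈ Set.Ioo 0 (Real.pi / 2)) : IsDecaying θ v := by
  refine of_norm_le (K := 1) hθ hu (fun z hz => ?_) (fun z hz => ?_) (fun z hz => ?_)
  · refine (hu.diff z hz).congr_of_eventuallyEq ?_
    filter_upwards [(isOpen_cDoubleSector θ).mem_nhds hz] with w hw using h w hw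
  · rw [h z hz, h _ (conj_mem_cDoubleSector hz), hu.map_conj z hz]
  · rw [h z hz, one_mul]

theorem integrable_line (hθ : θ ∈ Set.Ioo 0 (Real.pi / 2)) (hu : IsDecaying θ u) {α : ℝ}
    (hα : α ∈ angleSet θ) : Integrable fun x : ℝ => u (Complex.exp (x + α * I)) := by
  have h := (integrableOn_Ioi_zero_iff_exp _).mp (hu.integrable α hα)
  have hc : Continuous fun x : ℝ => u (Complex.exp (x + α * I)) := by
    rw [continuous_iff_continuousAt]
    intro x
    have h1 := (hu.diff _ (exp_mem_cDoubleSector hθ (w := x + α * I) (by simpa using hα))).continuousAt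
    exact ContinuousAt.comp (f := fun x : ℝ => Complex.exp (x + α * I)) h1
      (by fun_prop : Continuous fun x : ℝ => Complex.exp (x + α * I)).continuousAt
  refine Integrable.mono' h hc.aestronglyMeasurable (Eventually.of_forall fun x => ?_)
  rw [exp_line, smul_eq_mul, mul_div_cancel₀ _ (Real.exp_pos x).ne']

end IsDecaying

/-! ### Elementary multipliers -/

/-- The function `(a + b z) / ((z - c) (z - conj c))`. -/
def simpleFrac (c a b z : ℂ) : ℂ := (a + b * z) / ((z - c) * (z - conj c))

theorem exists_lower_bound {c : ℂ} (hc : c ∈ cOuter θ) :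
    ∃ δ : ℝ, 0 < δ ∧ ∀ z ∈ cDoubleSector θ, δ ≤ ‖z - c‖ ∧ δ * ‖z‖ ≤ ‖z - c‖ := by
  set g : ℝ := Real.cos θ * ‖c‖ - |c.re| with hg
  have hg0 : 0 < g := sub_pos.mpr hc
  have hk1 : Real.cos θ ≤ 1 := Real.cos_le_one θ
  have hk0 : 0 ≤ Real.cos θ := by
    by_contra h
    have h1 : |c.re| < Real.cos θ * ‖c‖ := hc
    nlinarith [abs_nonneg c.re, norm_nonneg c]
  -- Comparing the two sector inequalities gives g ≤ 2 |z - c|. Inserting this into |z| ≤ |c| + |z -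
  -- c| gives g |z| ≤ (2 |c| + g) |z - c|.
  refine ⟨min (g / 2) (g / (2 * ‖c‖ + g)), by positivity, fun z hz => ?_⟩
  have hz' : Real.cos θ * ‖z‖ < |z.re| := hz
  have h1 : |z.re| ≤ |c.re| + ‖z - c‖ := by
    have := Complex.abs_re_le_norm (z - c)
    rw [Complex.sub_re] at this
    have := abs_sub_abs_le_abs_sub z.re c.re
    linarith
  have h2 : ‖c‖ ≤ ‖z‖ + ‖z - c‖ := by
    have := norm_sub_norm_le c z
    rw [norm_sub_rev] at this
    linarith
  have h3 : ‖z‖ ≤ ‖c‖ + ‖z - c‖ := by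
    have := norm_sub_norm_le z c
    linarith
  have h4 : g / 2 ≤ ‖z - c‖ := by nlinarith [norm_nonneg (z - c)]
  refine ⟨(min_le_left _ _).trans h4, ?_⟩
  refine (mul_le_mul_of_nonneg_right (min_le_right _ _) (norm_nonneg _)).trans ?_
  rw [div_mul_eq_mul_div, div_le_iff₀ (by positivity)]
  nlinarith [norm_nonneg c]

theorem sub_ne_zero_of_mem {c z : ℂ} (hc : c ∈ cOuter θ) (hz : z ∈ cDoubleSector θ) :
    z - c ≠ 0 := by
  intro h
  rw [sub_eq_zero.mp h] at hz
  exact lt_asymm (show |c.re| < _ from hc) hz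

theorem exists_simpleFrac_bound {c : ℂ} (hc : c ∈ cOuter θ) (a b : ℂ) :
    ∃ K : ℝ, ∀ z ∈ cDoubleSector θ, ‖simpleFrac c a b z‖ ≤ K ∧ ‖simpleFrac c a b z‖ * ‖z‖ ≤ K := by
  obtain ⟨δ, hδ, h1⟩ := exists_lower_bound hc
  obtain ⟨δ', hδ', h2⟩ := exists_lower_bound (conj_mem_cOuter hc)
  refine ⟨(‖a‖ + ‖b‖) / (δ * δ'), fun z hz => ?_⟩
  obtain ⟨p1, p2⟩ := h1 z hz
  obtain ⟨q1, q2⟩ := h2 z hz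
  have hp : 0 < ‖z - c‖ := hδ.trans_le p1
  have hq : 0 < ‖z - conj c‖ := hδ'.trans_le q1
  have hz0 := norm_nonneg z
  have n0 : ‖a + b * z‖ ≤ ‖a‖ + ‖b‖ * ‖z‖ := (norm_add_le _ _).trans (by rw [norm_mul])
  have e0 : δ * δ' ≤ ‖z - c‖ * ‖z - conj c‖ := mul_le_mul p1 q1 hδ'.le hp.le
  have e1 : δ * δ' * ‖z‖ ≤ ‖z - c‖ * ‖z - conj c‖ := by
    calc δ * δ' * ‖z‖ = δ * (δ' * ‖z‖) := by ring
      _ ≤ _ := mul_le_mul p1 q2 (by positivity) hp.le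
  have e2 : δ * δ' * ‖z‖ * ‖z‖ ≤ ‖z - c‖ * ‖z - conj c‖ := by
    calc δ * δ' * ‖z‖ * ‖z‖ = (δ * ‖z‖) * (δ' * ‖z‖) := by ring
      _ ≤ _ := mul_le_mul p2 q2 (by positivity) hp.le
  have hdd : 0 < δ * δ' := by positivity
  have ha := norm_nonneg a
  have hb := norm_nonneg b
  constructor
  · rw [simpleFrac, norm_div, norm_mul, div_le_div_iff₀ (by positivity) hdd]
    calc ‖a + b * z‖ * (δ * δ') ≤ (‖a‖ + ‖b‖ * ‖z‖) * (δ * δ') := by gcongr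
      _ = ‖a‖ * (δ * δ') + ‖b‖ * (δ * δ' * ‖z‖) := by ring
      _ ≤ ‖a‖ * (‖z - c‖ * ‖z - conj c‖) + ‖b‖ * (‖z - c‖ * ‖z - conj c‖) := by gcongr
      _ = _ := by ring
  · rw [simpleFrac, norm_div, norm_mul, div_mul_eq_mul_div, div_le_div_iff₀ (by positivity) hdd]
    calc ‖a + b * z‖ * ‖z‖ * (δ * δ') ≤ (‖a‖ + ‖b‖ * ‖z‖) * ‖z‖ * (δ * δ') := by gcongr
      _ = ‖a‖ * (δ * δ' * ‖z‖) + ‖b‖ * (δ * δ' * ‖z‖ * ‖z‖) := by ring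
      _ ≤ ‖a‖ * (‖z - c‖ * ‖z - conj c‖) + ‖b‖ * (‖z - c‖ * ‖z - conj c‖) := by gcongr
      _ = _ := by ring

theorem differentiableAt_simpleFrac {c z : ℂ} (hc : c ∈ cOuter θ) (hz : z ∈ cDoubleSector θ)
    (a b : ℂ) : DifferentiableAt ℂ (simpleFrac c a b) z := by
  unfold simpleFrac
  refine DifferentiableAt.div (by fun_prop) (by fun_prop) ?_
  exact mul_ne_zero (sub_ne_zero_of_mem hc hz) (sub_ne_zero_of_mem (conj_mem_cOuter hc) hz)

theorem simpleFrac_conj (c : ℂ) (a b : ℝ) (z : ℂ) :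
    simpleFrac c a b (conj z) = conj (simpleFrac c a b z) := by
  simp only [simpleFrac, map_div₀, map_add, map_mul, map_sub, Complex.conj_ofReal,
    Complex.conj_conj]
  rw [mul_comm (conj z - c)]

theorem sub_I_mul (z : ℂ) : (z - I) * (z - conj I) = 1 + z ^ 2 := by
  rw [Complex.conj_I]; linear_combination -Complex.I_mul_I

theorem IsDecaying.simpleFrac_mul {u : ℂ → ℂ} (hθ : θ ∈ Set.Ioo 0 (Real.pi / 2))
    (hu : IsDecaying θ u) {c : ℂ} (hc : c ∈ cOuter θ) (a b : ℝ) :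
    IsDecaying θ fun z => simpleFrac c a b z * u z := by
  obtain ⟨K, hK⟩ := exists_simpleFrac_bound hc a b
  exact hu.mul_bdd hθ (fun z hz => differentiableAt_simpleFrac hc hz a b)
    (fun z _ => simpleFrac_conj c a b z) (fun z hz => (hK z hz).1)

theorem isDecaying_simpleFrac_I (hθ : θ ∈ Set.Ioo 0 (Real.pi / 2)) :
    IsDecaying θ (simpleFrac I 0 1) := by
  have hI := I_mem_cOuter hθ
  obtain ⟨K, hK⟩ := exists_simpleFrac_bound hI 0 1
  obtain ⟨K', hK'⟩ := exists_simpleFrac_bound hI 1 0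
  refine IsDecaying.of_bounds (K := max K K') hθ (fun z hz => differentiableAt_simpleFrac hI hz 0 1)
    (fun z _ => by simpa using simpleFrac_conj I 0 1 z) (fun z hz => ?_) (fun z hz => ?_)
  · have : simpleFrac I 0 1 z = simpleFrac I 1 0 z * z := by
      rw [simpleFrac, simpleFrac, div_mul_eq_mul_div]; congr 1; ring
    rw [this, norm_mul]
    exact mul_le_mul_of_nonneg_right ((hK' z hz).1.trans (le_max_right _ _)) (norm_nonneg _)
  · exact (hK z hz).2.trans (le_max_left _ _)

end Sector

end HInfty
end

noncomputable section
namespace HInfty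

open Polynomial
open Complex (I)
open Filter Topology MeasureTheory
open scoped ComplexConjugate

/-! ### The contour integral -/

section

variable {V : Type*} [NormedAddCommGroup V] [NormedSpace ℝ V]

/-- The integrand of the contour integral along the ray with angle `α`. -/
def rayIntegrand (j : V →L[ℝ] V) (P R : ℂ → V →L[ℝ] V) (u : ℂ → ℂ) (α t : ℝ) : V →L[ℝ] V :=
  leftResolvent j P R (t * Complex.exp (α * I)) *
    scalarOp j (Complex.exp (α * I) * -I * u (t * Complex.exp (α * I)))

/-- The contour integral of `u` over the boundary of the double sector of angle `φ`. -/
def contourCalculus (j : V →L[ℝ] V) (P R : ℂ → V →L[ℝ] V) (φ : ℝ) (u : ℂ → ℂ) : V →L[ℝ] V :=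
  (2 * Real.pi)⁻¹ • ((∫ t in Set.Ioi (0 : ℝ), rayIntegrand j P R u (-φ) t) -
    (∫ t in Set.Ioi (0 : ℝ), rayIntegrand j P R u φ t) +
    (∫ t in Set.Ioi (0 : ℝ), rayIntegrand j P R u (Real.pi - φ) t) -
    (∫ t in Set.Ioi (0 : ℝ), rayIntegrand j P R u (Real.pi + φ) t))

/-- The scalar form of the integrand in logarithmic coordinates. -/
def logIntegrand (j : V →L[ℝ] V) (P R : ℂ → V →L[ℝ] V) (ℓ : (V →L[ℝ] V) →L[ℝ] ℝ)
    (B : V →L[ℝ] V) (u : ℂ → ℂ) (w : ℂ) : ℂ :=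
  complexify j ℓ (B * leftResolvent j P R (Complex.exp w)) * Complex.exp w * u (Complex.exp w)

/-- The angles of the four rays of the contour. -/
def contourAngles (φ : ℝ) : Set ℝ := {-φ, φ, Real.pi - φ, Real.pi + φ}

theorem abs_cos_of_mem_contourAngles {φ α : ℝ} (hα : α ∈ contourAngles φ) :
    |Real.cos α| = |Real.cos φ| := by
  rcases hα with rfl | rfl | rfl | rfl
  · rw [Real.cos_neg]
  · rfl
  · rw [Real.cos_pi_sub, abs_neg]
  · rw [add_comm, Real.cos_add_pi, abs_neg]

theorem mem_angleSet_of_mem_contourAngles {φ θ α : ℝ} (h0 : 0 < φ) (hφ : φ < θ)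
    (hα : α ∈ contourAngles φ) : α ∈ angleSet θ := by
  rcases hα with rfl | rfl | rfl | rfl
  · exact Or.inl ⟨by linarith, by linarith⟩
  · exact Or.inl ⟨by linarith, by linarith⟩
  · exact Or.inr ⟨by linarith, by linarith⟩
  · exact Or.inr ⟨by linarith, by linarith⟩

namespace IsBisectorialFamily

variable {L : V →ₗ[ℝ] V} {D : Submodule ℝ V} {ω θ φ : ℝ} {j : V →L[ℝ] V} {P R : ℂ → V →L[ℝ] V}
variable {u v : ℂ → ℂ} {c : ℂ}

theorem cos_lt_cos (h : IsBisectorialFamily L D ω j P R) (hφ : φ ∈ Set.Ioo ω (Real.pi / 2)) :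
    Real.cos φ < Real.cos ω :=
  Real.cos_lt_cos_of_nonneg_of_le_pi h.angle_mem.1.le (by linarith [hφ.2, Real.pi_pos]) hφ.1

theorem cos_pos (h : IsBisectorialFamily L D ω j P R) (hφ : φ ∈ Set.Ioo ω (Real.pi / 2)) :
    0 < Real.cos φ :=
  Real.cos_pos_of_mem_Ioo ⟨by linarith [h.angle_mem.1, hφ.1, Real.pi_pos], hφ.2⟩

theorem cOuter_subset (h : IsBisectorialFamily L D ω j P R) (hφ : φ ∈ Set.Ioo ω (Real.pi / 2)) :
    cOuter φ ⊆ cOuter ω := fun z hz =>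
  (show |z.re| < _ from hz).trans_le
    (mul_le_mul_of_nonneg_right (h.cos_lt_cos hφ).le (norm_nonneg z))

theorem exp_le (w : ℂ) (hw : |Real.cos w.im| ≤ Real.cos φ) :
    |(Complex.exp w).re| ≤ Real.cos φ * ‖Complex.exp w‖ := by
  rw [Complex.norm_exp, Complex.exp_re, abs_mul, abs_of_pos (Real.exp_pos _), mul_comm]
  exact mul_le_mul_of_nonneg_right hw (Real.exp_pos _).le

theorem mem_cOuter_of_le (h : IsBisectorialFamily L D ω j P R)
    (hφ : φ ∈ Set.Ioo ω (Real.pi / 2)) {z : ℂ} (hz0 : z ≠ 0) (hz : |z.re| ≤ Real.cos φ * ‖z‖) :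
    z ∈ cOuter ω :=
  hz.trans_lt (mul_lt_mul_of_pos_right (h.cos_lt_cos hφ) (norm_pos_iff.mpr hz0))

theorem ray_le (h : IsBisectorialFamily L D ω j P R) (hφ : φ ∈ Set.Ioo ω (Real.pi / 2)) {α : ℝ}
    (hα : α ∈ contourAngles φ) {t : ℝ} (ht : 0 < t) :
    |((t : ℂ) * Complex.exp (α * I)).re| ≤ Real.cos φ * ‖(t : ℂ) * Complex.exp (α * I)‖ := by
  have h1 := exp_le (φ := φ) ((Real.log t : ℝ) + α * I : ℂ)
    (by simpa [abs_of_pos (h.cos_pos hφ)] using (abs_cos_of_mem_contourAngles hα).le)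
  rwa [Complex.exp_add, ← Complex.ofReal_exp, Real.exp_log ht] at h1

theorem ray_ne_zero (α : ℝ) {t : ℝ} (ht : 0 < t) : (t : ℂ) * Complex.exp (α * I) ≠ 0 :=
  mul_ne_zero (Complex.ofReal_ne_zero.mpr ht.ne') (Complex.exp_ne_zero _)

theorem norm_ray (α : ℝ) {t : ℝ} (ht : 0 < t) : ‖(t : ℂ) * Complex.exp (α * I)‖ = t := by
  rw [norm_mul, Complex.norm_exp_ofReal_mul_I, mul_one, Complex.norm_real,
    Real.norm_of_nonneg ht.le]

theorem theta_mem (h : IsBisectorialFamily L D ω j P R) (hθ : θ ∈ Set.Ioo ω (Real.pi / 2)) :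
    θ ∈ Set.Ioo 0 (Real.pi / 2) := ⟨h.angle_mem.1.trans hθ.1, hθ.2⟩

theorem phi_mem (hθ : θ ∈ Set.Ioo ω (Real.pi / 2)) (hφ : φ ∈ Set.Ioo ω θ) :
    φ ∈ Set.Ioo ω (Real.pi / 2) := ⟨hφ.1, hφ.2.trans hθ.2⟩

theorem mem_angleSet (h : IsBisectorialFamily L D ω j P R) (hφ : φ ∈ Set.Ioo ω θ) {α : ℝ}
    (hα : α ∈ contourAngles φ) : α ∈ angleSet θ :=
  mem_angleSet_of_mem_contourAngles (h.angle_mem.1.trans hφ.1) hφ.2 hα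

theorem contourCalculus_const_mul (h : IsBisectorialFamily L D ω j P R) (r : ℝ) :
    contourCalculus j P R φ (fun z => r * u z) = r • contourCalculus j P R φ u := by
  have key : ∀ α, ∫ t in Set.Ioi (0 : ℝ), rayIntegrand j P R (fun z => r * u z) α t =
      r • ∫ t in Set.Ioi (0 : ℝ), rayIntegrand j P R u α t := by
    intro α
    rw [← integral_smul]
    refine integral_congr_ae (Eventually.of_forall fun t => ?_)
    simp only [rayIntegrand]
    rw [show ∀ a b : ℂ, a * (r * b) = r * (a * b) by intros; ring, scalarOp_mul h.unit_sq,
      scalarOp_ofReal, smul_one_mul, mul_smul_comm]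
  simp only [contourCalculus, key]
  module

theorem contourCalculus_congr (h : IsBisectorialFamily L D ω j P R)
    (hθ : θ ∈ Set.Ioo ω (Real.pi / 2)) (hφ : φ ∈ Set.Ioo ω θ)
    (huv : ∀ z ∈ cDoubleSector θ, u z = v z) :
    contourCalculus j P R φ u = contourCalculus j P R φ v := by
  have key : ∀ α ∈ contourAngles φ, ∫ t in Set.Ioi (0 : ℝ), rayIntegrand j P R u α t =
      ∫ t in Set.Ioi (0 : ℝ), rayIntegrand j P R v α t := by
    intro α hα
    refine setIntegral_congr_fun measurableSet_Ioi fun t ht => ?_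
    simp only [rayIntegrand]
    rw [huv _ (mul_exp_mem_cDoubleSector (h.theta_mem hθ) (h.mem_angleSet hφ hα) ht)]
  simp only [contourCalculus]
  rw [key _ (by simp [contourAngles]), key _ (by simp [contourAngles]),
    key _ (by simp [contourAngles]), key _ (by simp [contourAngles])]

/-- The angles in a closed sector bounded by two rays of the contour. -/
theorem uIcc_subset_angleSet (h : IsBisectorialFamily L D ω j P R) (hφ : φ ∈ Set.Ioo ω θ) :
    Set.uIcc (-φ) φ ⊆ angleSet θ ∧
      Set.uIcc (Real.pi - φ) (Real.pi + φ) ⊆ angleSet θ := by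
  have h0 : 0 < φ := h.angle_mem.1.trans hφ.1
  constructor
  · rw [Set.uIcc_of_le (by linarith)]
    exact fun x hx => Or.inl ⟨by linarith [hx.1, hφ.2], by linarith [hx.2, hφ.2]⟩
  · rw [Set.uIcc_of_le (by linarith)]
    exact fun x hx => Or.inr ⟨by linarith [hx.1, hφ.2], by linarith [hx.2, hφ.2]⟩

variable [CompleteSpace V]

theorem integrableOn_rayIntegrand (h : IsBisectorialFamily L D ω j P R)
    (hθ : θ ∈ Set.Ioo ω (Real.pi / 2)) (hφ : φ ∈ Set.Ioo ω θ) (hu : IsDecaying θ u) {α : ℝ}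
    (hα : α ∈ contourAngles φ) : IntegrableOn (rayIntegrand j P R u α) (Set.Ioi 0) := by
  have hφ' := phi_mem hθ hφ
  obtain ⟨C, hC0, hC⟩ := h.bound φ hφ'
  have hcont : ContinuousOn (rayIntegrand j P R u α) (Set.Ioi 0) := by
    refine ContinuousOn.mul (fun t ht => ?_) ?_
    · have h1 := h.continuousAt_leftResolvent
        (h.mem_cOuter_of_le hφ' (ray_ne_zero α ht) (h.ray_le hφ' hα ht))
      exact (ContinuousAt.comp (f := fun t : ℝ => (t : ℂ) * Complex.exp (α * I)) h1
        (by fun_prop : Continuous fun t : ℝ =>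
          (t : ℂ) * Complex.exp (α * I)).continuousAt).continuousWithinAt
    · exact (continuous_scalarOp j).comp_continuousOn (continuousOn_const.mul
        (continuousOn_ray (h.theta_mem hθ) hu.diff (h.mem_angleSet hφ hα)))
  refine Integrable.mono' (((hu.integrable α (h.mem_angleSet hφ hα)).const_mul (C * (1 + ‖j‖))))
    (hcont.aestronglyMeasurable measurableSet_Ioi) ?_
  filter_upwards [ae_restrict_mem measurableSet_Ioi] with t ht
  have ht : 0 < t := ht
  have h1 := hC _ (ray_ne_zero α ht) (h.ray_le hφ' hα ht)
  rw [norm_ray α ht] at h1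
  have h2 := norm_scalarOp_le j (Complex.exp (α * I) * -I * u (t * Complex.exp (α * I)))
  rw [norm_mul, norm_mul, Complex.norm_exp_ofReal_mul_I, norm_neg, Complex.norm_I, one_mul,
    one_mul] at h2
  calc ‖rayIntegrand j P R u α t‖ ≤ _ := norm_mul_le _ _
    _ ≤ C / t * ((1 + ‖j‖) * ‖u (t * Complex.exp (α * I))‖) := by gcongr
    _ = _ := by ring

theorem complexify_integral_ray (h : IsBisectorialFamily L D ω j P R)
    (hθ : θ ∈ Set.Ioo ω (Real.pi / 2)) (hφ : φ ∈ Set.Ioo ω θ) (hu : IsDecaying θ u) {α : ℝ}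
    (hα : α ∈ contourAngles φ) (ℓ : (V →L[ℝ] V) →L[ℝ] ℝ) (B : V →L[ℝ] V) :
    (Integrable fun x : ℝ => logIntegrand j P R ℓ B u (x + α * I)) ∧
    complexify j ℓ (B * ∫ t in Set.Ioi (0 : ℝ), rayIntegrand j P R u α t) =
      -I * ∫ x : ℝ, logIntegrand j P R ℓ B u (x + α * I) := by
  let ψ := (complexify j ℓ).comp (ContinuousLinearMap.mul ℝ (V →L[ℝ] V) B)
  have hint := h.integrableOn_rayIntegrand hθ hφ hu hα
  -- The Jacobian exp x and the direction exp(iα) combine to exp w, and the factor -J of ds_J comes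
  -- out as -i.
  have hpt : ∀ x : ℝ, Real.exp x • ψ (rayIntegrand j P R u α (Real.exp x)) =
      -I * logIntegrand j P R ℓ B u (x + α * I) := by
    intro x
    change Real.exp x • complexify j ℓ (B * rayIntegrand j P R u α (Real.exp x)) = _
    rw [rayIntegrand, ← mul_assoc, complexify_mul_scalarOp h.unit_sq, logIntegrand, exp_line,
      Complex.real_smul]
    ring
  constructor
  · have h1 := (integrableOn_Ioi_zero_iff_exp _).mp (ψ.integrable_comp hint)
    simp only [hpt] at h1
    have h2 := h1.const_mul I
    refine h2.congr (Eventually.of_forall fun x => ?_)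
    change I * (-I * _) = _
    rw [← mul_assoc, mul_neg, Complex.I_mul_I, neg_neg, one_mul]
  · change ψ (∫ t in Set.Ioi (0 : ℝ), rayIntegrand j P R u α t) = _
    rw [← ψ.integral_comp_comm hint, integral_Ioi_zero_eq_exp, ← integral_const_mul]
    exact integral_congr_ae (Eventually.of_forall hpt)

theorem complexify_contourCalculus (h : IsBisectorialFamily L D ω j P R)
    (hθ : θ ∈ Set.Ioo ω (Real.pi / 2)) (hφ : φ ∈ Set.Ioo ω θ) (hu : IsDecaying θ u)
    (ℓ : (V →L[ℝ] V) →L[ℝ] ℝ) (B : V →L[ℝ] V) :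
    complexify j ℓ (B * contourCalculus j P R φ u) = (2 * Real.pi : ℂ)⁻¹ * (-I) *
      ((∫ x : ℝ, logIntegrand j P R ℓ B u (x + (-φ : ℝ) * I)) -
      (∫ x : ℝ, logIntegrand j P R ℓ B u (x + φ * I)) +
      (∫ x : ℝ, logIntegrand j P R ℓ B u (x + (Real.pi - φ : ℝ) * I)) -
      (∫ x : ℝ, logIntegrand j P R ℓ B u (x + (Real.pi + φ : ℝ) * I))) := by
  have key : ∀ α ∈ contourAngles φ, _ := fun α hα =>
    (h.complexify_integral_ray hθ hφ hu hα ℓ B).2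
  rw [contourCalculus, mul_smul_comm, map_smul, mul_sub, mul_add, mul_sub, map_sub, map_add,
    map_sub, key _ (by simp [contourAngles]), key _ (by simp [contourAngles]),
    key _ (by simp [contourAngles]), key _ (by simp [contourAngles]), Complex.real_smul]
  push_cast
  ring

theorem contourCalculus_add (h : IsBisectorialFamily L D ω j P R)
    (hθ : θ ∈ Set.Ioo ω (Real.pi / 2)) (hφ : φ ∈ Set.Ioo ω θ) (hu : IsDecaying θ u)
    (hv : IsDecaying θ v) :
    contourCalculus j P R φ (fun z => u z + v z) =
      contourCalculus j P R φ u + contourCalculus j P R φ v := by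
  have key : ∀ α ∈ contourAngles φ, ∫ t in Set.Ioi (0 : ℝ),
      rayIntegrand j P R (fun z => u z + v z) α t =
      (∫ t in Set.Ioi (0 : ℝ), rayIntegrand j P R u α t) +
        ∫ t in Set.Ioi (0 : ℝ), rayIntegrand j P R v α t := by
    intro α hα
    rw [← integral_add (h.integrableOn_rayIntegrand hθ hφ hu hα)
      (h.integrableOn_rayIntegrand hθ hφ hv hα)]
    refine integral_congr_ae (Eventually.of_forall fun t => ?_)
    simp only [rayIntegrand, mul_add, scalarOp_add]
  simp only [contourCalculus]
  rw [key _ (by simp [contourAngles]), key _ (by simp [contourAngles]),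
    key _ (by simp [contourAngles]), key _ (by simp [contourAngles])]
  module

/-- By the resolvent equations M S(s) u(s) differs from r(s) S(s) u(s) by a fraction times u(s),
holomorphic inside the sector. In each component its integrals along the two boundary rays cancel.
-/
theorem contourCalculus_simpleFrac_mul (h : IsBisectorialFamily L D ω j P R)
    (hθ : θ ∈ Set.Ioo ω (Real.pi / 2)) (hφ : φ ∈ Set.Ioo ω θ) (hu : IsDecaying θ u)
    (hc : c ∈ cOuter θ) (a b : ℝ) :
    contourCalculus j P R φ (fun z => simpleFrac c a b z * u z) =
      (a • P c + b • R c) * contourCalculus j P R φ u := by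
  have hθ0 := h.theta_mem hθ
  have hφ' := phi_mem hθ hφ
  have hc' := h.cOuter_subset hθ hc
  have hmu := hu.simpleFrac_mul hθ0 hc a b
  refine eq_of_complexify_eq (j := j) fun ℓ => ?_
  set M : V →L[ℝ] V := a • P c + b • R c with hM
  set ρ := complexify j ℓ (R c)
  set π := complexify j ℓ (P c)
  -- A + B s collects the terms of `complexify_P_mul` (times a) and `complexify_R_mul` (times b)
  -- that are free of the resolvent at s.
  let A : ℂ := a * (ρ - (c + conj c) * π) - b * (c * conj c * π)
  let B : ℂ := a * π + b * ρ
  let G : ℂ → ℂ := fun w => simpleFrac c A B (Complex.exp w) * Complex.exp w * u (Complex.exp w)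
  obtain ⟨K, hK⟩ := exists_simpleFrac_bound hc A B
  obtain ⟨C, hC⟩ := hu.bdd
  have hC0 : 0 ≤ |C| := abs_nonneg C
  have hGd : ∀ w : ℂ, w.im ∈ angleSet θ → DifferentiableAt ℂ G w := by
    intro w hw
    have hm := exp_mem_cDoubleSector hθ0 hw
    exact (((differentiableAt_simpleFrac hc hm A B).comp w Complex.differentiableAt_exp).mul
      Complex.differentiableAt_exp).mul ((hu.diff _ hm).comp w Complex.differentiableAt_exp)
  have hGb' : ∀ w : ℂ, w.im ∈ angleSet θ → ‖G w‖ ≤ |K| * ‖u (Complex.exp w)‖ := by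
    intro w hw
    have hm := exp_mem_cDoubleSector hθ0 hw
    rw [norm_mul, norm_mul]
    exact mul_le_mul_of_nonneg_right ((hK _ hm).2.trans (le_abs_self K)) (norm_nonneg _)
  have hGb : ∀ w : ℂ, w.im ∈ angleSet θ → ‖G w‖ ≤ |K| * |C| := fun w hw =>
    (hGb' w hw).trans (mul_le_mul_of_nonneg_left
      ((hC _ (exp_mem_cDoubleSector hθ0 hw)).trans (le_abs_self C)) (abs_nonneg _))
  have hGi : ∀ α ∈ contourAngles φ, Integrable fun x : ℝ => G (x + α * I) := by
    intro α hα
    have hα' := h.mem_angleSet hφ hα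
    refine Integrable.mono' ((hu.integrable_line hθ0 hα').norm.const_mul |K|)
      (continuous_line (a := α) (b := α) (fun w hw => hGd w ?_) (by simp)).aestronglyMeasurable
      (Eventually.of_forall fun x => hGb' _ (by simpa using hα'))
    have : w.im = α := by simpa using hw
    rwa [this]
  have hpt : ∀ α ∈ contourAngles φ, ∀ x : ℝ, logIntegrand j P R ℓ M u (x + α * I) =
      logIntegrand j P R ℓ 1 (fun z => simpleFrac c a b z * u z) (x + α * I) +
        G (x + α * I) := by
    intro α hα x
    set s := Complex.exp (x + α * I) with hs
    have hs1 : s ∈ cOuter ω := by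
      refine h.mem_cOuter_of_le hφ' (Complex.exp_ne_zero _) (exp_le _ ?_)
      have := (abs_cos_of_mem_contourAngles hα).le
      rw [abs_of_pos (h.cos_pos hφ')] at this
      simpa using this
    have hs2 : s ∈ cDoubleSector θ :=
      exp_mem_cDoubleSector hθ0 (by simpa using h.mem_angleSet hφ hα)
    have n1 := sub_ne_zero_of_mem hc hs2
    have n2 := sub_ne_zero_of_mem (conj_mem_cOuter hc) hs2
    have k1 := h.complexify_P_mul hs1 hc' ℓ
    have k2 := h.complexify_R_mul hs1 hc' ℓ
    have k3 : complexify j ℓ (M * leftResolvent j P R s) =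
        a * complexify j ℓ (P c * leftResolvent j P R s) +
        b * complexify j ℓ (R c * leftResolvent j P R s) := by
      rw [hM, add_mul, smul_mul_assoc, smul_mul_assoc, map_add, map_smul, map_smul,
        Complex.real_smul, Complex.real_smul]
    simp only [logIntegrand, G, simpleFrac, ← hs, one_mul, k3]
    rw [div_mul_eq_mul_div, div_mul_eq_mul_div, div_mul_eq_mul_div, mul_div_assoc', ← add_div,
      eq_div_iff (mul_ne_zero n1 n2)]
    simp only [A, B]
    linear_combination a * s * u s * k1 + b * s * u s * k2
  have hsum : ∀ α ∈ contourAngles φ, ∫ x : ℝ, logIntegrand j P R ℓ M u (x + α * I) =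
      (∫ x : ℝ, logIntegrand j P R ℓ 1 (fun z => simpleFrac c a b z * u z) (x + α * I)) +
        ∫ x : ℝ, G (x + α * I) := by
    intro α hα
    rw [← integral_add (h.complexify_integral_ray hθ hφ hmu hα ℓ 1).1 (hGi α hα)]
    exact integral_congr_ae (Eventually.of_forall (hpt α hα))
  have c1 := strip_integral_eq (a := -φ) (b := φ)
    (fun w hw => hGd w ((h.uIcc_subset_angleSet hφ).1 hw))
    (fun w hw => hGb w ((h.uIcc_subset_angleSet hφ).1 hw))
    (hGi _ (by simp [contourAngles])) (hGi _ (by simp [contourAngles]))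
  have c2 := strip_integral_eq (a := Real.pi - φ) (b := Real.pi + φ)
    (fun w hw => hGd w ((h.uIcc_subset_angleSet hφ).2 hw))
    (fun w hw => hGb w ((h.uIcc_subset_angleSet hφ).2 hw))
    (hGi _ (by simp [contourAngles])) (hGi _ (by simp [contourAngles]))
  have e1 := h.complexify_contourCalculus hθ hφ hmu ℓ 1
  rw [one_mul] at e1
  rw [e1, h.complexify_contourCalculus hθ hφ hu ℓ M, hsum _ (by simp [contourAngles]),
    hsum _ (by simp [contourAngles]), hsum _ (by simp [contourAngles]),
    hsum _ (by simp [contourAngles]), c1, c2]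
  ring

end IsBisectorialFamily

end

end HInfty
end

noncomputable section
namespace HInfty

open Polynomial
open Complex (I)
open Filter Topology MeasureTheory
open scoped ComplexConjugate

section

variable {V : Type*} [NormedAddCommGroup V] [NormedSpace ℝ V]

/-! ### The extended calculus and its multipliers -/

variable {L : V →ₗ[ℝ] V} {D : Submodule ℝ V} {ω θ φ : ℝ} {j : V →L[ℝ] V} {P R : ℂ → V →L[ℝ] V}

/-- `A` is the value of the calculus on the function `f` with values `f0` and `finf` at zero and
infinity. -/
def IsValue (j : V →L[ℝ] V) (P R : ℂ → V →L[ℝ] V) (θ φ : ℝ) (f : ℂ → ℂ) (A : V →L[ℝ] V) : Prop :=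
  ∃ f0 finf : ℝ, IsDecaying θ (fun z => f z - finf - (1 + z ^ 2)⁻¹ * (f0 - finf)) ∧
    A = finf • 1 + (f0 - finf) • P I +
      contourCalculus j P R φ fun z => f z - finf - (1 + z ^ 2)⁻¹ * (f0 - finf)

/-- `r` multiplies the domain of the calculus into itself, and the calculus maps multiplication by
`r` to composition with `M`. -/
def IsMultiplier (j : V →L[ℝ] V) (P R : ℂ → V →L[ℝ] V) (θ φ : ℝ) (r : ℂ → ℂ) (M : V →L[ℝ] V) :
    Prop :=
  ∀ f A, IsValue j P R θ φ f A → IsValue j P R θ φ (fun z => r z * f z) (M * A) ∧ Commute M A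

namespace IsBisectorialFamily

variable {u v : ℂ → ℂ} {c : ℂ}

theorem isValue_of_eq (h : IsBisectorialFamily L D ω j P R)
    (hθ : θ ∈ Set.Ioo ω (Real.pi / 2)) (hφ : φ ∈ Set.Ioo ω θ) {f u : ℂ → ℂ} {f0 finf : ℝ}
    {A : V →L[ℝ] V} (hu : IsDecaying θ u)
    (hf : ∀ z ∈ cDoubleSector θ, f z = finf + (1 + z ^ 2)⁻¹ * (f0 - finf) + u z)
    (hA : A = finf • 1 + (f0 - finf) • P I + contourCalculus j P R φ u) :
    IsValue j P R θ φ f A := by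
  have e : ∀ z ∈ cDoubleSector θ, f z - finf - (1 + z ^ 2)⁻¹ * (f0 - finf) = u z := fun z hz => by
    rw [hf z hz]; ring
  exact ⟨f0, finf, hu.congr e (h.theta_mem hθ), by
    rw [hA, h.contourCalculus_congr hθ hφ e]⟩

theorem isValue_congr (h : IsBisectorialFamily L D ω j P R)
    (hθ : θ ∈ Set.Ioo ω (Real.pi / 2)) (hφ : φ ∈ Set.Ioo ω θ) {f g : ℂ → ℂ} {A : V →L[ℝ] V}
    (hf : IsValue j P R θ φ f A) (hfg : ∀ z ∈ cDoubleSector θ, g z = f z) :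
    IsValue j P R θ φ g A := by
  obtain ⟨f0, finf, hu, hA⟩ := hf
  exact h.isValue_of_eq hθ hφ hu (fun z hz => by rw [hfg z hz]; ring) hA

/-- The integrand contains j, which need not commute with M. On conjugate rays the contributions of
j cancel for symmetric u, leaving a real combination of P_s and R_s. -/
theorem commute_rayIntegrand_sub (h : IsBisectorialFamily L D ω j P R)
    {u : ℂ → ℂ} {α β t : ℝ} (hαβ : Complex.exp (β * I) = conj (Complex.exp (α * I)))
    (hu : u (conj (t * Complex.exp (α * I))) = conj (u (t * Complex.exp (α * I))))
    {M : V →L[ℝ] V} (hP : Commute M (P (t * Complex.exp (α * I))))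
    (hR : Commute M (R (t * Complex.exp (α * I)))) :
    Commute M (rayIntegrand j P R u β t - rayIntegrand j P R u α t) := by
  set s : ℂ := t * Complex.exp (α * I) with hs
  set a : ℂ := Complex.exp (α * I) * -I * u s with ha
  have hsb : (t : ℂ) * Complex.exp (β * I) = conj s := by
    rw [hαβ, hs, map_mul, Complex.conj_ofReal]
  have hab : Complex.exp (β * I) * -I * u (t * Complex.exp (β * I)) = -conj a := by
    rw [hsb, hu, hαβ, ha, map_mul, map_mul, map_neg, Complex.conj_I]
    ring
  have key : rayIntegrand j P R u β t - rayIntegrand j P R u α t =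
      (2 * a.re) • R s - (2 * (conj s * a).re) • P s := by
    have r1 : scalarOp j (s * conj a) + scalarOp j (conj s * a) = (2 * (conj s * a).re) • 1 := by
      rw [← scalarOp_add, ← scalarOp_ofReal j]
      congr 1
      rw [← Complex.add_conj, map_mul (starRingEnd ℂ) (conj s) a, Complex.conj_conj, add_comm]
    have r2 : scalarOp j (conj a) + scalarOp j a = (2 * a.re) • 1 := by
      rw [← scalarOp_add, ← scalarOp_ofReal j, ← Complex.add_conj, add_comm]
    simp only [rayIntegrand]
    rw [hab, hsb, ← hs, ← ha]
    simp only [leftResolvent, h.P_conj, h.R_conj, Complex.conj_conj, scalarOp_neg, sub_mul,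
      mul_assoc, mul_neg, ← scalarOp_mul h.unit_sq]
    have r1' := congrArg (fun A => P s * A) r1
    have r2' := congrArg (fun A => R s * A) r2
    simp only [mul_add, mul_smul_comm, mul_one] at r1' r2'
    rw [← r1', ← r2']
    abel
  rw [key]
  exact (hR.smul_right _).sub_right (hP.smul_right _)

theorem isValue_one (h : IsBisectorialFamily L D ω j P R)
    (hθ : θ ∈ Set.Ioo ω (Real.pi / 2)) (hφ : φ ∈ Set.Ioo ω θ) :
    IsValue j P R θ φ (fun _ => 1) 1 := by
  have h0 : IsDecaying θ fun _ => (0 : ℂ) :=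
    ⟨fun _ _ => differentiableAt_const _, by simp, ⟨0, by simp⟩, by simp⟩
  have hz : contourCalculus j P R φ (fun _ => (0 : ℂ)) = 0 := by
    simpa using h.contourCalculus_const_mul (φ := φ) (u := fun _ => (0 : ℂ)) 0
  exact h.isValue_of_eq hθ hφ (f0 := 1) (finf := 1) h0 (by simp) (by simp [hz])

/-- On the positive axis the difference of the two remainders is a combination of 1 and 1 / (1 + t²)
that is integrable for dt / t, so the values at zero and infinity agree. -/
theorem isValue_unique (h : IsBisectorialFamily L D ω j P R)
    (hθ : θ ∈ Set.Ioo ω (Real.pi / 2)) (hφ : φ ∈ Set.Ioo ω θ) {f g : ℂ → ℂ}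
    {A B : V →L[ℝ] V} (hf : IsValue j P R θ φ f A) (hg : IsValue j P R θ φ g B)
    (hfg : ∀ z ∈ cDoubleSector θ, f z = g z) : A = B := by
  have hθ0 := h.theta_mem hθ
  have hg' := h.isValue_congr hθ hφ hg hfg
  obtain ⟨f0, finf, hu, hA⟩ := hf
  obtain ⟨g0, ginf, hv, hB⟩ := hg'
  have hd := hu.add hθ0 (hv.const_mul hθ0 (-1))
  have h0 : (0 : ℝ) ∈ angleSet θ := Or.inl ⟨by linarith [hθ0.1], hθ0.1⟩
  have hi := hd.integrable 0 h0
  have hz := eq_zero_of_integrableOn_const_add (a := ginf - finf)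
    (b := (g0 - ginf) - (f0 - finf)) (hi.congr_fun (fun t _ => by
      simp only [Complex.ofReal_zero, zero_mul, Complex.exp_zero, mul_one]
      congr 1
      rw [← Real.norm_eq_abs, ← Complex.norm_real]
      congr 1
      push_cast
      ring) measurableSet_Ioi)
  have e1 : ginf = finf := by linarith [hz.1]
  have e2 : g0 = f0 := by linarith [hz.2]
  rw [hA, hB, e1, e2]

theorem isMultiplier_const (h : IsBisectorialFamily L D ω j P R)
    (hθ : θ ∈ Set.Ioo ω (Real.pi / 2)) (hφ : φ ∈ Set.Ioo ω θ) (r : ℝ) :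
    IsMultiplier j P R θ φ (fun _ => r) (r • 1) := by
  rintro f A ⟨f0, finf, hu, hA⟩
  refine ⟨?_, (Commute.one_left A).smul_left r⟩
  refine h.isValue_of_eq hθ hφ (f0 := r * f0) (finf := r * finf)
    (hu.const_mul (h.theta_mem hθ) r) (fun z _ => by push_cast; ring) ?_
  rw [h.contourCalculus_const_mul, hA, smul_one_mul]
  module

theorem isMultiplier_congr (h : IsBisectorialFamily L D ω j P R)
    (hθ : θ ∈ Set.Ioo ω (Real.pi / 2)) (hφ : φ ∈ Set.Ioo ω θ) {r r' : ℂ → ℂ} {M : V →L[ℝ] V}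
    (hr : IsMultiplier j P R θ φ r M) (hrr' : ∀ z ∈ cDoubleSector θ, r' z = r z) :
    IsMultiplier j P R θ φ r' M := fun f A hf =>
  ⟨h.isValue_congr hθ hφ (hr f A hf).1 fun z hz => by rw [hrr' z hz], (hr f A hf).2⟩

theorem isMultiplier_mul (h : IsBisectorialFamily L D ω j P R)
    (hθ : θ ∈ Set.Ioo ω (Real.pi / 2)) (hφ : φ ∈ Set.Ioo ω θ) {r r' : ℂ → ℂ} {M M' : V →L[ℝ] V}
    (hr : IsMultiplier j P R θ φ r M) (hr' : IsMultiplier j P R θ φ r' M') :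
    IsMultiplier j P R θ φ (fun z => r z * r' z) (M * M') := by
  intro f A hf
  obtain ⟨hf', hc'⟩ := hr' f A hf
  refine ⟨?_, (hr f A hf).2.mul_left hc'⟩
  rw [mul_assoc]
  exact h.isValue_congr hθ hφ (hr _ _ hf').1 fun z _ => by ring

variable [CompleteSpace V]

/-- Outside the sector s R_I S(s) is holomorphic, tends to R_I at infinity and to 0 at zero, each
exponentially fast in the logarithmic variable. -/
theorem principal_value_outer (h : IsBisectorialFamily L D ω j P R)
    (hφ : φ ∈ Set.Ioo ω (Real.pi / 2)) (ℓ : (V →L[ℝ] V) →L[ℝ] ℝ) {a b : ℝ}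
    (hab : ∀ y ∈ Set.uIcc a b, |Real.cos y| ≤ Real.cos φ) :
    Tendsto (fun X : ℝ =>
      (∫ x : ℝ in -X..X, logIntegrand j P R ℓ (R I) (fun _ => 1) (x + a * I)) -
        ∫ x : ℝ in -X..X, logIntegrand j P R ℓ (R I) (fun _ => 1) (x + b * I))
      atTop (𝓝 (-(I * complexify j ℓ (R I) * (b - a)))) := by
  obtain ⟨C, hC0, hC⟩ := h.bound φ hφ
  set ψ := complexify j ℓ with hψ
  have hout : ∀ w : ℂ, w.im ∈ Set.uIcc a b → Complex.exp w ∈ cOuter ω := fun w hw =>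
    h.mem_cOuter_of_le hφ (Complex.exp_ne_zero w) (exp_le w (hab _ hw))
  have hS : ∀ w : ℂ, w.im ∈ Set.uIcc a b →
      ‖leftResolvent j P R (Complex.exp w)‖ ≤ C * Real.exp (-w.re) := by
    intro w hw
    have := hC _ (Complex.exp_ne_zero w) (exp_le w (hab _ hw))
    rwa [Complex.norm_exp, div_eq_mul_inv, ← Real.exp_neg] at this
  have hPS : ∀ w : ℂ, w.im ∈ Set.uIcc a b →
      ‖ψ (P I * leftResolvent j P R (Complex.exp w))‖ ≤
        ‖ψ‖ * (‖P I‖ * (C * Real.exp (-w.re))) := fun w hw =>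
    (ψ.le_opNorm _).trans (mul_le_mul_of_nonneg_left ((norm_mul_le _ _).trans
      (mul_le_mul_of_nonneg_left (hS w hw) (norm_nonneg _))) (norm_nonneg _))
  have hψS : ∀ w : ℂ, w.im ∈ Set.uIcc a b →
      ‖ψ (leftResolvent j P R (Complex.exp w))‖ ≤ ‖ψ‖ * (C * Real.exp (-w.re)) := fun w hw =>
    (ψ.le_opNorm _).trans (mul_le_mul_of_nonneg_left (hS w hw) (norm_nonneg _))
  set K1 : ℝ := ‖ψ‖ * C + ‖ψ‖ * ‖P I‖ * C
  set K2 : ℝ := ‖ψ‖ * ‖P I‖ * C + ‖ψ (P I)‖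
  refine strip_principal_value (K := max K1 K2) (fun w hw => ?_) (fun w hw => ?_) (fun w hw => ?_)
  · have h1 := (h.differentiableAt_complexify (hout w hw) ℓ (R I)).comp w
      Complex.differentiableAt_exp
    exact (h1.mul Complex.differentiableAt_exp).mul (differentiableAt_const 1)
  · rw [logIntegrand, mul_one, h.complexify_R_I_mul_s (hout w hw) ℓ]
    calc _ ≤ _ := norm_sub_le _ _
      _ ≤ ‖ψ‖ * (C * Real.exp (-w.re)) + ‖ψ‖ * (‖P I‖ * (C * Real.exp (-w.re))) :=
        add_le_add (hψS w hw) (hPS w hw)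
      _ = K1 * Real.exp (-w.re) := by simp only [K1]; ring
      _ ≤ _ := by gcongr; exact le_max_left _ _
  · rw [logIntegrand, mul_one, h.complexify_R_I_mul (hout w hw) ℓ, norm_mul, Complex.norm_exp]
    refine mul_le_mul_of_nonneg_right ?_ (Real.exp_pos _).le
    refine le_trans ?_ (le_max_right K1 K2)
    refine (norm_sub_le _ _).trans (add_le_add ?_ le_rfl)
    rw [norm_mul, Complex.norm_exp]
    calc _ ≤ ‖ψ‖ * (‖P I‖ * (C * Real.exp (-w.re))) * Real.exp w.re :=
        mul_le_mul_of_nonneg_right (hPS w hw) (Real.exp_pos _).le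
      _ = ‖ψ‖ * ‖P I‖ * C * (Real.exp (-w.re) * Real.exp w.re) := by ring
      _ = _ := by rw [← Real.exp_add, neg_add_cancel, Real.exp_zero, mul_one]

/-- Here z (π - ρ z) / (1 + z²) is holomorphic in the sector, with limit -ρ at infinity and 0 at
zero. -/
theorem principal_value_inner (hθ : θ ∈ Set.Ioo 0 (Real.pi / 2)) (π ρ : ℂ) {a b : ℝ}
    (hab : Set.uIcc a b ⊆ angleSet θ) :
    Tendsto (fun X : ℝ =>
      (∫ x : ℝ in -X..X, simpleFrac I π (-ρ) (Complex.exp (x + a * I)) *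
        Complex.exp (x + a * I)) -
      ∫ x : ℝ in -X..X, simpleFrac I π (-ρ) (Complex.exp (x + b * I)) *
        Complex.exp (x + b * I))
      atTop (𝓝 (-(I * (-ρ) * (b - a)))) := by
  have hI := I_mem_cOuter hθ
  obtain ⟨K1, hK1⟩ := exists_simpleFrac_bound hI ρ π
  obtain ⟨K2, hK2⟩ := exists_simpleFrac_bound hI π (-ρ)
  refine strip_principal_value (K := max K1 K2)
    (G := fun w => simpleFrac I π (-ρ) (Complex.exp w) * Complex.exp w)
    (fun w hw => ?_) (fun w hw => ?_) (fun w hw => ?_)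
  · exact ((differentiableAt_simpleFrac hI (exp_mem_cDoubleSector hθ (hab hw)) π (-ρ)).comp w
      Complex.differentiableAt_exp).mul Complex.differentiableAt_exp
  · have hm := exp_mem_cDoubleSector hθ (hab hw)
    have hne := mul_ne_zero (sub_ne_zero_of_mem hI hm)
      (sub_ne_zero_of_mem (conj_mem_cOuter hI) hm)
    have e : simpleFrac I π (-ρ) (Complex.exp w) * Complex.exp w - -ρ =
        simpleFrac I ρ π (Complex.exp w) := by
      rw [simpleFrac, simpleFrac, div_mul_eq_mul_div, div_sub' hne]
      congr 1
      rw [sub_I_mul]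
      ring
    have := (hK1 _ hm).2
    rw [Complex.norm_exp, ← le_div_iff₀ (Real.exp_pos _), div_eq_mul_inv, ← Real.exp_neg] at this
    rw [e]
    exact this.trans (mul_le_mul_of_nonneg_right (le_max_left _ _) (Real.exp_pos _).le)
  · have hm := exp_mem_cDoubleSector hθ (hab hw)
    rw [norm_mul, Complex.norm_exp]
    exact mul_le_mul_of_nonneg_right ((hK2 _ hm).1.trans (le_max_right _ _)) (Real.exp_pos _).le

/-- The resolvent equation at c = i splits z S(z) / (1 + z²) into R_I S(z) and a scalar fraction.
Each piece alone is only controlled by O(1/|z|) at infinity, so principal values are taken. The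
fraction is moved through the two inner sectors and R_I S(z) through the two complementary ones.
Together the openings 2φ, 2φ, π - 2φ, π - 2φ make a full turn, which is the factor 2π that
normalizes the integral. -/
theorem contourCalculus_simpleFrac_I (h : IsBisectorialFamily L D ω j P R)
    (hθ : θ ∈ Set.Ioo ω (Real.pi / 2)) (hφ : φ ∈ Set.Ioo ω θ) :
    contourCalculus j P R φ (simpleFrac I 0 1) = R I := by
  have hθ0 := h.theta_mem hθ
  have hφ' := phi_mem hθ hφ
  have hI := I_mem_cOuter h.angle_mem
  have hI' := I_mem_cOuter hθ0
  have hφ0 : 0 < φ := h.angle_mem.1.trans hφ.1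
  have hu := isDecaying_simpleFrac_I hθ0
  refine eq_of_complexify_eq (j := j) fun ℓ => ?_
  set ρ := complexify j ℓ (R I) with hρ
  set π := complexify j ℓ (P I) with hπ
  let G : ℂ → ℂ := fun w => simpleFrac I π (-ρ) (Complex.exp w) * Complex.exp w
  let F : ℂ → ℂ := logIntegrand j P R ℓ (R I) (fun _ => 1)
  let H : ℂ → ℂ := logIntegrand j P R ℓ 1 (simpleFrac I 0 1)
  have hmem : ∀ α ∈ contourAngles φ, ∀ x : ℝ, Complex.exp (x + α * I) ∈ cOuter ω ∧
      Complex.exp (x + α * I) ∈ cDoubleSector θ := by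
    intro α hα x
    refine ⟨h.mem_cOuter_of_le hφ' (Complex.exp_ne_zero _) (exp_le _ ?_),
      exp_mem_cDoubleSector hθ0 (by simpa using h.mem_angleSet hφ hα)⟩
    have := (abs_cos_of_mem_contourAngles hα).le
    rw [abs_of_pos (h.cos_pos hφ')] at this
    simpa using this
  have hpt : ∀ α ∈ contourAngles φ, ∀ x : ℝ, H (x + α * I) = F (x + α * I) + G (x + α * I) := by
    intro α hα x
    obtain ⟨hs1, hs2⟩ := hmem α hα x
    set s := Complex.exp (x + α * I) with hs
    have n1 := sub_ne_zero_of_mem hI' hs2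
    have n2 := sub_ne_zero_of_mem (conj_mem_cOuter hI') hs2
    have k := h.complexify_R_mul hs1 hI ℓ
    simp only [H, F, G, logIntegrand, simpleFrac, ← hs, one_mul, zero_add, mul_one]
    rw [div_mul_eq_mul_div, mul_div_assoc', add_div' _ _ _ (mul_ne_zero n1 n2),
      div_left_inj' (mul_ne_zero n1 n2)]
    rw [Complex.conj_I, mul_neg, Complex.I_mul_I, neg_neg, one_mul, ← hρ, ← hπ] at k
    rw [Complex.conj_I]
    linear_combination -s * k
  have hcF : ∀ α ∈ contourAngles φ, Continuous fun x : ℝ => F (x + α * I) := by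
    intro α hα
    refine continuous_line (a := α) (b := α) (fun w hw => ?_) (by simp)
    have hw' : w = (w.re : ℂ) + α * I := by
      have : w.im = α := by simpa using hw
      rw [← this, Complex.re_add_im]
    have hm : Complex.exp w ∈ cOuter ω := by rw [hw']; exact (hmem α hα w.re).1
    exact (((h.differentiableAt_complexify hm ℓ (R I)).comp w
      Complex.differentiableAt_exp).mul Complex.differentiableAt_exp).mul
      (differentiableAt_const 1)
  have hcG : ∀ α ∈ contourAngles φ, Continuous fun x : ℝ => G (x + α * I) := by
    intro α hα
    refine continuous_line (a := α) (b := α) (fun w hw => ?_) (by simp)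
    have hw' : w.im = α := by simpa using hw
    exact ((differentiableAt_simpleFrac hI' (exp_mem_cDoubleSector hθ0
      (hw' ▸ h.mem_angleSet hφ hα)) π (-ρ)).comp w Complex.differentiableAt_exp).mul
      Complex.differentiableAt_exp
  have hsplit : ∀ α ∈ contourAngles φ, ∀ X : ℝ, ∫ x : ℝ in -X..X, H (x + α * I) =
      (∫ x : ℝ in -X..X, F (x + α * I)) + ∫ x : ℝ in -X..X, G (x + α * I) := by
    intro α hα X
    rw [← intervalIntegral.integral_add ((hcF α hα).intervalIntegrable _ _)
      ((hcG α hα).intervalIntegrable _ _)]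
    exact intervalIntegral.integral_congr fun x _ => hpt α hα x
  have hlim : ∀ α ∈ contourAngles φ, Tendsto (fun X : ℝ => ∫ x : ℝ in -X..X, H (x + α * I)) atTop
      (𝓝 (∫ x : ℝ, H (x + α * I))) := fun α hα =>
    intervalIntegral_tendsto_integral (h.complexify_integral_ray hθ hφ hu hα ℓ 1).1
      tendsto_neg_atTop_atBot tendsto_id
  have m1 : -φ ∈ contourAngles φ := by simp [contourAngles]
  have m2 : φ ∈ contourAngles φ := by simp [contourAngles]
  have m3 : Real.pi - φ ∈ contourAngles φ := by simp [contourAngles]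
  have m4 : Real.pi + φ ∈ contourAngles φ := by simp [contourAngles]
  have hcos : ∀ y : ℝ, φ ≤ y → y ≤ Real.pi - φ → |Real.cos y| ≤ Real.cos φ := by
    intro y h1 h2
    rw [abs_le]
    constructor
    · rw [← Real.cos_pi_sub]
      exact Real.cos_le_cos_of_nonneg_of_le_pi (by linarith) (by linarith) h2
    · exact Real.cos_le_cos_of_nonneg_of_le_pi hφ0.le (by linarith) h1
  have o1 := h.principal_value_outer hφ' ℓ (a := φ) (b := Real.pi - φ) (fun y hy => by
    rw [Set.uIcc_of_le (by linarith [hφ'.2])] at hy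
    exact hcos y hy.1 hy.2)
  -- The ray at angle -φ bounds the lower complementary sector at angle 2π - φ; periodicity of exp
  -- identifies the two.
  have o2 := h.principal_value_outer hφ' ℓ (a := Real.pi + φ) (b := -φ + 2 * Real.pi)
    (fun y hy => by
      rw [Set.uIcc_of_le (by linarith [hφ'.2])] at hy
      have := hcos (y - Real.pi) (by linarith [hy.1]) (by linarith [hy.2])
      rwa [Real.cos_sub_pi, abs_neg] at this)
  have hper : ∀ x : ℝ, F (x + (-φ + 2 * Real.pi : ℝ) * I) = F (x + (-φ : ℝ) * I) := by
    intro x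
    have : Complex.exp (x + (-φ + 2 * Real.pi : ℝ) * I) = Complex.exp (x + (-φ : ℝ) * I) := by
      rw [← Complex.exp_periodic (x + (-φ : ℝ) * I)]
      congr 1
      push_cast
      ring
    simp only [F, logIntegrand, this]
  have i1 := principal_value_inner hθ0 π ρ (h.uIcc_subset_angleSet hφ).1
  have i2 := principal_value_inner hθ0 π ρ (h.uIcc_subset_angleSet hφ).2
  have hsum := (((hlim _ m1).sub (hlim _ m2)).add (hlim _ m3)).sub (hlim _ m4)
  have htot := ((i1.add i2).sub o1).sub o2
  have hval := tendsto_nhds_unique hsum (htot.congr fun X => by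
    have e : ∫ x : ℝ in -X..X, logIntegrand j P R ℓ (R I) (fun _ => 1)
        (x + (-φ + 2 * Real.pi : ℝ) * I) = ∫ x : ℝ in -X..X, F (x + (-φ : ℝ) * I) :=
      intervalIntegral.integral_congr fun x _ => hper x
    rw [hsplit _ m1, hsplit _ m2, hsplit _ m3, hsplit _ m4, e]
    simp only [F, G]
    ring)
  have e1 := h.complexify_contourCalculus hθ hφ hu ℓ 1
  rw [one_mul] at e1
  rw [e1]
  change _ * ((∫ x : ℝ, H (x + (-φ : ℝ) * I)) - (∫ x : ℝ, H (x + φ * I)) +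
    (∫ x : ℝ, H (x + (Real.pi - φ : ℝ) * I)) - (∫ x : ℝ, H (x + (Real.pi + φ : ℝ) * I))) = _
  rw [hval]
  push_cast
  have hpi : (Real.pi : ℂ) ≠ 0 := Complex.ofReal_ne_zero.mpr Real.pi_ne_zero
  field_simp
  linear_combination -2 * Real.pi * ρ * Complex.I_mul_I

theorem commute_contourCalculus (h : IsBisectorialFamily L D ω j P R)
    (hθ : θ ∈ Set.Ioo ω (Real.pi / 2)) (hφ : φ ∈ Set.Ioo ω θ) (hu : IsDecaying θ u)
    {M : V →L[ℝ] V} (hP : ∀ s ∈ cOuter ω, Commute M (P s)) (hR : ∀ s ∈ cOuter ω, Commute M (R s)) :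
    Commute M (contourCalculus j P R φ u) := by
  have hφ' := phi_mem hθ hφ
  have key : ∀ α ∈ contourAngles φ, ∀ β ∈ contourAngles φ,
      Complex.exp (β * I) = conj (Complex.exp (α * I)) →
      Commute M ((∫ t in Set.Ioi (0 : ℝ), rayIntegrand j P R u β t) -
        ∫ t in Set.Ioi (0 : ℝ), rayIntegrand j P R u α t) := by
    intro α hα β hβ hαβ
    have iα := h.integrableOn_rayIntegrand hθ hφ hu hα
    have iβ := h.integrableOn_rayIntegrand hθ hφ hu hβ
    rw [← integral_sub iβ iα]
    change M * _ = _ * M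
    have e1 := (ContinuousLinearMap.mul ℝ (V →L[ℝ] V) M).integral_comp_comm (iβ.sub iα)
    have e2 := ((ContinuousLinearMap.mul ℝ (V →L[ℝ] V)).flip M).integral_comp_comm (iβ.sub iα)
    simp only [ContinuousLinearMap.mul_apply', ContinuousLinearMap.flip_apply, Pi.sub_apply]
      at e1 e2
    rw [← e1, ← e2]
    refine setIntegral_congr_fun measurableSet_Ioi fun t ht => ?_
    have hs := h.mem_cOuter_of_le hφ' (ray_ne_zero α ht) (h.ray_le hφ' hα ht)
    exact h.commute_rayIntegrand_sub hαβ (hu.map_conj _ (mul_exp_mem_cDoubleSector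
      (h.theta_mem hθ) (h.mem_angleSet hφ hα) ht)) (hP _ hs) (hR _ hs)
  -- The four rays form two conjugate pairs, ±φ and π ± φ, and the contour takes the difference over
  -- each.
  have c1 := key φ (by simp [contourAngles]) (-φ) (by simp [contourAngles]) (by
    rw [← Complex.exp_conj]; simp)
  have c2 := key (Real.pi + φ) (by simp [contourAngles]) (Real.pi - φ) (by simp [contourAngles]) (by
    rw [← Complex.exp_conj, ← Complex.exp_periodic (conj (((Real.pi + φ : ℝ) : ℂ) * I))]
    congr 1
    simp
    ring)
  refine Commute.smul_right ?_ _
  rw [add_sub_assoc]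
  exact c1.add_right c2

theorem isMultiplier_add (h : IsBisectorialFamily L D ω j P R)
    (hθ : θ ∈ Set.Ioo ω (Real.pi / 2)) (hφ : φ ∈ Set.Ioo ω θ) {r r' : ℂ → ℂ} {M M' : V →L[ℝ] V}
    (hr : IsMultiplier j P R θ φ r M) (hr' : IsMultiplier j P R θ φ r' M') :
    IsMultiplier j P R θ φ (fun z => r z + r' z) (M + M') := by
  intro f A hf
  obtain ⟨⟨f0, finf, hu, hA⟩, hc⟩ := hr f A hf
  obtain ⟨⟨g0, ginf, hv, hB⟩, hc'⟩ := hr' f A hf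
  refine ⟨?_, hc.add_left hc'⟩
  refine h.isValue_of_eq hθ hφ (f0 := f0 + g0) (finf := finf + ginf)
    (hu.add (h.theta_mem hθ) hv) (fun z _ => by push_cast; ring) ?_
  rw [h.contourCalculus_add hθ hφ hu hv, add_mul, hA, hB]
  module

/-- Splitting f into its constant, its multiple of 1 / (1 + z²) and its decaying part u leaves r u
and three multiples of z / (1 + z²), with or without a simple fraction. Their integrals are known,
and the rest is algebra with P and R. -/
theorem isMultiplier_simpleFrac (h : IsBisectorialFamily L D ω j P R)
    (hθ : θ ∈ Set.Ioo ω (Real.pi / 2)) (hφ : φ ∈ Set.Ioo ω θ) (hc : c ∈ cOuter θ) (a b : ℝ) :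
    IsMultiplier j P R θ φ (simpleFrac c a b) (a • P c + b • R c) := by
  have hθ0 := h.theta_mem hθ
  have hc' := h.cOuter_subset hθ hc
  have hI := I_mem_cOuter h.angle_mem
  have hI' := I_mem_cOuter hθ0
  have hc0 : c ≠ 0 := by rintro rfl; simp [cOuter] at hc
  have hn : ‖c‖ ^ 2 ≠ 0 := pow_ne_zero 2 (norm_ne_zero_iff.mpr hc0)
  rintro f A ⟨f0, finf, hu, hA⟩
  have hcP : ∀ s ∈ cOuter ω, Commute (a • P c + b • R c) (P s) := fun s hs =>
    ((show Commute (P c) (P s) from h.comm_PP hc' hs).smul_left a).add_left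
      ((show Commute (R c) (P s) from (h.comm_PR hs hc').symm).smul_left b)
  have hcR : ∀ s ∈ cOuter ω, Commute (a • P c + b • R c) (R s) := fun s hs =>
    ((show Commute (P c) (R s) from h.comm_PR hc' hs).smul_left a).add_left
      ((show Commute (R c) (R s) from h.comm_RR hc' hs).smul_left b)
  refine ⟨?_, ?_⟩
  swap
  · rw [hA]
    exact (((Commute.one_right _).smul_right _).add_right ((hcP I hI).smul_right _)).add_right
      (h.commute_contourCalculus hθ hφ hu hcP hcR)
  set u : ℂ → ℂ := fun z => f z - finf - (1 + z ^ 2)⁻¹ * (f0 - finf) with hu_def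
  have hfu : ∀ z, f z = finf + (1 + z ^ 2)⁻¹ * (f0 - finf) + u z := fun z => by
    rw [hu_def]; ring
  -- r0 is the value of r at zero; at infinity r vanishes. Up to the factor z / (1 + z²), (a1 - r0
  -- z) / Q_c is the rest of r / (1 + z²) after r0 / (1 + z²) is removed, and b + (a2 + b2 z) / Q_c
  -- is what remains of r - r / (1 + z²).
  set r0 : ℝ := a / ‖c‖ ^ 2 with hr0
  have hr0' : r0 * ‖c‖ ^ 2 = a := div_mul_cancel₀ _ hn
  set a1 : ℝ := b + 2 * c.re * r0
  set a2 : ℝ := -(b * ‖c‖ ^ 2)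
  set b2 : ℝ := a + 2 * c.re * b
  have hd := isDecaying_simpleFrac_I hθ0
  have d0 := hu.simpleFrac_mul hθ0 hc a b
  have d1 := (hd.simpleFrac_mul hθ0 hc a1 (-r0)).const_mul hθ0 f0
  have d2 := (hd.simpleFrac_mul hθ0 hc a2 b2).const_mul hθ0 finf
  have d3 := hd.const_mul hθ0 (finf * b)
  have hq : (c * conj c : ℂ) = (‖c‖ : ℂ) ^ 2 := Complex.mul_conj' c
  have hs := Complex.add_conj c
  refine h.isValue_of_eq hθ hφ (f0 := r0 * f0) (finf := 0)
    (((d0.add hθ0 d1).add hθ0 d2).add hθ0 d3) (fun z hz => ?_) ?_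
  · have n1 := mul_ne_zero (sub_ne_zero_of_mem hc hz) (sub_ne_zero_of_mem (conj_mem_cOuter hc) hz)
    have n2 := mul_ne_zero (sub_ne_zero_of_mem hI' hz)
      (sub_ne_zero_of_mem (conj_mem_cOuter hI') hz)
    have hQ : (z - c) * (z - conj c) = z ^ 2 - 2 * c.re * z + (‖c‖ : ℂ) ^ 2 := by
      push_cast at hs
      linear_combination hq - z * hs
    rw [hfu z]
    simp only [simpleFrac]
    rw [sub_I_mul] at n2 ⊢
    rw [hQ] at n1 ⊢
    have hr0c : (r0 : ℂ) * (‖c‖ : ℂ) ^ 2 = a := by exact_mod_cast hr0'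
    simp only [a1, a2, b2]
    push_cast
    rw [← hr0c]
    generalize hQ' : z ^ 2 - 2 * c.re * z + (‖c‖ : ℂ) ^ 2 = Q at n1
    have hN : (‖c‖ : ℂ) ^ 2 = Q - z ^ 2 + 2 * c.re * z := by linear_combination hQ'
    rw [hN]
    field_simp
    ring
  · rw [h.contourCalculus_add hθ hφ ((d0.add hθ0 d1).add hθ0 d2) d3,
      h.contourCalculus_add hθ hφ (d0.add hθ0 d1) d2, h.contourCalculus_add hθ hφ d0 d1,
      h.contourCalculus_const_mul, h.contourCalculus_const_mul, h.contourCalculus_const_mul,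
      h.contourCalculus_simpleFrac_mul hθ hφ hu hc, h.contourCalculus_simpleFrac_mul hθ hφ hd hc,
      h.contourCalculus_simpleFrac_mul hθ hφ hd hc, h.contourCalculus_simpleFrac_I hθ hφ, hA]
    have k1 := h.R_mul_R hc' hI
    have k2 := h.R_mul_R hI hc'
    have k3 := h.R_sub_R hI hc'
    rw [h.comm_RR hI hc', h.P_mul_R hI hc', h.comm_PP hI hc'] at k2
    rw [h.comm_RR hI hc', h.P_mul_R hI hc'] at k3
    have k4 : R I * P c = P c * R I := (h.comm_PR hc' hI).symm
    have k5 : R c * P I = P c * R I := (h.P_mul_R hc' hI).symm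
    rw [k4] at k2 k3
    simp only [Complex.I_re, Complex.norm_I, mul_zero, zero_smul, add_zero, one_pow, one_smul]
      at k2 k3
    simp only [add_mul, mul_add, mul_smul_comm, smul_mul_assoc, mul_one, k5]
    generalize P c * contourCalculus j P R φ u = y1
    generalize R c * contourCalculus j P R φ u = y2
    generalize P c * R I = y at *
    generalize P c * P I = w at *
    generalize R c * R I = z at *
    simp only [a1, a2, b2]
    rw [← hr0']
    -- P_I, P_c and R_c are expressed by R_I and the products P_c R_I, P_c P_I, R_c R_I, after which
    -- both sides are linear combinations of the same operators.
    have k6 : P I = z - (2 * c.re) • y + ‖c‖ ^ 2 • w := by rw [k1]; abel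
    have k7 : P c = z + w := by rw [k2]; abel
    have k8 : R c = R I + (2 * c.re) • z - ‖c‖ ^ 2 • y + y := by rw [← k3]; abel
    rw [k6, k7, k8]
    module

end IsBisectorialFamily

end

end HInfty
end

noncomputable section
namespace HInfty

open Polynomial
open Complex (I)
open scoped ComplexConjugate

/-! ### Rational functions -/

theorem monic_quadPoly (z : ℂ) : (quadPoly z).Monic := by
  unfold quadPoly; monicity!

theorem im_ne_zero_of_mem_cOuter {θ : ℝ} {z : ℂ} (hz : z ∈ cOuter θ) : z.im ≠ 0 := by
  intro h0
  have h1 : |z.re| < Real.cos θ * ‖z‖ := hz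
  have h2 : ‖z‖ = |z.re| := Complex.abs_re_eq_norm.mpr h0 |>.symm
  have h3 := mul_le_mul_of_nonneg_right (Real.cos_le_one θ) (norm_nonneg z)
  linarith

/-- Induction on real polynomials without zeros in a closed double sector. -/
theorem outerPoly_induction {θ : ℝ} {motive : ℝ[X] → Prop}
    (const : ∀ a : ℝ, a ≠ 0 → motive (C a))
    (mul : ∀ z ∈ cOuter θ, ∀ q : ℝ[X], q ≠ 0 → (∀ w : ℂ, aeval w q = 0 → w ∈ cOuter θ) →
      motive q → motive (q * quadPoly z))
    (q : ℝ[X]) (hq0 : q ≠ 0) (hq : ∀ w : ℂ, aeval w q = 0 → w ∈ cOuter θ) : motive q := by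
  induction hN : q.natDegree using Nat.strong_induction_on generalizing q with
  | _ N ih =>
    by_cases hdeg : q.natDegree = 0
    · rw [eq_C_of_natDegree_eq_zero hdeg] at hq0 ⊢
      exact const _ (by simpa using hq0)
    · have hdeg' : q.degree ≠ 0 := fun h => hdeg (natDegree_eq_of_degree_eq_some h)
      obtain ⟨z, hz⟩ := IsAlgClosed.exists_aeval_eq_zero ℂ q hdeg'
      have hzo := hq z hz
      obtain ⟨q', hq'⟩ : quadPoly z ∣ q :=
        -- A zero off the closed double sector is never real, so it splits off together with its
        -- conjugate.
        q.quadratic_dvd_of_aeval_eq_zero_im_ne_zero hz (im_ne_zero_of_mem_cOuter hzo)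
      rw [mul_comm] at hq'
      have hq'0 : q' ≠ 0 := by
        rintro rfl
        exact hq0 (by rw [hq', zero_mul])
      have hroots : ∀ w : ℂ, aeval w q' = 0 → w ∈ cOuter θ := fun w hw =>
        hq w (by rw [hq', map_mul, hw, zero_mul])
      have hd : q.natDegree = q'.natDegree + 2 := by
        rw [hq', natDegree_mul hq'0 (quadPoly_ne_zero z), natDegree_quadPoly]
      rw [hq']
      exact mul z hzo q' hq'0 hroots (ih q'.natDegree (by omega) q' hq'0 hroots rfl)

section

variable {V : Type*} [NormedAddCommGroup V] [NormedSpace ℝ V]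
variable {L : V →ₗ[ℝ] V} {D : Submodule ℝ V} {ω θ φ : ℝ} {j : V →L[ℝ] V} {P R : ℂ → V →L[ℝ] V}

namespace IsBisectorialFamily

theorem exists_isPolyInverse (h : IsBisectorialFamily L D ω j P R) (q : ℝ[X]) (hq0 : q ≠ 0)
    (hq : ∀ w : ℂ, aeval w q = 0 → w ∈ cOuter ω) : ∃ B, IsPolyInverse L D q B :=
  outerPoly_induction (motive := fun q => ∃ B, IsPolyInverse L D q B)
    (fun _ ha => ⟨_, IsPolyInverse.C ha⟩)
    (fun z hz _ _ _ ⟨_, hB⟩ => ⟨_, hB.mul (h.inv z hz)⟩) q hq0 hq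

variable [CompleteSpace V]

/-- Dividing p by Q_z with remainder a + b X gives p / (q Q_z) = (a + b X) / Q_z · 1 / q + (p div
Q_z) / q. The first product is covered by the simple fractions and the induction hypothesis, the
last term by the hypothesis alone, since its degree bound is preserved. -/
theorem exists_isMultiplier (h : IsBisectorialFamily L D ω j P R)
    (hθ : θ ∈ Set.Ioo ω (Real.pi / 2)) (hφ : φ ∈ Set.Ioo ω θ) (q : ℝ[X]) (hq0 : q ≠ 0)
    (hq : ∀ w : ℂ, aeval w q = 0 → w ∈ cOuter θ) :
    ∃ B, IsPolyInverse L D q B ∧ ∀ p : ℝ[X], p.natDegree ≤ q.natDegree →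
      ∃ M : V →L[ℝ] V, (∀ v, M v = aeval L p (B v)) ∧
        IsMultiplier j P R θ φ (fun z => aeval z p * (aeval z q)⁻¹) M := by
  refine outerPoly_induction (motive := fun q => ∃ B, IsPolyInverse L D q B ∧
    ∀ p : ℝ[X], p.natDegree ≤ q.natDegree → ∃ M : V →L[ℝ] V, (∀ v, M v = aeval L p (B v)) ∧
      IsMultiplier j P R θ φ (fun z => aeval z p * (aeval z q)⁻¹) M) ?_ ?_ q hq0 hq
  · intro a ha
    refine ⟨_, IsPolyInverse.C ha, fun p hp => ?_⟩
    rw [natDegree_C, Nat.le_zero] at hp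
    rw [eq_C_of_natDegree_eq_zero hp]
    refine ⟨(p.coeff 0 * a⁻¹) • 1, fun v => ?_,
      h.isMultiplier_congr hθ hφ (h.isMultiplier_const hθ hφ (p.coeff 0 * a⁻¹)) fun z _ => ?_⟩
    · rw [aeval_C, Module.algebraMap_end_apply]
      simp [smul_smul]
    · simp
  · rintro z hz q hq0 hq ⟨B, hB, hM⟩
    have hz' := h.cOuter_subset hθ hz
    have hP := h.inv z hz'
    refine ⟨P z * B, hB.mul hP, fun p hp => ?_⟩
    rw [natDegree_mul hq0 (quadPoly_ne_zero z), natDegree_quadPoly] at hp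
    have hmonic := monic_quadPoly z
    obtain ⟨M₁, hM₁, hm₁⟩ := hM (p /ₘ quadPoly z) (by
      rw [natDegree_divByMonic _ hmonic, natDegree_quadPoly]; omega)
    obtain ⟨M₂, hM₂, hm₂⟩ := hM 1 (by simp)
    have hrd : (p %ₘ quadPoly z).natDegree < 2 := by
      rw [← natDegree_quadPoly z]
      refine natDegree_modByMonic_lt p hmonic fun h1 => ?_
      have := natDegree_quadPoly z
      rw [h1] at this
      simp at this
    set a := (p %ₘ quadPoly z).coeff 0
    set b := (p %ₘ quadPoly z).coeff 1
    have hr : p %ₘ quadPoly z = C a + C b * X := by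
      rw [as_sum_range_C_mul_X_pow' _ hrd, Finset.sum_range_succ, Finset.sum_range_one]
      simp [a, b]
    have hp' : p = C a + C b * X + quadPoly z * (p /ₘ quadPoly z) := by
      rw [← hr, modByMonic_add_div]
    refine ⟨(a • P z + b • R z) * M₂ + M₁, fun v => ?_, ?_⟩
    · conv_rhs => rw [hp']
      rw [mul_comm (quadPoly z)]
      have e1 : M₂ v = B v := by rw [hM₂ v, map_one]; rfl
      have e2 : ((a • P z + b • R z) * M₂ + M₁) v =
          a • P z (M₂ v) + b • R z (M₂ v) + M₁ v := rfl
      rw [e2, e1, hM₁ v, h.R_apply z hz']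
      simp only [map_add, map_mul, aeval_C, aeval_X, LinearMap.add_apply, Module.End.mul_apply,
        Module.algebraMap_end_apply]
      change _ = a • P z (B v) + b • L (P z (B v)) +
        aeval L (p /ₘ quadPoly z) (aeval L (quadPoly z) (P z (B v)))
      rw [hP.right_inv]
    · refine h.isMultiplier_congr hθ hφ (h.isMultiplier_add hθ hφ
        (h.isMultiplier_mul hθ hφ (h.isMultiplier_simpleFrac hθ hφ hz a b) hm₂) hm₁)
        fun s hs => ?_
      have n1 : aeval s q ≠ 0 := fun h0 =>
        lt_asymm (show |s.re| < _ from hq s h0) (show _ < |s.re| from hs)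
      have n2 := mul_ne_zero (sub_ne_zero_of_mem hz hs)
        (sub_ne_zero_of_mem (conj_mem_cOuter hz) hs)
      conv_lhs => rw [hp']
      simp only [map_add, map_mul, aeval_C, aeval_X, map_one, simpleFrac, aeval_quadPoly,
        Complex.coe_algebraMap]
      field_simp
      rw [add_div, mul_div_cancel_left₀ _ n2]

end IsBisectorialFamily

end

/-! ### The family of a bisectorial operator -/

section

variable {n : ℕ} {E : Type*} [NormedAddCommGroup E] [NormedSpace ℝ E]
variable {T : CliffordModule n E →ₗ.[ℝ] CliffordModule n E} {ω : ℝ} {J : Cl n}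

/-- The operator `Q_z[T]⁻¹`. -/
def pseudoResolvent (T : CliffordModule n E →ₗ.[ℝ] CliffordModule n E) (z : ℂ) :
    CliffordModule n E →L[ℝ] CliffordModule n E :=
  toBounded (polyOp T (quadPoly z)).inverse

/-- The operator `T Q_z[T]⁻¹`. -/
def pseudoResolvent' (T : CliffordModule n E →ₗ.[ℝ] CliffordModule n E) (z : ℂ) :
    CliffordModule n E →L[ℝ] CliffordModule n E :=
  toBounded (pcomp T (polyOp T (quadPoly z)).inverse)

theorem Qop_slicePt (hJ : J ∈ unitSphere n) (z : ℂ) :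
    Qop (slicePt J z.re z.im) T = polyOp T (quadPoly z) := by
  rw [Qop, coeff_slicePt_empty hJ, norm_slicePt hJ, quadPoly]

theorem isPolyInverse_pseudoResolvent {L : CliffordModule n E →ₗ[ℝ] CliffordModule n E}
    (hL : ∀ u : T.domain, T u = L u) (hω : IsBisectorial T ω) (hJ : J ∈ unitSphere n) {z : ℂ}
    (hz : z ∈ cOuter ω) : IsPolyInverse L T.domain (quadPoly z) (pseudoResolvent T z) := by
  have hres : slicePt J z.re z.im ∈ resolventSetS T := by
    by_contra hn
    have h1 := closure_doubleSector_le hω.angle_mem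
      (hω.spectrum_subset ⟨slicePt_mem_paravectors hJ _ _, hn⟩)
    rw [norm_slicePt hJ, coeff_slicePt_empty hJ] at h1
    exact absurd (show |z.re| < _ from hz) (not_lt.mpr h1)
  obtain ⟨-, hi, B, hB, -⟩ := hres
  rw [Qop_slicePt hJ] at hi hB
  rw [pseudoResolvent, toBounded_eq hB]
  exact isPolyInverse_of_total hL (quadPoly_ne_zero z) hi hB

theorem linearPMap_eq_total {V : Type*} [NormedAddCommGroup V] [NormedSpace ℝ V] {A : V →ₗ.[ℝ] V}
    {B : V →L[ℝ] V} (h : ∀ v, (v, B v) ∈ A.graph) : total B = A := by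
  refine LinearPMap.eq_of_le_of_domain_eq (LinearPMap.le_of_le_graph ?_) ?_
  · rintro ⟨v, w⟩ hvw
    rw [mem_total_graph.mp hvw]
    exact h v
  · refine (eq_top_iff.mpr fun v _ => ?_).symm
    exact LinearPMap.mem_domain_of_mem_graph (h v)

variable [CompleteSpace E]

theorem total_pseudoResolvent' {L : CliffordModule n E →ₗ[ℝ] CliffordModule n E}
    (hL : ∀ u : T.domain, T u = L u) (hT : T.IsClosed) {z : ℂ}
    (hP : IsPolyInverse L T.domain (quadPoly z) (pseudoResolvent T z)) :
    total (pseudoResolvent' T z) = pcomp T (polyOp T (quadPoly z)).inverse ∧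
      ∀ v, pseudoResolvent' T z v = L (pseudoResolvent T z v) := by
  have hmem : ∀ v, pseudoResolvent T z v ∈ T.domain := fun v => by
    have := hP.mem v
    rw [natDegree_quadPoly] at this
    exact this 0 (by norm_num)
  obtain ⟨R, hR⟩ := exists_bounded_comp hL hT hmem
  have h1 : total R = pcomp T (polyOp T (quadPoly z)).inverse := by
    refine linearPMap_eq_total fun v => mem_pcomp_graph.mpr ⟨pseudoResolvent T z v, ?_, ?_⟩
    · rw [← hP.total_eq hL]
      exact mem_total_graph.mpr rfl
    · rw [hR]
      exact (LinearPMap.mem_graph_iff _).mpr ⟨⟨_, hmem v⟩, rfl, hL _⟩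
  have h2 : pseudoResolvent' T z = R := toBounded_eq h1
  rw [h2]
  exact ⟨h1, hR⟩

theorem resolventL_slicePt {L : CliffordModule n E →ₗ[ℝ] CliffordModule n E}
    (hL : ∀ u : T.domain, T u = L u) (hT : T.IsClosed) (hJ : J ∈ unitSphere n) {z : ℂ}
    (hP : IsPolyInverse L T.domain (quadPoly z) (pseudoResolvent T z)) :
    resolventL (slicePt J z.re z.im) T =
      leftResolvent (leftMul J) (pseudoResolvent T) (pseudoResolvent' T) z := by
  refine toBounded_eq ?_
  have h1 := hP.total_eq hL
  obtain ⟨h2, -⟩ := total_pseudoResolvent' hL hT hP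
  have hc : (leftMul (slicePt J z.re z.im).conj : CliffordModule n E →L[ℝ] _) =
      scalarOp (leftMul J) (conj z) := by
    rw [conj_slicePt hJ, leftMul_slicePt, scalarOp]
    simp only [Complex.conj_re, Complex.conj_im]
    rfl
  rw [Qop_slicePt hJ, ← h2, ← h1, hc]
  refine linearPMap_eq_total fun v => (LinearPMap.mem_graph_iff _).mpr
    ⟨⟨v, ⟨trivial, trivial⟩, trivial⟩, rfl, rfl⟩

theorem isBisectorialFamily {L : CliffordModule n E →ₗ[ℝ] CliffordModule n E}
    (hL : ∀ u : T.domain, T u = L u) (hT : T.IsClosed) (hω : IsBisectorial T ω)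
    (hJ : J ∈ unitSphere n) :
    IsBisectorialFamily L T.domain ω (leftMul J) (pseudoResolvent T) (pseudoResolvent' T) := by
  have hinv : ∀ z ∈ cOuter ω, _ := fun z hz => isPolyInverse_pseudoResolvent hL hω hJ hz
  refine ⟨hω.angle_mem, leftMul_comp_self hJ, hinv,
    fun z hz => (total_pseudoResolvent' hL hT (hinv z hz)).2,
    fun z => by rw [pseudoResolvent, pseudoResolvent, quadPoly_conj],
    fun z => by rw [pseudoResolvent', pseudoResolvent', quadPoly_conj], fun φ hφ => ?_⟩
  obtain ⟨C, hC0, hC⟩ := hω.resolvent_bound φ hφ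
  refine ⟨C, hC0, fun z hz0 hz => ?_⟩
  have hφ0 : φ ∈ Set.Ioo 0 (Real.pi / 2) := ⟨hω.angle_mem.1.trans hφ.1, hφ.2⟩
  have hcos : Real.cos φ < Real.cos ω :=
    Real.cos_lt_cos_of_nonneg_of_le_pi hω.angle_mem.1.le (by linarith [hφ.2, Real.pi_pos]) hφ.1
  have hzo : z ∈ cOuter ω := hz.trans_lt (mul_lt_mul_of_pos_right hcos (norm_pos_iff.mpr hz0))
  rw [← resolventL_slicePt hL hT hJ (hinv z hzo), ← norm_slicePt hJ z]
  refine hC _ (slicePt_mem_paravectors hJ _ _) (fun hmem => ?_) fun h0 => ?_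
  · exact absurd ((slicePt_mem_doubleSector hJ hφ0 z).mp hmem) (not_lt.mpr hz)
  · have := norm_slicePt hJ z
    rw [h0, norm_zero] at this
    exact hz0 (norm_eq_zero.mp this.symm)

end

end HInfty
end

noncomputable section
namespace HInfty

open Polynomial
open Complex (I)
open MeasureTheory
open scoped ComplexConjugate

/-! ### Intrinsic functions as functions of a complex variable -/

variable {n : ℕ} {θ : ℝ} {J : Cl n}

/-- The intrinsic function `f` on the double sector is given by `h` on each of the planes `ℂ_J`. -/
def Represents (n : ℕ) (θ : ℝ) (f : Cl n → Cl n) (h : ℂ → ℂ) : Prop :=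
  ∀ J, ∀ hJ : J ∈ unitSphere n, ∀ z ∈ cDoubleSector θ, f (planeEmb hJ z) = planeEmb hJ (h z)

/-- Holomorphic functions on a double sector that are real on the real axis. -/
structure IsSymmHol (θ : ℝ) (h : ℂ → ℂ) : Prop where
  diff : ∀ z ∈ cDoubleSector θ, DifferentiableAt ℂ h z
  map_conj : ∀ z ∈ cDoubleSector θ, h (conj z) = conj (h z)

theorem one_add_sq_ne_zero (hθ : θ ∈ Set.Ioo 0 (Real.pi / 2)) {z : ℂ}
    (hz : z ∈ cDoubleSector θ) : 1 + z ^ 2 ≠ 0 := by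
  have hI := I_mem_cOuter hθ
  rw [← sub_I_mul]
  exact mul_ne_zero (sub_ne_zero_of_mem hI hz) (sub_ne_zero_of_mem (conj_mem_cOuter hI) hz)

namespace IsSymmHol

variable {g h : ℂ → ℂ}

theorem add (hg : IsSymmHol θ g) (hh : IsSymmHol θ h) : IsSymmHol θ fun z => g z + h z :=
  ⟨fun z hz => (hg.diff z hz).add (hh.diff z hz), fun z hz => by
    rw [hg.map_conj z hz, hh.map_conj z hz, map_add]⟩

theorem sub (hg : IsSymmHol θ g) (hh : IsSymmHol θ h) : IsSymmHol θ fun z => g z - h z :=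
  ⟨fun z hz => (hg.diff z hz).sub (hh.diff z hz), fun z hz => by
    rw [hg.map_conj z hz, hh.map_conj z hz, map_sub]⟩

theorem mul (hg : IsSymmHol θ g) (hh : IsSymmHol θ h) : IsSymmHol θ fun z => g z * h z :=
  ⟨fun z hz => (hg.diff z hz).mul (hh.diff z hz), fun z hz => by
    rw [hg.map_conj z hz, hh.map_conj z hz, map_mul]⟩

theorem const (r : ℝ) : IsSymmHol θ fun _ => (r : ℂ) :=
  ⟨fun _ _ => differentiableAt_const _, fun _ _ => (Complex.conj_ofReal r).symm⟩

theorem inv_one_add_sq (hθ : θ ∈ Set.Ioo 0 (Real.pi / 2)) :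
    IsSymmHol θ fun z => (1 + z ^ 2)⁻¹ :=
  ⟨fun _ hz => DifferentiableAt.inv (by fun_prop) (one_add_sq_ne_zero hθ hz), by simp⟩

theorem ratio {p q : ℝ[X]} (hq : ∀ z ∈ cDoubleSector θ, aeval z q ≠ 0) :
    IsSymmHol θ fun z => aeval z p * (aeval z q)⁻¹ := by
  refine ⟨fun z hz => ?_, fun z _ => ?_⟩
  · exact (p.differentiable_aeval z).mul ((q.differentiable_aeval z).inv (hq z hz))
  · have hc : ∀ r : ℝ[X], aeval (conj z) r = conj (aeval z r) := fun r =>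
      aeval_algHom_apply Complex.conjAe.toAlgHom z r
    rw [hc, hc, map_mul, map_inv₀]

end IsSymmHol

theorem IsDecaying.isSymmHol {u : ℂ → ℂ} (hu : IsDecaying θ u) : IsSymmHol θ u :=
  ⟨hu.diff, hu.map_conj⟩

theorem isOpen_sliceDomain (hn : 1 ≤ n) (hθ : θ ∈ Set.Ioo 0 (Real.pi / 2)) :
    IsOpen (sliceDomain (doubleSector n θ)) := by
  have h : sliceDomain (doubleSector n θ) =
      Complex.equivRealProdCLM.symm ⁻¹' cDoubleSector θ := by
    ext ⟨x, y⟩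
    exact sliceDomain_doubleSector hn hθ ⟨x, y⟩
  rw [h]
  exact (isOpen_cDoubleSector θ).preimage Complex.equivRealProdCLM.symm.continuous

/-- For real components the equations on f₀ and f₁ are the Cauchy–Riemann equations of f₀ + i f₁,
and the even-odd conditions are symmetry under conjugation. -/
theorem IsIntrinsic.exists_represents (hn : 1 ≤ n) (hθ : θ ∈ Set.Ioo 0 (Real.pi / 2))
    {f : Cl n → Cl n} (hf : IsIntrinsic (doubleSector n θ) f) :
    ∃ h, IsSymmHol θ h ∧ Represents n θ f h := by
  obtain ⟨f₀, f₁, hr, hreal⟩ := hf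
  have hmem : ∀ {z : ℂ}, z ∈ cDoubleSector θ → (z.re, z.im) ∈ sliceDomain (doubleSector n θ) :=
    fun {z} hz => (sliceDomain_doubleSector hn hθ z).mpr hz
  have hopen := isOpen_sliceDomain hn hθ
  refine ⟨fun z => ⟨(f₀ (z.re, z.im)).coeff ∅, (f₁ (z.re, z.im)).coeff ∅⟩,
    ⟨fun z hz => ?_, fun z hz => ?_⟩, fun J hJ z hz => ?_⟩
  · let e := Complex.equivRealProdCLM
    have d0 : HasFDerivAt f₀ (fderiv ℝ f₀ (e z)) (e z) :=
      ((hr.contDiff_fst.differentiableOn one_ne_zero _ (hmem hz)).differentiableAt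
        (hopen.mem_nhds (hmem hz))).hasFDerivAt
    have d1 : HasFDerivAt f₁ (fderiv ℝ f₁ (e z)) (e z) :=
      ((hr.contDiff_snd.differentiableOn one_ne_zero _ (hmem hz)).differentiableAt
        (hopen.mem_nhds (hmem hz))).hasFDerivAt
    have c0 := ((Cl.coeffCLM (∅ : Finset (Fin n))).hasFDerivAt.comp z (d0.comp z e.hasFDerivAt))
    have c1 := ((Cl.coeffCLM (∅ : Finset (Fin n))).hasFDerivAt.comp z (d1.comp z e.hasFDerivAt))
    have hfd := e.symm.hasFDerivAt.comp z (c0.prodMk c1)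
    rw [differentiableAt_complex_iff_differentiableAt_real]
    refine ⟨hfd.differentiableAt, ?_⟩
    have hE := hfd.fderiv
    have hE' : fderiv ℝ (fun z : ℂ => (⟨(f₀ (z.re, z.im)).coeff ∅, (f₁ (z.re, z.im)).coeff ∅⟩ : ℂ)) z
      = _ := hE
    rw [hE']
    have r1 := hr.cauchyRiemann_fst _ (hmem hz)
    have r2 := hr.cauchyRiemann_snd _ (hmem hz)
    have eI : e I = (0, 1) := rfl
    have e1 : e 1 = (1, 0) := rfl
    have ez : e z = (z.re, z.im) := rfl
    have er : ∀ p, (e.symm p).re = p.1 := fun _ => rfl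
    have ei : ∀ p, (e.symm p).im = p.2 := fun _ => rfl
    apply Complex.ext
    · simp [Cl.coeffCLM_apply, eI, e1, ez, er, ei, r2, Cl.coeff_neg]
    · simp [Cl.coeffCLM_apply, eI, e1, ez, er, ei, r1]
  · have h0 := hr.even _ (hmem hz)
    have h1 := hr.odd _ (hmem hz)
    apply Complex.ext <;> simp [h0, h1, Cl.coeff_neg]
  · obtain ⟨⟨a, ha⟩, ⟨b, hb⟩⟩ := hreal _ (hmem hz)
    have c0 : (f₀ (z.re, z.im)).coeff ∅ = a := by rw [← ha, Cl.coeff_algebraMap_empty]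
    have c1 : (f₁ (z.re, z.im)).coeff ∅ = b := by rw [← hb, Cl.coeff_algebraMap_empty]
    rw [planeEmb_apply, planeEmb_apply, hr.rep _ (hmem hz) J hJ]
    dsimp only
    rw [c0, c1, ← ha, ← hb, slicePt,
      Cl.algebraMap_eq, Cl.algebraMap_eq, mul_smul_comm, mul_one]

theorem Represents.isIntrinsic (hn : 1 ≤ n) (hθ : θ ∈ Set.Ioo 0 (Real.pi / 2))
    {f : Cl n → Cl n} {h : ℂ → ℂ} (hf : Represents n θ f h) (hh : IsSymmHol θ h) :
    IsIntrinsic (doubleSector n θ) f := by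
  let e := Complex.equivRealProdCLM
  let A : ℝ →L[ℝ] Cl n := ContinuousLinearMap.toSpanSingleton ℝ (1 : Cl n)
  have hA : ∀ r, A r = algebraMap ℝ (Cl n) r := fun r => by
    rw [Cl.algebraMap_eq]; rfl
  have hmem : ∀ {p : ℝ × ℝ}, p ∈ sliceDomain (doubleSector n θ) → e.symm p ∈ cDoubleSector θ :=
    fun {p} hp => (sliceDomain_doubleSector hn hθ (e.symm p)).mp hp
  have hC : ContDiffOn ℝ 1 h (cDoubleSector θ) :=
    ((DifferentiableOn.contDiffOn (fun z hz => (hh.diff z hz).differentiableWithinAt)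
      (isOpen_cDoubleSector θ)).restrict_scalars ℝ)
  have hCe : ContDiffOn ℝ 1 (fun p => h (e.symm p)) (sliceDomain (doubleSector n θ)) :=
    hC.comp e.symm.contDiff.contDiffOn fun p hp => hmem hp
  have hD : ∀ p ∈ sliceDomain (doubleSector n θ), ∀ B : ℂ →L[ℝ] Cl n, ∀ v,
      fderiv ℝ (fun p => B (h (e.symm p))) p v = B (deriv h (e.symm p) * e.symm v) := by
    intro p hp B v
    have d := (hh.diff _ (hmem hp)).hasDerivAt.hasFDerivAt.restrictScalars ℝ
    have := (B.hasFDerivAt.comp p (d.comp p e.symm.hasFDerivAt)).fderiv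
    have h2 : fderiv ℝ (fun p => B (h (e.symm p))) p = _ := this
    rw [h2]
    simp [mul_comm]
  have s1 : e.symm (1, 0) = 1 := rfl
  have s2 : e.symm (0, 1) = I := rfl
  refine ⟨fun p => A (Complex.reCLM (h (e.symm p))), fun p => A (Complex.imCLM (h (e.symm p))),
    ⟨?_, ?_, fun p hp J hJ => ?_, fun p hp => ?_, fun p hp => ?_, fun p hp => ?_, fun p hp => ?_⟩,
    fun p _ => ⟨⟨_, (hA _).symm⟩, ⟨_, (hA _).symm⟩⟩⟩
  · exact (A.comp Complex.reCLM).contDiff.comp_contDiffOn hCe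
  · exact (A.comp Complex.imCLM).contDiff.comp_contDiffOn hCe
  · have h1 := hf J hJ _ (hmem hp)
    rw [planeEmb_apply, planeEmb_apply] at h1
    refine Eq.trans h1 ?_
    rw [hA, hA, slicePt, Cl.algebraMap_eq, Cl.algebraMap_eq, mul_smul_comm, mul_one]
    rfl
  · have h1 : e.symm (p.1, -p.2) = conj (e.symm p) := rfl
    rw [h1, hh.map_conj _ (hmem hp)]
    simp
  · have h1 : e.symm (p.1, -p.2) = conj (e.symm p) := rfl
    rw [h1, hh.map_conj _ (hmem hp)]
    simp
  · have k1 := hD p hp (A.comp Complex.reCLM) (1, 0)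
    have k2 := hD p hp (A.comp Complex.imCLM) (0, 1)
    rw [s1] at k1
    rw [s2] at k2
    refine k1.trans (Eq.trans ?_ k2.symm)
    simp
  · have k1 := hD p hp (A.comp Complex.reCLM) (0, 1)
    have k2 := hD p hp (A.comp Complex.imCLM) (1, 0)
    rw [s2] at k1
    rw [s1] at k2
    refine k1.trans (Eq.trans ?_ (congrArg Neg.neg k2.symm))
    simp

theorem exists_planeEmb_of_mem (hθ : θ ∈ Set.Ioo 0 (Real.pi / 2)) {s : Cl n}
    (hs : s ∈ doubleSector n θ) :
    ∃ J, ∃ hJ : J ∈ unitSphere n, ∃ z ∈ cDoubleSector θ, s = planeEmb hJ z := by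
  obtain ⟨t, ht, J, hJ, α, hα, rfl⟩ := hs
  exact ⟨J, hJ, _, mul_exp_mem_cDoubleSector hθ hα ht, polarPt_eq hJ t α⟩

theorem planeEmb_mem_doubleSector (hθ : θ ∈ Set.Ioo 0 (Real.pi / 2)) (hJ : J ∈ unitSphere n)
    {z : ℂ} (hz : z ∈ cDoubleSector θ) : planeEmb hJ z ∈ doubleSector n θ := by
  rw [planeEmb_apply]
  exact (slicePt_mem_doubleSector hJ hθ z).mpr hz

theorem Represents.isDecaying (hθ : θ ∈ Set.Ioo 0 (Real.pi / 2)) (hn : 1 ≤ n)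
    {f : Cl n → Cl n} {u : ℂ → ℂ} (hf : Represents n θ f u) (hu : IsSymmHol θ u)
    (hd : HasDecay θ f) : IsDecaying θ u := by
  obtain ⟨J, hJ⟩ := unitSphere_nonempty hn
  obtain ⟨⟨C, hC⟩, hi⟩ := hd
  refine ⟨hu.diff, hu.map_conj, ⟨C, fun z hz => ?_⟩, fun α hα => ?_⟩
  · rw [← norm_planeEmb hJ, ← hf J hJ z hz]
    exact hC _ (planeEmb_mem_doubleSector hθ hJ hz)
  · refine (hi J hJ α hα).congr_fun (fun t ht => ?_) measurableSet_Ioi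
    simp only
    rw [polarPt_eq hJ, hf J hJ _ (mul_exp_mem_cDoubleSector hθ hα ht), norm_planeEmb]

theorem Represents.hasDecay (hθ : θ ∈ Set.Ioo 0 (Real.pi / 2))
    {f : Cl n → Cl n} {u : ℂ → ℂ} (hf : Represents n θ f u) (hu : IsDecaying θ u) :
    HasDecay θ f := by
  obtain ⟨C, hC⟩ := hu.bdd
  refine ⟨⟨C, fun s hs => ?_⟩, fun J hJ α hα => ?_⟩
  · obtain ⟨J, hJ, z, hz, rfl⟩ := exists_planeEmb_of_mem hθ hs
    rw [hf J hJ z hz, norm_planeEmb]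
    exact hC z hz
  · refine (hu.integrable α hα).congr_fun (fun t ht => ?_) measurableSet_Ioi
    simp only
    rw [polarPt_eq hJ, hf J hJ _ (mul_exp_mem_cDoubleSector hθ hα ht), norm_planeEmb]

theorem inverse_one_add_sq_planeEmb (hJ : J ∈ unitSphere n) (z : ℂ) :
    Ring.inverse (1 + planeEmb hJ z ^ 2) = planeEmb hJ (1 + z ^ 2)⁻¹ := by
  rw [← inverse_planeEmb hJ, map_add, map_one, map_pow]

theorem planeEmb_ofReal (hJ : J ∈ unitSphere n) (r : ℝ) :
    planeEmb hJ r = algebraMap ℝ (Cl n) r := (planeEmb hJ).commutes r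

theorem represents_ratFun (p q : ℝ[X]) :
    Represents n θ (ratFun n p q) fun z => aeval z p * (aeval z q)⁻¹ := fun J hJ z _ => by
  rw [ratFun, aeval_planeEmb, aeval_planeEmb, inverse_planeEmb, map_mul]

theorem Represents.mul {f g : Cl n → Cl n} {h k : ℂ → ℂ} (hf : Represents n θ f h)
    (hg : Represents n θ g k) : Represents n θ (fun s => f s * g s) fun z => h z * k z :=
  fun J hJ z hz => by
    change f _ * g _ = _
    rw [hf J hJ z hz, hg J hJ z hz, map_mul]

/-- The part of `f` that remains after splitting off the values at zero and infinity. -/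
theorem Represents.remainder {f : Cl n → Cl n} {h : ℂ → ℂ} (hf : Represents n θ f h) (a b : ℝ) :
    Represents n θ (fun s => f s - algebraMap ℝ (Cl n) b -
      Ring.inverse (1 + s ^ 2) * (algebraMap ℝ (Cl n) a - algebraMap ℝ (Cl n) b))
      fun z => h z - b - (1 + z ^ 2)⁻¹ * (a - b) := fun J hJ z hz => by
  simp only
  rw [hf J hJ z hz, inverse_one_add_sq_planeEmb, ← planeEmb_ofReal hJ, ← planeEmb_ofReal hJ,
    map_sub, map_sub, map_mul, map_sub]

theorem IsNBnd.exists_represents (hn : 1 ≤ n) (hθ : θ ∈ Set.Ioo 0 (Real.pi / 2))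
    {f : Cl n → Cl n} (hf : IsNBnd θ f) : ∃ h, IsSymmHol θ h ∧ Represents n θ f h := by
  obtain ⟨a, b, gt, ⟨hi, -⟩, -, hd⟩ := hf
  obtain ⟨u, hu, hr⟩ := hi.exists_represents hn hθ
  refine ⟨fun z => b + (1 + z ^ 2)⁻¹ * ((a : ℂ) - b) + u z,
    ((IsSymmHol.const b).add ((IsSymmHol.inv_one_add_sq hθ).mul
      ((IsSymmHol.const a).sub (IsSymmHol.const b)))).add hu, fun J hJ z hz => ?_⟩
  rw [hd _ (planeEmb_mem_doubleSector hθ hJ hz), inverse_one_add_sq_planeEmb,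
    ← planeEmb_ofReal hJ, ← planeEmb_ofReal hJ, hr J hJ z hz, map_add, map_add, map_mul, map_sub]

theorem IsNBnd.isSHBnd {f : Cl n → Cl n} (hf : IsNBnd θ f) : IsSHBnd θ f := by
  obtain ⟨a, b, gt, -, hd⟩ := hf
  exact ⟨(_, _, gt), hd⟩

/-! ### Comparison of the Clifford calculus with its complex form -/

section Calculus

variable {E : Type*} [NormedAddCommGroup E] [NormedSpace ℝ E]
variable {T : CliffordModule n E →ₗ.[ℝ] CliffordModule n E} {ω φ : ℝ}

/-- The values of the complex form of the calculus of `T`. -/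
abbrev IsCalculusValue (T : CliffordModule n E →ₗ.[ℝ] CliffordModule n E) (J : Cl n) (θ φ : ℝ)
    (h : ℂ → ℂ) (A : CliffordModule n E →L[ℝ] CliffordModule n E) : Prop :=
  IsValue (leftMul J) (pseudoResolvent T) (pseudoResolvent' T) θ φ h A

theorem IsCalculusValue.isNBnd (hn : 1 ≤ n) (hθ : θ ∈ Set.Ioo 0 (Real.pi / 2))
    {f : Cl n → Cl n} {h : ℂ → ℂ} {A : CliffordModule n E →L[ℝ] CliffordModule n E}
    (hA : IsCalculusValue T J θ φ h A) (hf : Represents n θ f h) : IsNBnd θ f := by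
  obtain ⟨a, b, hu, -⟩ := hA
  have hr := hf.remainder a b
  have hi := hr.isIntrinsic hn hθ hu.isSymmHol
  have hd := hr.hasDecay hθ hu
  refine ⟨a, b, _, ⟨hi, hd⟩, ⟨?_, hd⟩, fun s _ => by simp⟩
  obtain ⟨f₀, f₁, h1, -⟩ := hi
  exact ⟨f₀, f₁, h1⟩

theorem zero_mem_angleSet (hθ : θ ∈ Set.Ioo 0 (Real.pi / 2)) : (0 : ℝ) ∈ angleSet θ :=
  Or.inl ⟨by linarith [hθ.1], hθ.1⟩

theorem ofReal_mem_cDoubleSector (hθ : θ ∈ Set.Ioo 0 (Real.pi / 2)) {t : ℝ} (ht : 0 < t) :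
    (t : ℂ) ∈ cDoubleSector θ := by
  simpa using mul_exp_mem_cDoubleSector hθ (zero_mem_angleSet hθ) ht

/-- The values at zero and infinity of a function that is intrinsic are real. -/
theorem IsBndDecomp.values_real (hn : 1 ≤ n) (hθ : θ ∈ Set.Ioo 0 (Real.pi / 2))
    {f ft : Cl n → Cl n} {a b : Cl n} {h : ℂ → ℂ} (hd : IsBndDecomp θ f a b ft)
    (hf : Represents n θ f h) (hh : IsSymmHol θ h) :
    a = algebraMap ℝ (Cl n) (a.coeff ∅) ∧ b = algebraMap ℝ (Cl n) (b.coeff ∅) := by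
  obtain ⟨J, hJ⟩ := unitSphere_nonempty hn
  -- On the positive axis f is real, so its coefficient at A vanishes. Hence b_A + (a - b)_A / (1 +
  -- t²) is minus a coefficient of the decaying part, and integrable for dt / t.
  have key : ∀ A, A ≠ ∅ → b.coeff A = 0 ∧ (a - b).coeff A = 0 := by
    intro A hA
    refine eq_zero_of_integrableOn_const_add (Integrable.mono'
      (hd.1.2.2 J hJ 0 (zero_mem_angleSet hθ)) ?_ ?_)
    · refine Measurable.aestronglyMeasurable ?_
      fun_prop
    · filter_upwards [ae_restrict_mem measurableSet_Ioi] with t ht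
      have ht : 0 < t := ht
      have hm := ofReal_mem_cDoubleSector hθ ht
      have hp : polarPt J t 0 = planeEmb hJ t := by rw [polarPt_eq hJ]; simp
      have e1 := hd.2 _ (planeEmb_mem_doubleSector hθ hJ hm)
      have him : (h t).im = 0 := by
        have := hh.map_conj _ hm
        rw [Complex.conj_ofReal] at this
        exact Complex.conj_eq_iff_im.mp this.symm
      have e2 : h t = ((h t).re : ℝ) := Complex.ext (by simp) (by simp [him])
      have e3 : (1 + (t : ℂ) ^ 2)⁻¹ = (((1 + t ^ 2)⁻¹ : ℝ) : ℂ) := by push_cast; rfl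
      rw [hf J hJ _ hm, inverse_one_add_sq_planeEmb, e2, e3, planeEmb_ofReal, planeEmb_ofReal,
        ← Algebra.smul_def] at e1
      have e4 := congrArg (fun s => Cl.coeff s A) e1
      simp only [Cl.coeff_add, Cl.coeff_smul, Cl.coeff_algebraMap_of_ne hA] at e4
      rw [Real.norm_of_nonneg (by positivity), hp]
      refine div_le_div_of_nonneg_right ?_ ht.le
      rw [show b.coeff A + (1 + t ^ 2)⁻¹ * (a - b).coeff A = -(ft (planeEmb hJ t)).coeff A by
        linarith, abs_neg]
      exact Cl.abs_coeff_le_norm _ _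
  have hb : ∀ A, A ≠ ∅ → b.coeff A = 0 := fun A hA => (key A hA).1
  refine ⟨Cl.eq_algebraMap_of_coeff fun A hA => ?_, Cl.eq_algebraMap_of_coeff hb⟩
  have := (key A hA).2
  rw [Cl.coeff_sub, hb A hA] at this
  linarith

variable [CompleteSpace E]

theorem omegaCalculus_eq {L : CliffordModule n E →ₗ[ℝ] CliffordModule n E}
    (hL : ∀ u : T.domain, T u = L u) (hT : T.IsClosed) (hω : IsBisectorial T ω)
    (hθ : θ ∈ Set.Ioo ω (Real.pi / 2)) (hφ : φ ∈ Set.Ioo ω θ) (hJ : J ∈ unitSphere n)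
    {f : Cl n → Cl n} {u : ℂ → ℂ} (hf : Represents n θ f u) :
    omegaCalculus T φ J f =
      contourCalculus (leftMul J) (pseudoResolvent T) (pseudoResolvent' T) φ u := by
  have h := isBisectorialFamily hL hT hω hJ
  have hθ0 := h.theta_mem hθ
  have hφ' := IsBisectorialFamily.phi_mem hθ hφ
  have key : ∀ α ∈ contourAngles φ, rayIntegral T J f α = ∫ t in Set.Ioi (0 : ℝ),
      rayIntegrand (leftMul J) (pseudoResolvent T) (pseudoResolvent' T) u α t := by
    intro α hα
    refine setIntegral_congr_fun measurableSet_Ioi fun t ht => ?_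
    have hz := h.mem_cOuter_of_le hφ' (IsBisectorialFamily.ray_ne_zero α ht) (h.ray_le hφ' hα ht)
    have hz' := mul_exp_mem_cDoubleSector hθ0 (h.mem_angleSet hφ hα) ht
    have e1 : polarPt J t α = planeEmb hJ (t * Complex.exp (α * I)) := polarPt_eq hJ t α
    have e2 : polarPt J 1 α = planeEmb hJ (Complex.exp (α * I)) := by
      rw [polarPt_eq hJ]; simp
    have e3 : J = planeEmb hJ I := by
      rw [planeEmb_apply, slicePt]; simp
    have e4 : polarPt J 1 α * -J * f (polarPt J t α) =
        planeEmb hJ (Complex.exp (α * I) * -I * u (t * Complex.exp (α * I))) := by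
      rw [e1, e2, hf J hJ _ hz', map_mul, map_mul, map_neg, ← e3]
    simp only
    rw [e4, e1, planeEmb_apply, planeEmb_apply,
      resolventL_slicePt hL hT hJ (h.inv _ hz), leftMul_slicePt]
    rfl
  rw [omegaCalculus, contourCalculus, key _ (by simp [contourAngles]),
    key _ (by simp [contourAngles]), key _ (by simp [contourAngles]),
    key _ (by simp [contourAngles])]

/-- The decomposition chosen in `extendedCalculus` only has Clifford-valued data. For intrinsic f
its values at zero and infinity are real, so its decaying part is again intrinsic and the complex
form applies. -/
theorem isCalculusValue_extendedCalculus (hn : 1 ≤ n)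
    {L : CliffordModule n E →ₗ[ℝ] CliffordModule n E}
    (hL : ∀ u : T.domain, T u = L u) (hT : T.IsClosed) (hω : IsBisectorial T ω)
    (hθ : θ ∈ Set.Ioo ω (Real.pi / 2)) (hφ : φ ∈ Set.Ioo ω θ) (hJ : J ∈ unitSphere n)
    {f : Cl n → Cl n} {h : ℂ → ℂ} (hf : Represents n θ f h) (hh : IsSymmHol θ h)
    (hs : IsSHBnd θ f) : IsCalculusValue T J θ φ h (extendedCalculus T θ φ J f) := by
  have hfam := isBisectorialFamily hL hT hω hJ
  have hθ0 := hfam.theta_mem hθ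
  rw [extendedCalculus, dif_pos hs]
  have hd := hs.choose_spec
  set d := hs.choose
  obtain ⟨ha, hb⟩ := hd.values_real hn hθ0 hf hh
  set a := d.1.coeff ∅
  set b := d.2.1.coeff ∅
  have hr := hf.remainder a b
  rw [← ha, ← hb] at hr
  have hft : Represents n θ d.2.2 fun z => h z - b - (1 + z ^ 2)⁻¹ * (a - b) := by
    intro K hK z hz
    rw [← hr K hK z hz]
    beta_reduce
    rw [hd.2 _ (planeEmb_mem_doubleSector hθ0 hK hz)]
    abel
  have hu : IsSymmHol θ fun z => h z - b - (1 + z ^ 2)⁻¹ * ((a : ℂ) - b) :=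
    (hh.sub (IsSymmHol.const b)).sub ((IsSymmHol.inv_one_add_sq hθ0).mul
      ((IsSymmHol.const a).sub (IsSymmHol.const b)))
  refine ⟨a, b, hft.isDecaying hθ0 hn hu hd.1.2, ?_⟩
  rw [omegaCalculus_eq hL hT hω hθ hφ hJ hft]
  congr 1
  rw [ha, hb, ← map_sub, leftMul_algebraMap, leftMul_algebraMap, ← quadPoly_I]
  refine ContinuousLinearMap.ext fun v => ?_
  simp [pseudoResolvent]

end Calculus

end HInfty
end

noncomputable section
namespace HInfty

open Polynomial
open Complex (I)
open scoped ComplexConjugate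

/-! ### Rational functions of the operator -/

section

variable {V : Type*} [NormedAddCommGroup V] [NormedSpace ℝ V]
variable {T : V →ₗ.[ℝ] V} {L : V →ₗ[ℝ] V}

theorem IsPolyInverse.apply_injective {D : Submodule ℝ V} {q : ℝ[X]} {B : V →L[ℝ] V}
    (h : IsPolyInverse L D q B) : Function.Injective B := fun v w hvw => by
  rw [← h.right_inv v, hvw, h.right_inv]

/-- After smoothing by `B = q[T]⁻¹` with `deg p ≤ deg q`, the graph of `p[T]` is recovered. -/
theorem IsPolyInverse.aeval_apply_eq_iff {D : Submodule ℝ V} {p q : ℝ[X]} {B : V →L[ℝ] V}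
    (h : IsPolyInverse L D q B) (hpq : p.natDegree ≤ q.natDegree) {u w : V} :
    aeval L p (B u) = B w ↔ u ∈ powDomain L D p.natDegree ∧ aeval L p u = w := by
  constructor
  · intro he
    have hu : u ∈ powDomain L D p.natDegree := by
      -- The zero polynomial has `natDegree` 0, so its domain is everything and no bootstrap is
      -- needed.
      by_cases hp : p = 0
      · subst hp
        exact fun k hk => absurd hk (by simp)
      · have h1 : B u ∈ powDomain L D (p.natDegree + q.natDegree) :=
          mem_powDomain_of_aeval hp (powDomain_mono hpq (h.mem u)) (he ▸ h.mem w)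
        rw [add_comm] at h1
        rw [← h.right_inv u]
        exact aeval_mem_powDomain le_rfl h1
    exact ⟨hu, h.apply_injective (by rw [h.map_aeval_comm hu, he])⟩
  · rintro ⟨hu, rfl⟩
    exact (h.map_aeval_comm hu).symm

/-- Applying the injective B₁ to A' v = A w and moving B₁ and M past A reduces the equation to M v =
B₁ w. The smoothing is then undone by `IsPolyInverse.aeval_apply_eq_iff`, which recovers the domain
of p[T] as well. -/
theorem pcomp_inverse_total_eq (hL : ∀ u : T.domain, T u = L u) {p q r : ℝ[X]}
    {A A' B B₁ M : V →L[ℝ] V} (hB : IsPolyInverse L T.domain q B)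
    (hB₁ : IsPolyInverse L T.domain r B₁) (hpr : p.natDegree ≤ r.natDegree)
    (hM : ∀ v, M v = aeval L p (B₁ (B v))) (hA : Function.Injective A)
    (hAA' : B₁ * A' = M * A) (hcB : Commute B₁ A) (hcM : Commute M A) :
    pcomp (total A).inverse (total A') = pcomp (polyOp T p) (polyOp T q).inverse := by
  refine LinearPMap.eq_of_eq_graph (Submodule.ext ?_)
  rintro ⟨v, w⟩
  have e1 : B₁ (A' v) = A (M v) := by
    have := DFunLike.congr_fun (hAA'.trans hcM.eq) v
    exact this
  have e2 : B₁ (A w) = A (B₁ w) := DFunLike.congr_fun hcB.eq w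
  have key : A' v = A w ↔ B v ∈ powDomain L T.domain p.natDegree ∧ aeval L p (B v) = w := by
    rw [← hB₁.aeval_apply_eq_iff hpr, ← hM, ← hA.eq_iff (a := M v), ← e1, ← e2,
      hB₁.apply_injective.eq_iff]
  rw [mem_pcomp_graph, mem_pcomp_graph, ← hB.total_eq hL]
  constructor
  · rintro ⟨x, hx, hx'⟩
    rw [mem_total_graph] at hx
    rw [mem_total_inverse_graph hA, hx] at hx'
    exact ⟨B v, mem_total_graph.mpr rfl, (mem_polyOp_graph hL).mpr (key.mp hx')⟩
  · rintro ⟨x, hx, hx'⟩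
    rw [mem_total_graph] at hx
    rw [mem_polyOp_graph hL, hx] at hx'
    exact ⟨A' v, mem_total_graph.mpr rfl, (mem_total_inverse_graph hA).mpr (key.mpr hx')⟩

end

theorem natDegree_one_add_X_sq_pow (m : ℕ) : ((1 + X ^ 2 : ℝ[X]) ^ m).natDegree = m * 2 := by
  rw [natDegree_pow]
  congr 1
  compute_degree!

theorem mem_cOuter_of_aeval_one_add_X_sq_pow {θ : ℝ} (hθ : θ ∈ Set.Ioo 0 (Real.pi / 2)) {m : ℕ}
    {w : ℂ} (hw : aeval w ((1 + X ^ 2 : ℝ[X]) ^ m) = 0) : w ∈ cOuter θ := by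
  have h1 : (w - I) * (w - conj I) = 0 := by
    rw [sub_I_mul]
    simpa using eq_zero_of_pow_eq_zero (by simpa using hw)
  rcases mul_eq_zero.mp h1 with h | h
  · rw [sub_eq_zero.mp h]
    exact I_mem_cOuter hθ
  · rw [sub_eq_zero.mp h]
    exact conj_mem_cOuter (I_mem_cOuter hθ)

/-- Each zero stays outside under a small enlargement of the angle, by continuity of the cosine, and
there are finitely many. -/
theorem exists_angle_of_roots {ω : ℝ} (hω : ω < Real.pi / 2) {q : ℝ[X]} (hq0 : q ≠ 0)
    (hq : ∀ w : ℂ, aeval w q = 0 → w ∈ cOuter ω) :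
    ∃ θ ∈ Set.Ioo ω (Real.pi / 2), ∀ w : ℂ, aeval w q = 0 → w ∈ cOuter θ := by
  have h1 : ∀ w ∈ q.rootSet ℂ, ∀ᶠ θ in nhdsWithin ω (Set.Ioi ω), w ∈ cOuter θ := fun w hw => by
    have hc : Filter.Tendsto (fun θ => Real.cos θ * ‖w‖) (nhdsWithin ω (Set.Ioi ω))
        (nhds (Real.cos ω * ‖w‖)) :=
      ((Real.continuous_cos.mul continuous_const).tendsto ω).mono_left nhdsWithin_le_nhds
    exact hc.eventually_const_lt (hq w (mem_rootSet.mp hw).2)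
  obtain ⟨θ, hθ, hθ'⟩ := (((q.rootSet_finite ℂ).eventually_all.mpr h1).and
    (Ioo_mem_nhdsGT hω)).exists
  exact ⟨θ, hθ', fun w hw => hθ w (mem_rootSet.mpr ⟨hq0, hw⟩)⟩

variable {n : ℕ} {E : Type*} [NormedAddCommGroup E] [NormedSpace ℝ E]
variable {T : CliffordModule n E →ₗ.[ℝ] CliffordModule n E} {ω θ φ : ℝ} {J : Cl n}

theorem mem_cOuter_of_ne_zero_on_closure (hn : 1 ≤ n) (hω : ω ∈ Set.Ioo 0 (Real.pi / 2))
    {q : ℝ[X]} (hq : ∀ s ∈ closure (doubleSector n ω), aeval s q ≠ 0) {w : ℂ}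
    (hw : aeval w q = 0) : w ∈ cOuter ω := by
  obtain ⟨J, hJ⟩ := unitSphere_nonempty hn
  by_contra h
  refine hq _ (slicePt_mem_closure_doubleSector hJ hω (z := w) (not_lt.mp h)) ?_
  rw [← planeEmb_apply hJ, aeval_planeEmb, hw, map_zero]

theorem ne_zero_of_ne_zero_on_closure (hn : 1 ≤ n) (hω : ω ∈ Set.Ioo 0 (Real.pi / 2))
    {q : ℝ[X]} (hq : ∀ s ∈ closure (doubleSector n ω), aeval s q ≠ 0) : q ≠ 0 := by
  rintro rfl
  have h : |(1 : ℂ).re| < Real.cos ω * ‖(1 : ℂ)‖ :=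
    mem_cOuter_of_ne_zero_on_closure hn hω hq (map_zero _)
  have := Real.cos_le_one ω
  norm_num at h
  linarith

theorem aeval_ne_zero_of_cOuter {q : ℝ[X]} (hq : ∀ w : ℂ, aeval w q = 0 → w ∈ cOuter θ) :
    ∀ z ∈ cDoubleSector θ, aeval z q ≠ 0 := fun z hz h0 =>
  lt_asymm (show |z.re| < _ from hq z h0) (show _ < |z.re| from hz)

variable [CompleteSpace E]

/-- The smoothing operator `(1 + T²)⁻ᵐ` and the bounded operator `(1 + T²)⁻ᵐ p[T] q[T]⁻¹`. -/
theorem exists_smoothing {L : CliffordModule n E →ₗ[ℝ] CliffordModule n E}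
    (hL : ∀ u : T.domain, T u = L u) (hT : T.IsClosed) (hω : IsBisectorial T ω)
    (hθ : θ ∈ Set.Ioo ω (Real.pi / 2)) (hφ : φ ∈ Set.Ioo ω θ) (hJ : J ∈ unitSphere n)
    {p q : ℝ[X]} {m : ℕ} (hp : p.natDegree ≤ m) (hq0 : q ≠ 0)
    (hq : ∀ w : ℂ, aeval w q = 0 → w ∈ cOuter θ) {B : CliffordModule n E →L[ℝ] CliffordModule n E}
    (hB : IsPolyInverse L T.domain q B) :
    ∃ B₁ M, IsPolyInverse L T.domain ((1 + X ^ 2) ^ m) B₁ ∧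
      (∀ v, M v = aeval L p (B₁ (B v))) ∧
      IsMultiplier (leftMul J) (pseudoResolvent T) (pseudoResolvent' T) θ φ
        (fun z => aeval z (1 : ℝ[X]) * (aeval z ((1 + X ^ 2 : ℝ[X]) ^ m))⁻¹) B₁ ∧
      IsMultiplier (leftMul J) (pseudoResolvent T) (pseudoResolvent' T) θ φ
        (fun z => (aeval z (1 : ℝ[X]) * (aeval z ((1 + X ^ 2 : ℝ[X]) ^ m))⁻¹) *
          (aeval z p * (aeval z q)⁻¹)) M := by
  have hfam := isBisectorialFamily hL hT hω hJ
  have hθ0 := hfam.theta_mem hθ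
  set r : ℝ[X] := (1 + X ^ 2) ^ m with hr
  have hr0 : r ≠ 0 := by
    refine pow_ne_zero _ fun h0 => ?_
    have := congrArg (Polynomial.eval 0) h0
    simp at this
  have hrθ : ∀ w : ℂ, aeval w r = 0 → w ∈ cOuter θ :=
    fun w => mem_cOuter_of_aeval_one_add_X_sq_pow hθ0
  have hdeg : p.natDegree ≤ (q * r).natDegree := by
    rw [natDegree_mul hq0 hr0, hr, natDegree_one_add_X_sq_pow]
    omega
  obtain ⟨B₁, hB₁, hm₁⟩ := hfam.exists_isMultiplier hθ hφ r hr0 hrθ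
  -- The fraction p / (q r) is proper because r has degree 2m ≥ deg p, whatever the degree of q.
  obtain ⟨B₂, hB₂, hm₂⟩ := hfam.exists_isMultiplier hθ hφ (q * r) (mul_ne_zero hq0 hr0)
    fun w hw => by
      rw [map_mul, mul_eq_zero] at hw
      exact hw.elim (hq w) (hrθ w)
  obtain ⟨M₁, hM₁, hM₁'⟩ := hm₁ 1 (by simp)
  obtain ⟨M, hM, hM'⟩ := hm₂ p hdeg
  have e1 : M₁ = B₁ := ContinuousLinearMap.ext fun v => by rw [hM₁ v, map_one]; rfl
  have e2 : B₂ = B₁ * B := hB₂.unique (hB.mul hB₁)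
  refine ⟨B₁, M, hB₁, fun v => ?_, e1 ▸ hM₁', hfam.isMultiplier_congr hθ hφ hM' fun z _ => ?_⟩
  · rw [hM v, e2]; rfl
  · rw [map_mul, map_one, mul_inv]; ring

/-- The regularizer is (1 + s²)⁻ᵐ with m = deg p, and its value is the injective operator (1 +
T²)⁻ᵐ. Membership in the function classes is read off by letting the multipliers act on the constant
function 1. -/
theorem isNReg_ratFun (hn : 1 ≤ n) {L : CliffordModule n E →ₗ[ℝ] CliffordModule n E}
    (hL : ∀ u : T.domain, T u = L u) (hT : T.IsClosed) (hω : IsBisectorial T ω)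
    (hθ : θ ∈ Set.Ioo ω (Real.pi / 2)) (p : ℝ[X]) {q : ℝ[X]} (hq0 : q ≠ 0)
    (hq : ∀ w : ℂ, aeval w q = 0 → w ∈ cOuter θ) {B : CliffordModule n E →L[ℝ] CliffordModule n E}
    (hB : IsPolyInverse L T.domain q B) : IsNReg T ω θ (ratFun n p q) := by
  obtain ⟨J₀, hJ₀⟩ := unitSphere_nonempty hn
  obtain ⟨φ₀, hφ₀⟩ : (Set.Ioo ω θ).Nonempty := Set.nonempty_Ioo.mpr hθ.1
  have hθ0 := (isBisectorialFamily hL hT hω hJ₀).theta_mem hθ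
  set r : ℝ[X] := (1 + X ^ 2) ^ p.natDegree with hr
  have hrep : Represents n θ (ratFun n 1 r) _ := represents_ratFun 1 r
  have hsymm := IsSymmHol.ratio (p := 1)
    (aeval_ne_zero_of_cOuter (q := r) fun w => mem_cOuter_of_aeval_one_add_X_sq_pow hθ0)
  have hval : ∀ φ ∈ Set.Ioo ω θ, ∀ J ∈ unitSphere n, ∃ B₁ M,
      IsPolyInverse L T.domain r B₁ ∧
      IsCalculusValue T J θ φ (fun z => aeval z (1 : ℝ[X]) * (aeval z r)⁻¹) B₁ ∧
      IsCalculusValue T J θ φ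
        (fun z => (aeval z (1 : ℝ[X]) * (aeval z r)⁻¹) * (aeval z p * (aeval z q)⁻¹)) M := by
    intro φ hφ J hJ
    have hfam := isBisectorialFamily hL hT hω hJ
    have h1 := hfam.isValue_one hθ hφ
    obtain ⟨B₁, M, hB₁, -, hm₁, hm⟩ := exists_smoothing hL hT hω hθ hφ hJ le_rfl hq0 hq hB
    exact ⟨B₁, M, hB₁, by simpa only [mul_one] using (hm₁ _ _ h1).1,
      by simpa only [mul_one] using (hm _ _ h1).1⟩
  -- The function classes do not depend on φ or J, so one choice of both suffices for membership;
  -- injectivity is checked for every choice.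
  obtain ⟨_, _, _, h1, h2⟩ := hval φ₀ hφ₀ J₀ hJ₀
  have he := h1.isNBnd hn hθ0 hrep
  refine ⟨(represents_ratFun p q).isIntrinsic hn hθ0
    (IsSymmHol.ratio (aeval_ne_zero_of_cOuter hq)), ratFun n 1 r, he,
    h2.isNBnd hn hθ0 (hrep.mul (represents_ratFun p q)), fun φ hφ J hJ => ?_⟩
  have hfam := isBisectorialFamily hL hT hω hJ
  obtain ⟨B₁, _, hB₁, h3, _⟩ := hval φ hφ J hJ
  rw [hfam.isValue_unique hθ hφ (isCalculusValue_extendedCalculus hn hL hT hω hθ hφ hJ hrep hsymm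
    he.isSHBnd) h3 fun _ _ => rfl]
  exact hB₁.apply_injective

/-- Both B₁ (e p/q)(T) and M e(T) are values of the function (1 + z²)⁻ᵐ e p/q, so they agree by
uniqueness; e enters only through injectivity of e(T). -/
theorem hInftyCalculus_ratFun (hn : 1 ≤ n) {L : CliffordModule n E →ₗ[ℝ] CliffordModule n E}
    (hL : ∀ u : T.domain, T u = L u) (hT : T.IsClosed) (hω : IsBisectorial T ω)
    (hθ : θ ∈ Set.Ioo ω (Real.pi / 2)) (hφ : φ ∈ Set.Ioo ω θ) (hJ : J ∈ unitSphere n)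
    {p q : ℝ[X]} (hq0 : q ≠ 0) (hq : ∀ w : ℂ, aeval w q = 0 → w ∈ cOuter θ)
    {B : CliffordModule n E →L[ℝ] CliffordModule n E} (hB : IsPolyInverse L T.domain q B)
    {e : Cl n → Cl n} (he : IsRegularizer T θ φ J e (ratFun n p q)) :
    hInftyCalculus T θ φ J e (ratFun n p q) = pcomp (polyOp T p) (polyOp T q).inverse := by
  have hfam := isBisectorialFamily hL hT hω hJ
  have hθ0 := hfam.theta_mem hθ
  obtain ⟨he1, he2, he3⟩ := he
  obtain ⟨h, hh, hrep⟩ := he1.exists_represents hn hθ0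
  obtain ⟨B₁, M, hB₁, hM, hm₁, hm⟩ := exists_smoothing hL hT hω hθ hφ hJ le_rfl hq0 hq hB
  have hA := isCalculusValue_extendedCalculus hn hL hT hω hθ hφ hJ hrep hh he1.isSHBnd
  have hA' := isCalculusValue_extendedCalculus hn hL hT hω hθ hφ hJ
    (hrep.mul (represents_ratFun p q)) (hh.mul (IsSymmHol.ratio (aeval_ne_zero_of_cOuter hq))) he2
  refine pcomp_inverse_total_eq hL hB hB₁ ?_ hM he3 ?_ (hm₁ _ _ hA).2 (hm _ _ hA).2
  · rw [natDegree_one_add_X_sq_pow]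
    omega
  · exact hfam.isValue_unique hθ hφ (hm₁ _ _ hA').1 (hm _ _ hA).1 fun z _ => by ring

end HInfty
end

/-! ### The main theorem -/

theorem mainTheorem10 {n : ℕ} (hn : 1 ≤ n) {E : Type*} [NormedAddCommGroup E] [NormedSpace ℝ E]
    [CompleteSpace E] (T : CliffordModule n E →ₗ.[ℝ] CliffordModule n E) (hT : IsClosedOp T)
    (ω : ℝ) (hω : IsBisectorial T ω) (p q : Polynomial ℝ)
    (hq : ∀ s ∈ closure (doubleSector n ω), Polynomial.aeval s q ≠ 0) :
    Function.Bijective (polyOp T q) ∧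
    ∃ θ ∈ Set.Ioo ω (Real.pi / 2),
      IsNReg T ω θ (ratFun n p q) ∧
      ∀ φ ∈ Set.Ioo ω θ, ∀ J ∈ unitSphere n, ∀ e : Cl n → Cl n,
        IsRegularizer T θ φ J e (ratFun n p q) →
          hInftyCalculus T θ φ J e (ratFun n p q) = pcomp (polyOp T p) (polyOp T q).inverse := by
  obtain ⟨L, hL⟩ := exists_linearMap_extend T
  obtain ⟨J₀, hJ₀⟩ := unitSphere_nonempty hn
  have hfam := isBisectorialFamily hL hT.closed hω hJ₀
  have hq0 := ne_zero_of_ne_zero_on_closure hn hω.angle_mem hq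
  have hqω : ∀ w : ℂ, Polynomial.aeval w q = 0 → w ∈ cOuter ω :=
    fun w => mem_cOuter_of_ne_zero_on_closure hn hω.angle_mem hq
  obtain ⟨B, hB⟩ := hfam.exists_isPolyInverse q hq0 hqω
  obtain ⟨θ, hθ, hqθ⟩ := exists_angle_of_roots hω.angle_mem.2 hq0 hqω
  exact ⟨hB.bijective hL, θ, hθ, isNReg_ratFun hn hL hT.closed hω hθ p hq0 hqθ hB,
    fun φ hφ J hJ e he => hInftyCalculus_ratFun hn hL hT.closed hω hθ hφ hJ hq0 hqθ hB he⟩
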